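/- Let $n\ge 1$, $\beta>0$, $R>0$, and let $p>1$, with $p\le n/(n-2)$ if $n\ge 3$. Let $(u_0,u_1,u_2)\in H^2(\mathbb{R}^n)\times H^1(\mathbb{R}^n)\times L^2(\mathbb{R}^n)$ be real-valued with $\operatorname{supp}u_j\subset B_R$ for $j=0,1,2$, where $B_r=\{x\in\mathbb{R}^n: |x|\le r\}$. Consider the semilinear Moore–Gibson–Thompson problem $$\beta u_{ttt}+u_{tt}-\Delta u-\beta\Delta u_t=|u|^p\quad (x\in\mathbb{R}^n,\ t>0),\qquad (u,u_t,u_{tt})(0,\cdot)=(u_0,u_1,u_2).$$ Let $K_0,K_1,K_2$ be the fundamental solutions of the linear problem (right-hand side $0$) with data $(\delta_0,0,0)$, $(0,\delta_0,0)$, $(0,0,\delta_0)$. Their Fourier transforms in $x$ (with the convention $\hat f(\xi)=\int e^{-ix\cdot\xi}f(x)\,dx$) are $$\widehat{K_0}(t,\xi)=\frac{\cos(|\xi|t)+\beta|\xi|\sin(|\xi|t)+\beta^2|\xi|^2e^{-t/\beta}}{1+\beta^2|\xi|^2},\qquad \widehat{K_1}(t,\xi)=\frac{\sin(|\xi|t)}{|\xi|},$$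 $$\widehat{K_2}(t,\xi)=\frac{\beta|\xi|^{-1}\sin(|\xi|t)-\beta^2\cos(|\xi|t)+\beta^2e^{-t/\beta}}{1+\beta^2|\xi|^2}.$$ A mild solution on $[0,T]$ is a fixed point $u=Nu$ on $[0,T]$ of the Duhamel operator $$Nu(t)=K_0(t)*u_0+K_1(t)*u_1+K_2(t)*u_2+\frac1\beta\int_0^tK_2(t-\tau)*|u(\tau)|^p\,d\tau,$$ where $|u(\tau)|^p\in L^2(\mathbb{R}^n)$ for $\tau\in[0,T]$, the convolutions are in $x$, and the integral is taken in $L^2(\mathbb{R}^n)$. Then there exist $T>0$ and a mild solution $$u\in\mathcal{C}([0,T],H^2(\mathbb{R}^n))\cap\mathcal{C}^1([0,T],H^1(\mathbb{R}^n))\cap\mathcal{C}^2([0,T],L^2(\mathbb{R}^n))$$ with $\operatorname{supp}u(t,\cdot)\subset B_{R+t}$ for all $t\in[0,T]$, and $u$ is the only mild solution on $[0,T]$ in this class of functions. -/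

import Mathlib

open MeasureTheory Set
open scoped FourierTransform SchwartzMap ENNReal

noncomputable section

namespace MGT

/-- The Euclidean space `ℝⁿ`. -/
abbrev Rn (n : ℕ) : Type := EuclideanSpace ℝ (Fin n)

/-- The space `L²(ℝⁿ)` of real-valued functions. -/
abbrev L2 (n : ℕ) : Type := Lp ℝ 2 (volume : Measure (Rn n))

/-- The space `L²(ℝⁿ; ℂ)` of complex-valued functions. -/
abbrev L2C (n : ℕ) : Type := Lp ℂ 2 (volume : Measure (Rn n))

/-- The inclusion `L²(ℝⁿ) → L²(ℝⁿ; ℂ)`. -/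
def toComplex (n : ℕ) : L2 n →L[ℝ] L2C n :=
  Complex.ofRealCLM.compLpL 2 volume

/-- `supp f ⊆ {x : |x| ≤ r}` for the (essential) support of a function in `L²`. -/
def SupportedInBall {n : ℕ} (f : L2 n) (r : ℝ) : Prop :=
  ∀ᵐ x : Rn n, x ∉ Metric.closedBall (0 : Rn n) r → f x = 0

/-! ### The Sobolev spaces `Hˢ(ℝⁿ)` of real-valued functions, as normed spaces -/

/-- `Hˢ(ℝⁿ)` (for `s ≥ 0`) as a linear subspace of `L²(ℝⁿ)`. -/
def sobolevSubmodule (n : ℕ) (s : ℝ) : Submodule ℝ (L2 n) where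
  carrier := {f | TemperedDistribution.MemSobolev s 2 (toComplex n f : 𝓢'(Rn n, ℂ))}
  add_mem' {f g} hf hg := by
    have h := TemperedDistribution.MemSobolev.add hf hg
    rw [← Lp.toTemperedDistributionCLM_apply, ← Lp.toTemperedDistributionCLM_apply,
      ← map_add, ← map_add] at h
    exact h
  zero_mem' := by
    have h := TemperedDistribution.memSobolev_fun_zero (Rn n) ℂ s 2
    rw [← map_zero (Lp.toTemperedDistributionCLM ℂ (volume : Measure (Rn n)) 2),
      ← map_zero (toComplex n)] at h
    exact h
  smul_mem' c f hf := by
    have h := TemperedDistribution.MemSobolev.smul (c : ℂ) hf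
    rw [← Lp.toTemperedDistributionCLM_apply, ← map_smul, Complex.coe_smul, ← map_smul] at h
    exact h

theorem toTemperedDistribution_injective (n : ℕ) :
    Function.Injective (fun f : L2C n => (f : 𝓢'(Rn n, ℂ))) :=
  LinearMap.ker_eq_bot.mp
    (Lp.ker_toTemperedDistributionCLM_eq_bot (F := ℂ) (μ := (volume : Measure (Rn n))) (p := 2))

theorem toComplex_injective (n : ℕ) : Function.Injective (toComplex n) := by
  intro f g h
  apply Lp.ext
  have hf := Complex.ofRealCLM.coeFn_compLpL (p := 2) (μ := (volume : Measure (Rn n))) f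
  have hg := Complex.ofRealCLM.coeFn_compLpL (p := 2) (μ := (volume : Measure (Rn n))) g
  change Complex.ofRealCLM.compLpL 2 volume f = Complex.ofRealCLM.compLpL 2 volume g at h
  rw [h] at hf
  filter_upwards [hf, hg] with x hx hy
  exact Complex.ofReal_injective (hx.symm.trans hy)

theorem exists_bessel {n : ℕ} {s : ℝ} (f : sobolevSubmodule n s) :
    ∃ g : L2C n, TemperedDistribution.besselPotential (Rn n) ℂ s
      (toComplex n f.1 : 𝓢'(Rn n, ℂ)) = g :=
  f.2

theorem real_smul_eq {n : ℕ} (c : ℝ) (g : L2C n) : c • g = (c : ℂ) • g :=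
  (Complex.coe_smul c g).symm

/-- The map `f ↦ 𝓕⁻¹ ((1 + |ξ|²) ^ (s / 2) 𝓕 f)` from `Hˢ(ℝⁿ)` to `L²(ℝⁿ; ℂ)`. -/
def besselLift (n : ℕ) (s : ℝ) : sobolevSubmodule n s →ₗ[ℝ] L2C n where
  toFun f := Classical.choose (exists_bessel f)
  map_add' f g := by
    apply toTemperedDistribution_injective n
    have hf := Classical.choose_spec (exists_bessel f)
    have hg := Classical.choose_spec (exists_bessel g)
    have hfg := Classical.choose_spec (exists_bessel (f + g))
    simp only
    rw [← hfg, ← Lp.toTemperedDistributionCLM_apply (_ + _),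
      map_add, Lp.toTemperedDistributionCLM_apply, Lp.toTemperedDistributionCLM_apply,
      ← hf, ← hg, ← map_add, Submodule.coe_add, map_add, ← Lp.toTemperedDistributionCLM_apply,
      map_add]
    rfl
  map_smul' c f := by
    apply toTemperedDistribution_injective n
    have hf := Classical.choose_spec (exists_bessel f)
    have hcf := Classical.choose_spec (exists_bessel (c • f))
    simp only [RingHom.id_apply]
    rw [← hcf, real_smul_eq, ← Lp.toTemperedDistributionCLM_apply ((c : ℂ) • _),
      map_smul, Lp.toTemperedDistributionCLM_apply, ← hf, ← map_smul, Submodule.coe_smul, map_smul,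
      real_smul_eq, ← Lp.toTemperedDistributionCLM_apply, map_smul]
    rfl

/-- The space `Hˢ(ℝⁿ)`; its norm is defined below. -/
def Sobolev (n : ℕ) (s : ℝ) : Type := sobolevSubmodule n s

instance (n : ℕ) (s : ℝ) : AddCommGroup (Sobolev n s) :=
  inferInstanceAs (AddCommGroup (sobolevSubmodule n s))

instance (n : ℕ) (s : ℝ) : Module ℝ (Sobolev n s) :=
  inferInstanceAs (Module ℝ (sobolevSubmodule n s))

/-- The inclusion `Hˢ(ℝⁿ) → L²(ℝⁿ)`. -/
def Sobolev.toL2 {n : ℕ} {s : ℝ} : Sobolev n s →ₗ[ℝ] L2 n := (sobolevSubmodule n s).subtype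

/-- The map `besselLift` on the type `Sobolev n s`. -/
def Sobolev.bessel {n : ℕ} {s : ℝ} : Sobolev n s →ₗ[ℝ] L2C n := besselLift n s

theorem Sobolev.bessel_spec {n : ℕ} {s : ℝ} (f : Sobolev n s) :
    TemperedDistribution.besselPotential (Rn n) ℂ s (toComplex n f.toL2 : 𝓢'(Rn n, ℂ))
      = (Sobolev.bessel f : L2C n) :=
  Classical.choose_spec (exists_bessel f)

theorem Sobolev.bessel_injective {n : ℕ} {s : ℝ} :
    Function.Injective (Sobolev.bessel : Sobolev n s →ₗ[ℝ] L2C n) := by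
  intro f g h
  have hf := f.bessel_spec
  have hg := g.bessel_spec
  rw [h, ← hg] at hf
  have h2 := congrArg (TemperedDistribution.besselPotential (Rn n) ℂ (-s)) hf
  simp only [TemperedDistribution.besselPotential_besselPotential_apply, add_neg_cancel,
    TemperedDistribution.besselPotential_zero, ContinuousLinearMap.id_apply] at h2
  exact Subtype.ext (toComplex_injective n (toTemperedDistribution_injective n h2))

/-- The norm of `Hˢ(ℝⁿ)` is `‖f‖ = ‖(1 + |ξ|²) ^ (s / 2) 𝓕 f‖_{L²}`. -/
instance (n : ℕ) (s : ℝ) : NormedAddCommGroup (Sobolev n s) :=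
  NormedAddCommGroup.induced (Sobolev n s) (L2C n) Sobolev.bessel Sobolev.bessel_injective

instance (n : ℕ) (s : ℝ) : NormedSpace ℝ (Sobolev n s) :=
  NormedSpace.induced ℝ (Sobolev n s) (L2C n) Sobolev.bessel

/-- The restriction of `u` to `[0, T]` belongs to `C^k([0, T], Hˢ(ℝⁿ))`, with one-sided
derivatives at the endpoints. -/
def IsCkSobolev {n : ℕ} (k : ℕ) (s T : ℝ) (u : ℝ → L2 n) : Prop :=
  ∃ v : ℝ → Sobolev n s, ContDiffOn ℝ k v (Icc 0 T) ∧ ∀ t ∈ Icc 0 T, (v t).toL2 = u t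

/-- `u ∈ C([0, T], H²(ℝⁿ)) ∩ C¹([0, T], H¹(ℝⁿ)) ∩ C²([0, T], L²(ℝⁿ))`. -/
def IsInEnergyClass {n : ℕ} (T : ℝ) (u : ℝ → L2 n) : Prop :=
  IsCkSobolev 0 2 T u ∧ IsCkSobolev 1 1 T u ∧ ContDiffOn ℝ 2 u (Icc 0 T)

/-! ### The fundamental solutions of the linear equation

With `r = |η|`, the functions `symbol₀`, `symbol₁`, `symbol₂` of `t` are the solutions of
`β y''' + y'' + r² y + β r² y' = 0` with `(y, y', y'')(0)` equal to `(1, 0, 0)`, `(0, 1, 0)` and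
`(0, 0, 1)`. Here `η` is the frequency for the convention `∫ exp(-i x·η) f(x) dx`. -/

/-- The Fourier transform of the fundamental solution for the data `(δ₀, 0, 0)`, at `|η| = r`. -/
def symbol₀ (β t r : ℝ) : ℝ :=
  (Real.cos (r * t) + β * r * Real.sin (r * t) + β ^ 2 * r ^ 2 * Real.exp (-t / β))
    / (1 + β ^ 2 * r ^ 2)

/-- The Fourier transform of the fundamental solution for the data `(0, δ₀, 0)`, at `|η| = r`;
this is `sin (r t) / r`, continuously extended to `r = 0`. -/
def symbol₁ (t r : ℝ) : ℝ := t * Real.sinc (r * t)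

/-- The Fourier transform of the fundamental solution for the data `(0, 0, δ₀)`, at `|η| = r`. -/
def symbol₂ (β t r : ℝ) : ℝ :=
  (β * (t * Real.sinc (r * t)) - β ^ 2 * Real.cos (r * t) + β ^ 2 * Real.exp (-t / β))
    / (1 + β ^ 2 * r ^ 2)

/-- A radial symbol, as a function of Mathlib's frequency variable `ξ = η / (2 π)`. -/
def radial (n : ℕ) (m : ℝ → ℝ) (ξ : Rn n) : ℂ := (m (2 * Real.pi * ‖ξ‖) : ℂ)

theorem radial_memLp (n : ℕ) {m : ℝ → ℝ} {C : ℝ} (hm : Continuous m) (hC : ∀ r, |m r| ≤ C) :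
    MemLp (radial n m) ∞ (volume : Measure (Rn n)) := by
  refine memLp_top_of_bound (C := C) ?_ (Filter.Eventually.of_forall fun ξ => ?_)
  · exact (Complex.continuous_ofReal.comp (hm.comp (by fun_prop))).aestronglyMeasurable
  · simpa [radial] using hC (2 * Real.pi * ‖ξ‖)

theorem symbol₀_memLp (n : ℕ) (β t : ℝ) :
    MemLp (radial n (symbol₀ β t)) ∞ (volume : Measure (Rn n)) := by
  refine radial_memLp n (C := 2 + Real.exp (-t / β)) ?_ fun r => ?_
  · unfold symbol₀
    exact Continuous.div (by fun_prop) (by fun_prop) fun r => by positivity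
  · have hD : 0 < 1 + β ^ 2 * r ^ 2 := by positivity
    have he := Real.exp_pos (-t / β)
    have h1 := Real.abs_cos_le_one (r * t)
    have h2 : |β * r * Real.sin (r * t)| ≤ |β * r| := by
      rw [abs_mul]
      exact mul_le_of_le_one_right (abs_nonneg _) (Real.abs_sin_le_one _)
    have h3 : |β * r| ≤ 1 + β ^ 2 * r ^ 2 := by
      nlinarith [sq_abs (β * r), sq_nonneg (|β * r| - 1)]
    rw [symbol₀, abs_div, abs_of_pos hD, div_le_iff₀ hD]
    have h4 : |β ^ 2 * r ^ 2 * Real.exp (-t / β)| = β ^ 2 * r ^ 2 * Real.exp (-t / β) :=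
      abs_of_nonneg (by positivity)
    have h5 := abs_add_three (Real.cos (r * t)) (β * r * Real.sin (r * t))
      (β ^ 2 * r ^ 2 * Real.exp (-t / β))
    have h6 : 0 ≤ β ^ 2 * r ^ 2 := by positivity
    nlinarith

theorem symbol₁_memLp (n : ℕ) (t : ℝ) :
    MemLp (radial n (symbol₁ t)) ∞ (volume : Measure (Rn n)) := by
  refine radial_memLp n (C := |t|) ?_ fun r => ?_
  · unfold symbol₁
    exact continuous_const.mul (Real.continuous_sinc.comp (by fun_prop))
  · rw [symbol₁, abs_mul]
    exact mul_le_of_le_one_right (abs_nonneg _) (Real.abs_sinc_le_one _)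

theorem symbol₂_memLp (n : ℕ) (β t : ℝ) :
    MemLp (radial n (symbol₂ β t)) ∞ (volume : Measure (Rn n)) := by
  refine radial_memLp n (C := |β| * |t| + β ^ 2 + β ^ 2 * Real.exp (-t / β)) ?_ fun r => ?_
  · unfold symbol₂
    have := Real.continuous_sinc
    exact Continuous.div (by fun_prop) (by fun_prop) fun r => by positivity
  · have hD : 1 ≤ 1 + β ^ 2 * r ^ 2 := le_add_of_nonneg_right (by positivity)
    have h1 : |β * (t * Real.sinc (r * t))| ≤ |β| * |t| := by
      rw [abs_mul, abs_mul]
      exact mul_le_mul_of_nonneg_left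
        (mul_le_of_le_one_right (abs_nonneg _) (Real.abs_sinc_le_one _)) (abs_nonneg _)
    have h2 : |β ^ 2 * Real.cos (r * t)| ≤ β ^ 2 := by
      rw [abs_mul, abs_of_nonneg (sq_nonneg β)]
      exact mul_le_of_le_one_right (sq_nonneg β) (Real.abs_cos_le_one _)
    have h3 : |β ^ 2 * Real.exp (-t / β)| = β ^ 2 * Real.exp (-t / β) :=
      abs_of_nonneg (by positivity)
    have h4 := abs_add_le (β * (t * Real.sinc (r * t)) - β ^ 2 * Real.cos (r * t))
      (β ^ 2 * Real.exp (-t / β))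
    have h5 := abs_sub (β * (t * Real.sinc (r * t))) (β ^ 2 * Real.cos (r * t))
    rw [symbol₂, abs_div, abs_of_pos (lt_of_lt_of_le one_pos hD)]
    refine (div_le_self (abs_nonneg _) hD).trans ?_
    linarith

/-- The Fourier multiplier `f ↦ 𝓕⁻¹ (m 𝓕 f)` on `L²` with bounded symbol `m`, that is, the
convolution in `x` of `f` with the kernel `𝓕⁻¹ m`. -/
def convolve {n : ℕ} {m : Rn n → ℂ} (hm : MemLp m ∞ (volume : Measure (Rn n))) (f : L2 n) :
    L2C n :=
  𝓕⁻ ((hm.toLp m • 𝓕 (toComplex n f) : L2C n))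

/-- `f ↦ K₀(t, ·) ∗ f`. -/
def K₀ {n : ℕ} (β t : ℝ) (f : L2 n) : L2C n := convolve (symbol₀_memLp n β t) f

/-- `f ↦ K₁(t, ·) ∗ f`. -/
def K₁ {n : ℕ} (t : ℝ) (f : L2 n) : L2C n := convolve (symbol₁_memLp n t) f

/-- `f ↦ K₂(t, ·) ∗ f`. -/
def K₂ {n : ℕ} (β t : ℝ) (f : L2 n) : L2C n := convolve (symbol₂_memLp n β t) f

/-! ### Mild solutions -/

open Classical in
/-- The nonlinearity `|f|^p` as an element of `L²` (only used when `|f|^p` is in `L²`). -/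
def absPow {n : ℕ} (p : ℝ) (f : L2 n) : L2 n :=
  if h : MemLp (fun x => |f x| ^ p) 2 (volume : Measure (Rn n)) then h.toLp _ else 0

/-- The Duhamel operator
`N u (t) = K₀(t) ∗ u₀ + K₁(t) ∗ u₁ + K₂(t) ∗ u₂ + (1/β) ∫₀ᵗ K₂(t - τ) ∗ |u(τ)|^p dτ`
(with a Bochner integral in `L²`). The factor `1/β` is due to the coefficient `β` of `u_ttt`. -/
def duhamel {n : ℕ} (β p : ℝ) (u₀ u₁ u₂ : L2 n) (u : ℝ → L2 n) (t : ℝ) : L2C n :=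
  K₀ β t u₀ + K₁ t u₁ + K₂ β t u₂ + (1 / β) • ∫ τ in (0 : ℝ)..t, K₂ β (t - τ) (absPow p (u τ))

/-- `u` is a mild solution on `[0, T]` of
`β u_ttt + u_tt - Δ u - β Δ u_t = |u|^p`, `(u, u_t, u_tt)(0) = (u₀, u₁, u₂)`:
it is a fixed point of the Duhamel operator, whose integrals make sense in `L²`. -/
structure IsMildSolution {n : ℕ} (β p : ℝ) (u₀ u₁ u₂ : L2 n) (T : ℝ) (u : ℝ → L2 n) : Prop where
  memLp : ∀ t ∈ Icc 0 T, MemLp (fun x => |u t x| ^ p) 2 (volume : Measure (Rn n))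
  integrable : ∀ t ∈ Icc 0 T,
    IntervalIntegrable (fun τ => K₂ β (t - τ) (absPow p (u τ))) volume 0 t
  fixedPoint : ∀ t ∈ Icc 0 T, toComplex n (u t) = duhamel β p u₀ u₁ u₂ u t

end MGT

end

open MeasureTheory Set
open scoped FourierTransform SchwartzMap ENNReal

noncomputable section

namespace MGT

/-! The operator factors as (β∂ₜ + 1)(∂ₜ² − Δ), so y = u + βuₜ solves a wave equation with source
|u|^p, and u is recovered from y by a first-order ODE in time. Two facts follow, and they carry the
theorem.

Smoothing. The symbol of K₂(t) is O(⟨ξ⟩⁻²), locally uniformly in t, and each time derivative costs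
one power of |ξ| (`isEnergyFamily_symbol₂`). Hence K₂ maps L² to H². The bound on p makes H² ⊂
L^{2p} strictly subcritical, so |u|^p is locally Lipschitz from H² to L² (`absPow_sobolev`). The
Duhamel map is therefore a contraction on C([0,T], H²) for small T (`exists_mild_solution`), and
Gronwall gives uniqueness in C([0,T], H²) without smallness (`mild_solution_unique`). Since K₂ and
∂ₜK₂ vanish at t = 0, the Duhamel integral can be differentiated twice in time although the source
is only continuous (`hasDerivAt_duhamel`); this gives the C¹H¹ and C²L² regularity.

Finite speed. All three symbols have the form c + ∫₀ᵗ w(s) cos(sr) ds with r the angular frequency,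
so it is enough to treat cos(sr). On the Fourier side this function is a limit of leapfrog schemes:
cos(Nθ) is a Chebyshev polynomial in cos θ, and cos θ is a combination of cosines, that is, of
translations. With anisotropic weights, N steps move at most t in a prescribed direction ω
(`annihilated_cos`). Pairing with the part of the solution in a half-space ω·x > ρ + t shows that
this part is zero, and the half-spaces exhaust the complement of the ball. The same argument applied
to the imaginary part shows that the kernels preserve real functions.

The cone condition is closed in H² and preserved by the Duhamel map, so it is built into the set on
which the contraction acts. -/

/-! ### Multiplication operators on `L²(ℝⁿ; ℂ)` -/

/-- Bounded continuous functions, as symbols of multiplication operators. -/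
def IsSymbol {n : ℕ} (a : Rn n → ℝ) : Prop :=
  Continuous a ∧ ∃ C, ∀ ξ, |a ξ| ≤ C

theorem IsSymbol.memLp {n : ℕ} {a : Rn n → ℝ} (h : IsSymbol a) :
    MemLp (fun ξ => (a ξ : ℂ)) ∞ (volume : Measure (Rn n)) := by
  obtain ⟨hc, C, hC⟩ := h
  refine memLp_top_of_bound (C := C) ?_ (Filter.Eventually.of_forall fun ξ => ?_)
  · exact (Complex.continuous_ofReal.comp hc).aestronglyMeasurable
  · simpa using hC ξ

theorem IsSymbol.mul {n : ℕ} {a b : Rn n → ℝ} (ha : IsSymbol a) (hb : IsSymbol b) :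
    IsSymbol (fun ξ => a ξ * b ξ) := by
  obtain ⟨hca, A, hA⟩ := ha
  obtain ⟨hcb, B, hB⟩ := hb
  refine ⟨hca.mul hcb, A * B, fun ξ => ?_⟩
  rw [abs_mul]
  exact mul_le_mul (hA ξ) (hB ξ) (abs_nonneg _) ((abs_nonneg _).trans (hA ξ))

theorem IsSymbol.sub {n : ℕ} {a b : Rn n → ℝ} (ha : IsSymbol a) (hb : IsSymbol b) :
    IsSymbol (fun ξ => a ξ - b ξ) := by
  obtain ⟨hca, A, hA⟩ := ha
  obtain ⟨hcb, B, hB⟩ := hb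
  exact ⟨hca.sub hcb, A + B, fun ξ => (abs_sub _ _).trans (add_le_add (hA ξ) (hB ξ))⟩

theorem IsSymbol.const_mul {n : ℕ} {a : Rn n → ℝ} (c : ℝ) (ha : IsSymbol a) :
    IsSymbol (fun ξ => c * a ξ) :=
  IsSymbol.mul ⟨continuous_const, |c|, fun _ => le_rfl⟩ ha

open Classical in
/-- Multiplication by a bounded continuous real function on `L²(ℝⁿ; ℂ)`. -/
def mulOp {n : ℕ} (a : Rn n → ℝ) : L2C n →L[ℂ] L2C n :=
  if h : IsSymbol a then
    (ContinuousLinearMap.lsmul ℂ ℂ).holderL volume ∞ 2 2 h.memLp.toLp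
  else 0

theorem coeFn_mulOp {n : ℕ} {a : Rn n → ℝ} (h : IsSymbol a) (f : L2C n) :
    mulOp a f =ᵐ[volume] fun ξ => (a ξ : ℂ) * f ξ := by
  rw [mulOp, dif_pos h]
  filter_upwards [(ContinuousLinearMap.lsmul ℂ ℂ).coeFn_holder (r := 2) h.memLp.toLp f,
    h.memLp.coeFn_toLp] with ξ h1 h2
  simp only [ContinuousLinearMap.holderL_apply_apply]
  rw [h1, h2]
  simp

theorem mulOp_eq_of_ae {n : ℕ} {a : Rn n → ℝ} (h : IsSymbol a) {f g : L2C n}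
    (hfg : ∀ᵐ ξ, g ξ = (a ξ : ℂ) * f ξ) : mulOp a f = g := by
  apply Lp.ext
  filter_upwards [coeFn_mulOp h f, hfg] with ξ h1 h2
  rw [h1, h2]

theorem norm_mulOp_le {n : ℕ} {a : Rn n → ℝ} {C : ℝ} (h : Continuous a)
    (hC : ∀ ξ, |a ξ| ≤ C) (f : L2C n) : ‖mulOp a f‖ ≤ C * ‖f‖ := by
  refine Lp.norm_le_mul_norm_of_ae_le_mul ?_
  filter_upwards [coeFn_mulOp ⟨h, C, hC⟩ f] with ξ h1
  rw [h1, norm_mul, Complex.norm_real, Real.norm_eq_abs]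
  exact mul_le_mul_of_nonneg_right (hC ξ) (norm_nonneg _)

theorem mulOp_mulOp {n : ℕ} {a b : Rn n → ℝ} (ha : IsSymbol a) (hb : IsSymbol b) (f : L2C n) :
    mulOp a (mulOp b f) = mulOp (fun ξ => a ξ * b ξ) f := by
  refine (mulOp_eq_of_ae (ha.mul hb) ?_).symm
  filter_upwards [coeFn_mulOp ha (mulOp b f), coeFn_mulOp hb f] with ξ h1 h2
  rw [h1, h2]
  push_cast
  ring

theorem mulOp_sub {n : ℕ} {a b : Rn n → ℝ} (ha : IsSymbol a) (hb : IsSymbol b) (f : L2C n) :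
    mulOp (fun ξ => a ξ - b ξ) f = mulOp a f - mulOp b f := by
  refine mulOp_eq_of_ae (ha.sub hb) ?_
  filter_upwards [coeFn_mulOp ha f, coeFn_mulOp hb f, Lp.coeFn_sub (mulOp a f) (mulOp b f)]
    with ξ h1 h2 h3
  rw [h3, Pi.sub_apply, h1, h2]
  push_cast
  ring

theorem mulOp_const_mul {n : ℕ} {a : Rn n → ℝ} (ha : IsSymbol a) (c : ℝ) (f : L2C n) :
    mulOp (fun ξ => c * a ξ) f = c • mulOp a f := by
  refine mulOp_eq_of_ae (ha.const_mul c) ?_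
  filter_upwards [coeFn_mulOp ha f, Lp.coeFn_smul c (mulOp a f)] with ξ h1 h2
  rw [h2, Pi.smul_apply, h1, Complex.real_smul]
  push_cast
  ring

theorem norm_sq_eq_integral {n : ℕ} (f : L2C n) : ‖f‖ ^ 2 = ∫ ξ, ‖f ξ‖ ^ 2 := by
  have h := L2.inner_def (𝕜 := ℂ) f f
  rw [inner_self_eq_norm_sq_to_K] at h
  simp only [inner_self_eq_norm_sq_to_K] at h
  have h2 : ((‖f‖ ^ 2 : ℝ) : ℂ) = ((∫ ξ, ‖f ξ‖ ^ 2 : ℝ) : ℂ) := by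
    rw [← integral_complex_ofReal]
    push_cast
    exact h
  exact_mod_cast h2

theorem integrable_norm_sq {n : ℕ} (f : L2C n) : Integrable (fun ξ => ‖f ξ‖ ^ 2) volume :=
  (memLp_two_iff_integrable_sq_norm (Lp.aestronglyMeasurable f)).1 (Lp.memLp f)

/-- Dominated convergence for |a_k f|² with majorant C²|f|². Pointwise convergence of the symbols
gives strong convergence only, not convergence in operator norm. The general filter serves both
continuity and difference quotients. -/
theorem tendsto_mulOp_zero {n : ℕ} {ι : Type*} {l : Filter ι} [l.IsCountablyGenerated]
    {a : ι → Rn n → ℝ} {C : ℝ} (h : ∀ᶠ k in l, Continuous (a k) ∧ ∀ ξ, |a k ξ| ≤ C)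
    (h0 : ∀ ξ, Filter.Tendsto (fun k => a k ξ) l (nhds 0)) (f : L2C n) :
    Filter.Tendsto (fun k => mulOp (a k) f) l (nhds 0) := by
  have key : Filter.Tendsto (fun k => ∫ ξ, ‖(a k ξ : ℂ) * f ξ‖ ^ 2) l
      (nhds (∫ _ : Rn n, (0 : ℝ))) := by
    refine tendsto_integral_filter_of_dominated_convergence (fun ξ => C ^ 2 * ‖f ξ‖ ^ 2)
      ?_ ?_ ((integrable_norm_sq f).const_mul _) ?_
    · filter_upwards [h] with k hk
      exact ((((Complex.continuous_ofReal.comp hk.1).aestronglyMeasurable).mul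
        (Lp.aestronglyMeasurable f)).norm.pow 2)
    · filter_upwards [h] with k hk
      refine Filter.Eventually.of_forall fun ξ => ?_
      rw [Real.norm_of_nonneg (by positivity), norm_mul, mul_pow, Complex.norm_real,
        Real.norm_eq_abs]
      gcongr
      exact hk.2 ξ
    · refine Filter.Eventually.of_forall fun ξ => ?_
      have h1 : Filter.Tendsto (fun k => (|a k ξ| * ‖f ξ‖) ^ 2) l
          (nhds ((|0| * ‖f ξ‖) ^ 2)) := (((h0 ξ).abs).mul_const _).pow 2
      simpa [norm_mul] using h1
  rw [integral_zero] at key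
  rw [tendsto_zero_iff_norm_tendsto_zero]
  have h2 : Filter.Tendsto (fun k => ‖mulOp (a k) f‖ ^ 2) l (nhds 0) := by
    refine key.congr' ?_
    filter_upwards [h] with k hk
    rw [norm_sq_eq_integral]
    refine integral_congr_ae ?_
    filter_upwards [coeFn_mulOp ⟨hk.1, C, hk.2⟩ f] with ξ hξ
    rw [hξ]
  have h3 := h2.sqrt
  simpa [Real.sqrt_sq] using h3

/-- Families of bounded continuous functions which depend continuously on time, with bounds
that are locally uniform in time. -/
def IsSymbolFamily {n : ℕ} (a : ℝ → Rn n → ℝ) : Prop :=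
  Continuous (Function.uncurry a) ∧ ∀ b, ∃ C, ∀ t, |t| ≤ b → ∀ ξ, |a t ξ| ≤ C

theorem IsSymbolFamily.isSymbol {n : ℕ} {a : ℝ → Rn n → ℝ} (h : IsSymbolFamily a) (t : ℝ) :
    IsSymbol (a t) := by
  obtain ⟨C, hC⟩ := h.2 |t|
  exact ⟨h.1.comp (by fun_prop : Continuous fun ξ : Rn n => (t, ξ)), C, hC t le_rfl⟩

theorem IsSymbolFamily.exists_norm_le {n : ℕ} {a : ℝ → Rn n → ℝ} (h : IsSymbolFamily a)
    (b : ℝ) : ∃ C, 0 ≤ C ∧ ∀ t, |t| ≤ b → ∀ f : L2C n, ‖mulOp (a t) f‖ ≤ C * ‖f‖ := by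
  obtain ⟨C, hC⟩ := h.2 b
  refine ⟨max C 0, le_max_right _ _, fun t ht f => ?_⟩
  exact norm_mulOp_le (h.isSymbol t).1 (fun ξ => (hC t ht ξ).trans (le_max_left _ _)) f

theorem IsSymbolFamily.add {n : ℕ} {a b : ℝ → Rn n → ℝ} (ha : IsSymbolFamily a)
    (hb : IsSymbolFamily b) : IsSymbolFamily (fun t ξ => a t ξ + b t ξ) := by
  refine ⟨ha.1.add hb.1, fun r => ?_⟩
  obtain ⟨A, hA⟩ := ha.2 r
  obtain ⟨B, hB⟩ := hb.2 r
  exact ⟨A + B, fun t ht ξ => (abs_add_le _ _).trans (add_le_add (hA t ht ξ) (hB t ht ξ))⟩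

theorem IsSymbolFamily.mul {n : ℕ} {a b : ℝ → Rn n → ℝ} (ha : IsSymbolFamily a)
    (hb : IsSymbolFamily b) : IsSymbolFamily (fun t ξ => a t ξ * b t ξ) := by
  refine ⟨ha.1.mul hb.1, fun r => ?_⟩
  obtain ⟨A, hA⟩ := ha.2 r
  obtain ⟨B, hB⟩ := hb.2 r
  refine ⟨A * B, fun t ht ξ => ?_⟩
  rw [abs_mul]
  exact mul_le_mul (hA t ht ξ) (hB t ht ξ) (abs_nonneg _) ((abs_nonneg _).trans (hA t ht ξ))

theorem IsSymbolFamily.of_isSymbol {n : ℕ} {a : Rn n → ℝ} (ha : IsSymbol a) :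
    IsSymbolFamily (fun _ => a) :=
  ⟨ha.1.comp continuous_snd, fun _ => ha.2.imp fun _ hC _ _ => hC⟩

theorem IsSymbolFamily.of_time {n : ℕ} {c : ℝ → ℝ} (hc : Continuous c) :
    IsSymbolFamily (fun t (_ : Rn n) => c t) := by
  refine ⟨hc.comp continuous_fst, fun b => ?_⟩
  obtain ⟨C, hC⟩ := (isCompact_Icc (a := -b) (b := b)).exists_bound_of_continuousOn
    hc.continuousOn
  exact ⟨C, fun t ht _ => hC t (abs_le.1 ht)⟩

theorem IsSymbolFamily.neg {n : ℕ} {a : ℝ → Rn n → ℝ} (ha : IsSymbolFamily a) :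
    IsSymbolFamily (fun t ξ => -a t ξ) :=
  ⟨ha.1.neg, fun r => (ha.2 r).imp fun _ hC t ht ξ => by rw [abs_neg]; exact hC t ht ξ⟩

theorem IsSymbolFamily.sub {n : ℕ} {a b : ℝ → Rn n → ℝ} (ha : IsSymbolFamily a)
    (hb : IsSymbolFamily b) : IsSymbolFamily (fun t ξ => a t ξ - b t ξ) := by
  simpa only [sub_eq_add_neg] using ha.add hb.neg

/-- A multiplication operator family is jointly continuous in time and in the function. -/
theorem IsSymbolFamily.continuous_mulOp {n : ℕ} {a : ℝ → Rn n → ℝ} (h : IsSymbolFamily a) :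
    Continuous (fun q : ℝ × L2C n => mulOp (a q.1) q.2) := by
  rw [continuous_iff_continuousAt]
  rintro ⟨t₀, f₀⟩
  obtain ⟨C, hC0, hC⟩ := h.exists_norm_le (|t₀| + 1)
  obtain ⟨D, hD⟩ := h.2 (|t₀| + 1)
  have hev : ∀ᶠ t in nhds t₀, |t| ≤ |t₀| + 1 := by
    have : Filter.Tendsto (fun t : ℝ => |t|) (nhds t₀) (nhds |t₀|) := continuous_abs.tendsto _
    exact (this.eventually_lt_const (by linarith)).mono fun _ h => h.le
  -- Strong continuity is used at the fixed `f₀` only; the change of the function is absorbed by the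
  -- locally uniform operator bound `hC`.
  have h1 : Filter.Tendsto (fun t => mulOp (fun ξ => a t ξ - a t₀ ξ) f₀) (nhds t₀) (nhds 0) := by
    refine tendsto_mulOp_zero (C := D + D) ?_ ?_ f₀
    · filter_upwards [hev] with t ht
      refine ⟨((h.isSymbol t).sub (h.isSymbol t₀)).1, fun ξ => (abs_sub _ _).trans ?_⟩
      exact add_le_add (hD t ht ξ) (hD t₀ (by linarith) ξ)
    · intro ξ
      have hc : Continuous (fun t => a t ξ - a t₀ ξ) :=
        (h.1.comp (by fun_prop : Continuous fun t : ℝ => (t, ξ))).sub continuous_const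
      simpa using hc.tendsto t₀
  rw [ContinuousAt, tendsto_iff_norm_sub_tendsto_zero]
  have h2 : Filter.Tendsto (fun q : ℝ × L2C n =>
      C * ‖q.2 - f₀‖ + ‖mulOp (fun ξ => a q.1 ξ - a t₀ ξ) f₀‖) (nhds (t₀, f₀)) (nhds 0) := by
    have e1 : Filter.Tendsto (fun q : ℝ × L2C n => C * ‖q.2 - f₀‖) (nhds (t₀, f₀)) (nhds 0) := by
      have : Continuous (fun q : ℝ × L2C n => C * ‖q.2 - f₀‖) := by fun_prop
      simpa using this.tendsto (t₀, f₀)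
    have e2 := (h1.comp (continuous_fst.tendsto (t₀, f₀))).norm
    simpa using e1.add e2
  refine squeeze_zero' (Filter.Eventually.of_forall fun _ => norm_nonneg _) ?_ h2
  filter_upwards [(continuous_fst.tendsto (t₀, f₀)).eventually hev] with q hq
  have e : mulOp (a q.1) q.2 - mulOp (a t₀) f₀
      = mulOp (a q.1) (q.2 - f₀) + mulOp (fun ξ => a q.1 ξ - a t₀ ξ) f₀ := by
    rw [mulOp_sub (h.isSymbol _) (h.isSymbol _), map_sub]
    abel
  rw [e]
  exact (norm_add_le _ _).trans (add_le_add (hC _ hq _) le_rfl)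

/-- Strong differentiability of a multiplication operator family. -/
theorem IsSymbolFamily.hasDerivAt_mulOp {n : ℕ} {a a' : ℝ → Rn n → ℝ} (h : IsSymbolFamily a)
    (h' : IsSymbolFamily a') (hd : ∀ t ξ, HasDerivAt (fun s => a s ξ) (a' t ξ) t)
    (f : L2C n) (t : ℝ) : HasDerivAt (fun s => mulOp (a s) f) (mulOp (a' t) f) t := by
  rw [hasDerivAt_iff_tendsto_slope_zero]
  obtain ⟨D, hD⟩ := h'.2 (|t| + 1)
  -- The mean value inequality bounds the difference quotients by `D` uniformly in ξ, which provides
  -- the majorant for dominated convergence.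
  have hmv : ∀ s : ℝ, |s| ≤ 1 → ∀ ξ, |a (t + s) ξ - a t ξ| ≤ D * |s| := by
    intro s hs ξ
    have := Convex.norm_image_sub_le_of_norm_hasDerivWithin_le (f := fun r => a r ξ)
      (f' := fun r => a' r ξ) (s := Icc (-(|t| + 1)) (|t| + 1)) (C := D) (x := t) (y := t + s)
      (fun r _ => (hd r ξ).hasDerivWithinAt) (fun r hr => hD r (abs_le.2 hr) ξ)
      (convex_Icc _ _) (abs_le.1 (by linarith [abs_nonneg t]))
      (abs_le.1 ((abs_add_le _ _).trans (by linarith)))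
    simpa using this
  have hsm : ∀ s : ℝ, IsSymbol (fun ξ => s⁻¹ * (a (t + s) ξ - a t ξ) - a' t ξ) := fun s =>
    (((h.isSymbol _).sub (h.isSymbol t)).const_mul s⁻¹).sub (h'.isSymbol t)
  have key : Filter.Tendsto (fun s : ℝ =>
      mulOp (fun ξ => s⁻¹ * (a (t + s) ξ - a t ξ) - a' t ξ) f) (nhdsWithin 0 {0}ᶜ) (nhds 0) := by
    refine tendsto_mulOp_zero (C := D + D) ?_ ?_ f
    · have hev : ∀ᶠ s : ℝ in nhdsWithin 0 {0}ᶜ, |s| < 1 := by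
        refine nhdsWithin_le_nhds ?_
        have : Filter.Tendsto (fun t : ℝ => |t|) (nhds 0) (nhds |0|) := continuous_abs.tendsto _
        exact this.eventually_lt_const (by simp)
      filter_upwards [hev, self_mem_nhdsWithin] with s hs hs0
      refine ⟨(hsm s).1, fun ξ => (abs_sub _ _).trans (add_le_add ?_ (hD t (by linarith) ξ))⟩
      rw [abs_mul, abs_inv, inv_mul_le_iff₀ (abs_pos.2 hs0), mul_comm]
      exact hmv s hs.le ξ
    · intro ξ
      have := (hasDerivAt_iff_tendsto_slope_zero.1 (hd t ξ)).sub_const (a' t ξ)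
      simpa using this
  have := key.add_const (mulOp (a' t) f)
  rw [zero_add] at this
  refine this.congr fun s => ?_
  rw [mulOp_sub (((h.isSymbol _).sub (h.isSymbol t)).const_mul s⁻¹) (h'.isSymbol t),
    mulOp_const_mul ((h.isSymbol _).sub (h.isSymbol t)), mulOp_sub (h.isSymbol _) (h.isSymbol t)]
  abel

/-! ### Pairings in Fourier space -/

theorem coeFn_toComplex {n : ℕ} (f : L2 n) : toComplex n f =ᵐ[volume] fun x => (f x : ℂ) :=
  Complex.ofRealCLM.coeFn_compLpL (p := 2) (μ := (volume : Measure (Rn n))) f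

/-- Translation by `v` on `L²(ℝⁿ; ℂ)`. -/
def translate {n : ℕ} (v : Rn n) : L2C n →+ L2C n :=
  Lp.compMeasurePreserving (fun x => x + v) (measurePreserving_add_right volume v)

theorem coeFn_translate {n : ℕ} (v : Rn n) (f : L2C n) :
    translate v f =ᵐ[volume] fun x => f (x + v) :=
  Lp.coeFn_compMeasurePreserving f (measurePreserving_add_right volume v)

theorem continuous_translate {n : ℕ} (v : Rn n) : Continuous (translate (n := n) v) :=
  (Lp.isometry_compMeasurePreserving (measurePreserving_add_right volume v)).continuous

/-- The character `ξ ↦ exp (2 π i v·ξ)`. -/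
def character {n : ℕ} (v ξ : Rn n) : ℂ := Real.fourierChar (inner ℝ v ξ)

theorem continuous_character {n : ℕ} (v : Rn n) : Continuous (character v) := by
  unfold character
  exact continuous_subtype_val.comp (Real.continuous_fourierChar.comp (by fun_prop))

theorem norm_character {n : ℕ} (v ξ : Rn n) : ‖character v ξ‖ = 1 :=
  Circle.norm_coe _

theorem character_memLp {n : ℕ} (v : Rn n) :
    MemLp (character v) ∞ (volume : Measure (Rn n)) :=
  memLp_top_of_bound (C := 1) (continuous_character v).aestronglyMeasurable
    (Filter.Eventually.of_forall fun ξ => (norm_character v ξ).le)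

/-- Checked on Schwartz functions, where the Fourier transform is an integral, and extended by
density since both sides are continuous in `f`. -/
theorem fourier_translate {n : ℕ} (v : Rn n) (f : L2C n) :
    𝓕 (translate v f) = ((character_memLp v).toLp • 𝓕 f : L2C n) := by
  apply DenseRange.induction_on
    (p := fun f : L2C n => 𝓕 (translate v f) = ((character_memLp v).toLp • 𝓕 f : L2C n))
    (SchwartzMap.denseRange_toLpCLM (p := 2) ENNReal.ofNat_ne_top) f
  · apply isClosed_eq
    · exact (Lp.fourierTransformₗᵢ (Rn n) ℂ).continuous.comp (continuous_translate v)
    · have h1 : Continuous ((ContinuousLinearMap.lsmul ℂ ℂ (E := ℂ)).holderL volume ∞ 2 2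
          (character_memLp v).toLp) := ContinuousLinearMap.continuous _
      have h2 := h1.comp (Lp.fourierTransformₗᵢ (Rn n) ℂ).continuous
      exact h2
  · intro φ
    have h1 : translate v (SchwartzMap.toLpCLM ℝ ℂ 2 volume φ)
        = SchwartzMap.toLp (SchwartzMap.compSubConstCLM ℂ (-v) φ) 2 volume := by
      apply Lp.ext
      filter_upwards [coeFn_translate v (SchwartzMap.toLpCLM ℝ ℂ 2 volume φ),
        (measurePreserving_add_right (volume : Measure (Rn n)) v).quasiMeasurePreserving.ae
          (SchwartzMap.coeFn_toLp φ 2 volume),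
        SchwartzMap.coeFn_toLp (SchwartzMap.compSubConstCLM ℂ (-v) φ) 2 volume] with x e1 e2 e3
      rw [e1, e3, SchwartzMap.toLpCLM_apply, e2]
      simp
    rw [h1, SchwartzMap.toLp_fourier_eq, SchwartzMap.toLpCLM_apply, SchwartzMap.toLp_fourier_eq]
    apply Lp.ext
    filter_upwards [Lp.coeFn_lpSMul (r := 2) (character_memLp v).toLp
        (SchwartzMap.toLp (𝓕 φ) 2 (volume : Measure (Rn n))),
      (character_memLp v).coeFn_toLp, SchwartzMap.coeFn_toLp (𝓕 φ) 2 volume,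
      SchwartzMap.coeFn_toLp (𝓕 (SchwartzMap.compSubConstCLM ℂ (-v) φ)) 2 volume]
      with ξ e1 e2 e3 e4
    rw [e1, e4, Pi.smul_apply', e2, e3, SchwartzMap.fourier_coe, SchwartzMap.fourier_coe]
    have h3 := congrFun (VectorFourier.fourierIntegral_comp_add_right Real.fourierChar
      (volume : Measure (Rn n)) (innerₗ (Rn n)) (φ : Rn n → ℂ) v) ξ
    have h4 : ((SchwartzMap.compSubConstCLM ℂ (-v) φ : 𝓢(Rn n, ℂ)) : Rn n → ℂ)
        = (φ : Rn n → ℂ) ∘ fun x => x + v := by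
      ext x
      simp
    rw [h4]
    exact h3

/-- The product `𝓕 f · conj (𝓕 g)`. -/
def crossSpectrum {n : ℕ} (f g : L2 n) (ξ : Rn n) : ℂ :=
  (starRingEnd ℂ) ((𝓕 (toComplex n g) : L2C n) ξ) * (𝓕 (toComplex n f) : L2C n) ξ

theorem integrable_conj_mul {n : ℕ} (a b : L2C n) :
    Integrable (fun ξ => (starRingEnd ℂ) (a ξ) * b ξ) volume := by
  refine (L2.integrable_inner (𝕜 := ℂ) a b).congr (Filter.Eventually.of_forall fun ξ => ?_)
  simp [mul_comm]

theorem integrable_crossSpectrum {n : ℕ} (f g : L2 n) :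
    Integrable (crossSpectrum f g) volume :=
  integrable_conj_mul _ _

/-- Plancherel. The pairing of the convolution with `g` becomes linear in the symbol `m`, against a
fixed integrable function, so limits and superpositions of symbols can be taken directly. -/
theorem integral_mul_crossSpectrum {n : ℕ} {m : Rn n → ℂ}
    (hm : MemLp m ∞ (volume : Measure (Rn n))) (f g : L2 n) :
    ∫ ξ, m ξ * crossSpectrum f g ξ = ∫ x, (g x : ℂ) * convolve hm f x := by
  have h1 := Lp.inner_fourier_eq (toComplex n g) (convolve hm f)
  have h2 : (𝓕 (convolve hm f) : L2C n) = hm.toLp m • 𝓕 (toComplex n f) := by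
    rw [convolve, FourierTransform.fourier_fourierInv_eq]
  rw [h2, L2.inner_def, L2.inner_def] at h1
  calc ∫ ξ, m ξ * crossSpectrum f g ξ
      = ∫ ξ, inner ℂ ((𝓕 (toComplex n g) : L2C n) ξ)
          ((hm.toLp m • 𝓕 (toComplex n f) : L2C n) ξ) := by
        refine integral_congr_ae ?_
        filter_upwards [Lp.coeFn_lpSMul (r := 2) (hm.toLp m) (𝓕 (toComplex n f) : L2C n),
          hm.coeFn_toLp] with ξ e1 e2
        rw [e1, Pi.smul_apply', e2]
        simp only [crossSpectrum, smul_eq_mul, RCLike.inner_apply]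
        ring
    _ = _ := h1
    _ = _ := by
        refine integral_congr_ae ?_
        filter_upwards [coeFn_toComplex g] with x e1
        rw [e1]
        simp [mul_comm]

/-- A character acts as a translation, so the pairing is the correlation of `g` with a shifted `f`.
It is always real, and it vanishes when the supports are separated; these are the two inputs for
reality and finite speed. -/
theorem integral_character_mul_crossSpectrum {n : ℕ} (v : Rn n) (f g : L2 n) :
    ∫ ξ, character v ξ * crossSpectrum f g ξ = ((∫ x, g x * f (x + v) : ℝ) : ℂ) := by
  rw [integral_mul_crossSpectrum (character_memLp v), ← integral_complex_ofReal]
  have h : convolve (character_memLp v) f = translate v (toComplex n f) := by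
    rw [convolve, ← fourier_translate, FourierTransform.fourierInv_fourier_eq]
  refine integral_congr_ae ?_
  rw [h]
  filter_upwards [coeFn_translate v (toComplex n f),
    (measurePreserving_add_right (volume : Measure (Rn n)) v).quasiMeasurePreserving.ae
      (coeFn_toComplex f)] with x e1 e2
  rw [e1, e2]
  push_cast
  rfl

/-! ### Finite speed of propagation

A functional of an integrable function `F` which annihilates the characters `exp (2 π i v·ξ)` with
`|v·ω| ≤ t` also annihilates `cos (2 π s |ξ|)` for `0 ≤ s < t`: these functions are limits of
Chebyshev polynomials in the symbols of finite difference operators. -/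

/-- `φ` times any character `exp (2 π i v·ξ)` with `|v·ω| ≤ t - c` is annihilated by
`φ ↦ ℓ (∫ φ F)`. -/
def IsAnnihilated {n : ℕ} (F : Rn n → ℂ) (ℓ : ℂ →L[ℝ] ℝ) (ω : Rn n) (t c : ℝ)
    (φ : Rn n → ℝ) : Prop :=
  IsSymbol φ ∧ ∀ v, |inner ℝ ω v| + c ≤ t → ℓ (∫ ξ, φ ξ * (character v ξ * F ξ)) = 0

theorem character_add_sub {n : ℕ} (v d ξ : Rn n) :
    ((2 * Real.cos (2 * Real.pi * inner ℝ d ξ) : ℝ) : ℂ) * character v ξ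
      = character (v + d) ξ + character (v - d) ξ := by
  simp only [character, inner_add_left, inner_sub_left, Real.fourierChar_apply]
  push_cast
  rw [Complex.two_cos, add_mul, ← Complex.exp_add, ← Complex.exp_add]
  congr 2 <;> ring

theorem IsSymbol.integrable_mul {n : ℕ} {φ : Rn n → ℝ} (hφ : IsSymbol φ) {F : Rn n → ℂ}
    (hF : Integrable F volume) (v : Rn n) :
    Integrable (fun ξ => (φ ξ : ℂ) * (character v ξ * F ξ)) volume := by
  obtain ⟨hc, C, hC⟩ := hφ
  refine Integrable.bdd_mul (c := C) ?_ ?_ (Filter.Eventually.of_forall fun ξ => ?_)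
  · exact hF.bdd_mul (c := 1) (continuous_character v).aestronglyMeasurable
      (Filter.Eventually.of_forall fun ξ => (norm_character v ξ).le)
  · exact (Complex.continuous_ofReal.comp hc).aestronglyMeasurable
  · simpa using hC ξ

namespace IsAnnihilated

variable {n : ℕ} {F : Rn n → ℂ} {ℓ : ℂ →L[ℝ] ℝ} {ω : Rn n} {t c : ℝ} {φ ψ : Rn n → ℝ}

theorem mono {c' : ℝ} (h : IsAnnihilated F ℓ ω t c φ) (hc : c ≤ c') :
    IsAnnihilated F ℓ ω t c' φ :=
  ⟨h.1, fun v hv => h.2 v (by linarith)⟩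

theorem add (hF : Integrable F volume) (h : IsAnnihilated F ℓ ω t c φ)
    (h' : IsAnnihilated F ℓ ω t c ψ) : IsAnnihilated F ℓ ω t c (fun ξ => φ ξ + ψ ξ) := by
  refine ⟨?_, fun v hv => ?_⟩
  · obtain ⟨hc, C, hC⟩ := h.1
    obtain ⟨hc', C', hC'⟩ := h'.1
    exact ⟨hc.add hc', C + C', fun ξ => (abs_add_le _ _).trans (add_le_add (hC ξ) (hC' ξ))⟩
  · simp only [Complex.ofReal_add, add_mul]
    rw [integral_add (h.1.integrable_mul hF v) (h'.1.integrable_mul hF v), map_add, h.2 v hv,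
      h'.2 v hv, add_zero]

theorem const_mul (h : IsAnnihilated F ℓ ω t c φ) (a : ℝ) :
    IsAnnihilated F ℓ ω t c (fun ξ => a * φ ξ) := by
  refine ⟨h.1.const_mul a, fun v hv => ?_⟩
  simp only [Complex.ofReal_mul, mul_assoc]
  rw [integral_const_mul, ← Complex.real_smul, map_smul, h.2 v hv, smul_zero]

/-- Multiplication by cos(2π d·ξ) replaces the character of `v` by the average of those of `v + d`
and `v - d`, so it uses up |d·ω| ≤ `e` of the allowed displacement. -/
theorem cos_mul (hF : Integrable F volume) (h : IsAnnihilated F ℓ ω t c φ) {d : Rn n} {e : ℝ}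
    (hd : |inner ℝ ω d| ≤ e) :
    IsAnnihilated F ℓ ω t (c + e) (fun ξ => Real.cos (2 * Real.pi * inner ℝ d ξ) * φ ξ) := by
  refine ⟨IsSymbol.mul ⟨by fun_prop, 1, fun ξ => Real.abs_cos_le_one _⟩ h.1, fun v hv => ?_⟩
  have h1 : ∀ ξ, ((Real.cos (2 * Real.pi * inner ℝ d ξ) * φ ξ : ℝ) : ℂ) * (character v ξ * F ξ)
      = ((1 / 2 : ℝ) : ℂ) * (φ ξ * (character (v + d) ξ * F ξ)
        + φ ξ * (character (v - d) ξ * F ξ)) := by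
    intro ξ
    have := character_add_sub v d ξ
    push_cast at this ⊢
    linear_combination (1 / 2 : ℂ) * φ ξ * F ξ * this
  simp only [h1]
  rw [integral_const_mul, integral_add (h.1.integrable_mul hF _) (h.1.integrable_mul hF _),
    ← Complex.real_smul, map_smul, map_add, h.2, h.2, add_zero, smul_zero]
  · rw [inner_sub_right]
    linarith [abs_sub (inner ℝ ω v) (inner ℝ ω d)]
  · rw [inner_add_right]
    linarith [abs_add_le (inner ℝ ω v) (inner ℝ ω d)]

/-- One time step of the scheme. The cosines are added, not composed, so the step costs `e` whatever
the number of terms. -/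
theorem sum_mul (hF : Integrable F volume) (h : IsAnnihilated F ℓ ω t c φ) {ι : Type*}
    (s : Finset ι) (a : ι → ℝ) (d : ι → Rn n) {e : ℝ} (he : 0 ≤ e)
    (hd : ∀ j, |inner ℝ ω (d j)| ≤ e) :
    IsAnnihilated F ℓ ω t (c + e)
      (fun ξ => (1 - ∑ j ∈ s, a j * (1 - Real.cos (2 * Real.pi * inner ℝ (d j) ξ))) * φ ξ) := by
  classical
  induction s using Finset.induction_on with
  | empty => simpa using h.mono (by linarith)
  | insert j s hj ih =>
    have h1 := ((h.mono (by linarith : c ≤ c + e)).const_mul (-a j)).add hF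
      ((h.cos_mul hF (hd j)).const_mul (a j))
    have h2 := ih.add hF h1
    convert h2 using 2 with ξ
    rw [Finset.sum_insert hj]
    ring

/-- Chebyshev polynomials of finite difference operators have finite speed of propagation. -/
theorem chebyshev (hF : Integrable F volume)
    (h : IsAnnihilated F ℓ ω t 0 (fun _ => 1)) {ι : Type*}
    (s : Finset ι) (a : ι → ℝ) (d : ι → Rn n) {e : ℝ} (he : 0 ≤ e)
    (hd : ∀ j, |inner ℝ ω (d j)| ≤ e) {θ : Rn n → ℝ}
    (hθ : ∀ ξ, Real.cos (θ ξ)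
      = 1 - ∑ j ∈ s, a j * (1 - Real.cos (2 * Real.pi * inner ℝ (d j) ξ))) (k : ℕ) :
    IsAnnihilated F ℓ ω t (k * e) (fun ξ => Real.cos (k * θ ξ)) ∧
      IsAnnihilated F ℓ ω t ((k + 1) * e) (fun ξ => Real.cos ((k + 1) * θ ξ)) := by
  -- Two consecutive indices are carried because of the three-term recursion cos((k+2)θ) = 2 cos θ
  -- cos((k+1)θ) − cos(kθ).
  induction k with
  | zero =>
    refine ⟨by simpa using h, ?_⟩
    simpa [hθ] using h.sum_mul hF s a d he hd
  | succ k ih =>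
    refine ⟨by simpa using ih.2, ?_⟩
    have h1 := (ih.2.sum_mul hF s a d he hd).const_mul 2
    have h2 := (ih.1.mono (by nlinarith : (k : ℝ) * e ≤ (k + 1) * e + e)).const_mul (-1)
    convert h1.add hF h2 using 2 with ξ
    · push_cast
      ring
    · rw [← hθ]
      have e1 : Real.cos ((k + 1) * θ ξ + θ ξ) = Real.cos ((k + 1) * θ ξ) * Real.cos (θ ξ)
        - Real.sin ((k + 1) * θ ξ) * Real.sin (θ ξ) := Real.cos_add _ _
      have e2 : Real.cos ((k + 1) * θ ξ - θ ξ) = Real.cos ((k + 1) * θ ξ) * Real.cos (θ ξ)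
        + Real.sin ((k + 1) * θ ξ) * Real.sin (θ ξ) := Real.cos_sub _ _
      have e3 : ((k : ℝ) + 1) * θ ξ - θ ξ = k * θ ξ := by ring
      have e4 : ((k + 1 : ℕ) + 1 : ℝ) * θ ξ = (k + 1) * θ ξ + θ ξ := by
        push_cast
        ring
      rw [e4, e1]
      rw [e3] at e2
      rw [e2]
      ring

end IsAnnihilated

/-- Since arcsin has derivative 1 at 0 and z_N → 0, arcsin z_N is asymptotic to z_N; `dslope` makes
the quotient meaningful also where z_N = 0. -/
theorem tendsto_nat_mul_arcsin {z : ℕ → ℝ} {κ : ℝ}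
    (hz : Filter.Tendsto (fun N : ℕ => (N : ℝ) * z N) Filter.atTop (nhds κ)) :
    Filter.Tendsto (fun N : ℕ => (N : ℝ) * Real.arcsin (z N)) Filter.atTop (nhds κ) := by
  have hz0 : Filter.Tendsto z Filter.atTop (nhds 0) := by
    have h1 := hz.mul tendsto_inv_atTop_nhds_zero_nat
    rw [mul_zero] at h1
    refine h1.congr' ?_
    filter_upwards [Filter.eventually_gt_atTop 0] with N hN
    have : (N : ℝ) ≠ 0 := by exact_mod_cast hN.ne'
    field_simp
  have hd : HasDerivAt Real.arcsin 1 0 := by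
    simpa using Real.hasDerivAt_arcsin (x := 0) (by norm_num) (by norm_num)
  have hc : ContinuousAt (dslope Real.arcsin 0) 0 :=
    continuousAt_dslope_same.2 hd.differentiableAt
  have h2 : Filter.Tendsto (fun N => dslope Real.arcsin 0 (z N)) Filter.atTop (nhds 1) := by
    have := hc.tendsto.comp hz0
    rwa [dslope_same, hd.deriv] at this
  have h3 := hz.mul h2
  rw [mul_one] at h3
  refine h3.congr fun N => ?_
  have := sub_smul_dslope Real.arcsin 0 (z N)
  simp only [sub_zero, Real.arcsin_zero, smul_eq_mul] at this
  rw [mul_assoc, this]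

theorem tendsto_nat_mul_sin_div (c : ℝ) :
    Filter.Tendsto (fun N : ℕ => (N : ℝ) * Real.sin (c / N)) Filter.atTop (nhds c) := by
  have h1 : Filter.Tendsto (fun N : ℕ => c * Real.sinc (c / N)) Filter.atTop (nhds (c * 1)) := by
    refine Filter.Tendsto.const_mul _ ?_
    have := Real.continuous_sinc.tendsto 0
    rw [Real.sinc_zero] at this
    exact this.comp (tendsto_const_div_atTop_nhds_zero_nat c)
  rw [mul_one] at h1
  refine h1.congr' ?_
  filter_upwards [Filter.eventually_gt_atTop 0] with N hN
  have hN' : (N : ℝ) ≠ 0 := by exact_mod_cast hN.ne'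
  rcases eq_or_ne c 0 with rfl | hc
  · simp
  · rw [Real.sinc_of_ne_zero (div_ne_zero hc hN')]
    field_simp

/-- The frequency of the finite difference scheme converges to that of the wave equation. -/
theorem tendsto_scheme_frequency {n : ℕ} {ι : Type*} [Fintype ι] (b : OrthonormalBasis ι ℝ (Rn n))
    {a : ι → ℝ} (ha : ∀ j, 0 < a j) {s : ℝ} (hs : 0 ≤ s) (ξ : Rn n) :
    Filter.Tendsto (fun N : ℕ => (N : ℝ) * (2 * Real.arcsin (Real.sqrt
      (∑ j, a j * Real.sin (Real.pi * inner ℝ ((s / (N * Real.sqrt (a j))) • b j) ξ) ^ 2))))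
      Filter.atTop (nhds (2 * Real.pi * s * ‖ξ‖)) := by
  have h1 : Filter.Tendsto (fun N : ℕ => (N : ℝ) * Real.sqrt
      (∑ j, a j * Real.sin (Real.pi * inner ℝ ((s / (N * Real.sqrt (a j))) • b j) ξ) ^ 2))
      Filter.atTop (nhds (Real.pi * s * ‖ξ‖)) := by
    have h2 : Filter.Tendsto (fun N : ℕ => ∑ j, a j * ((N : ℝ) *
        Real.sin ((Real.pi * s / Real.sqrt (a j) * inner ℝ (b j) ξ) / N)) ^ 2)
        Filter.atTop (nhds (∑ j, a j * (Real.pi * s / Real.sqrt (a j) * inner ℝ (b j) ξ) ^ 2)) :=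
      tendsto_finsetSum _ fun j _ => ((tendsto_nat_mul_sin_div _).pow 2).const_mul _
    -- The weights cancel: shifts of size s/(N√aⱼ) compensate the factors aⱼ, so by Parseval the
    -- limit is isotropic for every choice of positive weights.
    have h3 : ∑ j, a j * (Real.pi * s / Real.sqrt (a j) * inner ℝ (b j) ξ) ^ 2
        = (Real.pi * s * ‖ξ‖) ^ 2 := by
      rw [mul_pow, ← b.sum_sq_norm_inner_right ξ, Finset.mul_sum]
      refine Finset.sum_congr rfl fun j _ => ?_
      rw [Real.norm_eq_abs, sq_abs, mul_pow, div_pow, Real.sq_sqrt (ha j).le]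
      have := (ha j).ne'
      field_simp
    rw [h3] at h2
    have h4 := h2.sqrt
    rw [Real.sqrt_sq (by positivity)] at h4
    refine h4.congr fun N => ?_
    rw [← Real.sqrt_sq (Nat.cast_nonneg N : (0 : ℝ) ≤ N), ← Real.sqrt_mul (sq_nonneg _),
      Real.sqrt_sq (Nat.cast_nonneg N), Finset.mul_sum]
    congr 1
    refine Finset.sum_congr rfl fun j _ => ?_
    have e : Real.pi * s / Real.sqrt (a j) * inner ℝ (b j) ξ / N
        = Real.pi * inner ℝ ((s / (N * Real.sqrt (a j))) • b j) ξ := by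
      rw [real_inner_smul_left]
      ring
    rw [e]
    ring
  have h5 := (tendsto_nat_mul_arcsin h1).const_mul 2
  have e : 2 * (Real.pi * s * ‖ξ‖) = 2 * Real.pi * s * ‖ξ‖ := by ring
  rw [e] at h5
  exact h5.congr fun N => by ring

/-- With ω in the basis, the shifts along all other basis vectors produce no displacement in the
direction ω. -/
theorem exists_orthonormalBasis_mem {n : ℕ} {ω : Rn n} (hω : ‖ω‖ = 1) :
    ∃ (s : Finset (Rn n)) (b : OrthonormalBasis s ℝ (Rn n)) (i : s), b i = ω := by
  have h : Orthonormal ℝ (Subtype.val : ({ω} : Set (Rn n)) → Rn n) := by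
    rw [orthonormal_subtype_iff_ite]
    rintro v rfl w rfl
    simp [hω]
  obtain ⟨s, b, hs, hb⟩ := h.exists_orthonormalBasis_extension
  exact ⟨s, b, ⟨ω, hs rfl⟩, by rw [hb]⟩

/-- The domain of dependence of a finite difference scheme for the wave equation, passed to the
limit. The weights sum to at most 1 (the stability condition, which makes the one-step symbol a
cosine), and are chosen so that N steps displace by at most t along ω. -/
theorem annihilated_cos {n : ℕ} {F : Rn n → ℂ} (hF : Integrable F volume) {ℓ : ℂ →L[ℝ] ℝ}
    {ω : Rn n} (hω : ‖ω‖ = 1) {t : ℝ}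
    (h : ∀ v, |inner ℝ ω v| ≤ t → ℓ (∫ ξ, character v ξ * F ξ) = 0) {s : ℝ} (hs : 0 < s)
    (hst : s < t) : ℓ (∫ ξ, (Real.cos (2 * Real.pi * s * ‖ξ‖) : ℂ) * F ξ) = 0 := by
  classical
  obtain ⟨σ, b, i, hb⟩ := exists_orthonormalBasis_mem hω
  have ht : 0 < t := hs.trans hst
  set r := s / t with hr
  have hr0 : 0 < r := by positivity
  have hr1 : r < 1 := (div_lt_one ht).2 hst
  have hr2 : 0 < 1 - r ^ 2 := by nlinarith
  have hcard : (0 : ℝ) < Fintype.card σ := by exact_mod_cast Fintype.card_pos_iff.2 ⟨i⟩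
  -- The weight (s/t)² on ω makes the shift along ω exactly t/N. The other directions share 1 −
  -- (s/t)², which is positive because s < t.
  let a : σ → ℝ := fun j => if j = i then r ^ 2 else (1 - r ^ 2) / Fintype.card σ
  have ha : ∀ j, 0 < a j := by
    intro j
    simp only [a]
    split_ifs <;> positivity
  have hasum : ∑ j, a j ≤ 1 := by
    have h1 : ∀ j, a j ≤ (if j = i then r ^ 2 else 0) + (1 - r ^ 2) / Fintype.card σ := by
      intro j
      simp only [a]
      split_ifs
      · linarith [div_pos hr2 hcard]
      · linarith
    refine (Finset.sum_le_sum fun j _ => h1 j).trans ?_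
    rw [Finset.sum_add_distrib, Finset.sum_ite_eq' Finset.univ i]
    simp only [Finset.mem_univ, if_true, Finset.sum_const, Finset.card_univ, nsmul_eq_mul]
    rw [mul_div_cancel₀ _ hcard.ne']
    linarith
  let d : ℕ → σ → Rn n := fun N j => (s / (N * Real.sqrt (a j))) • b j
  have hd : ∀ N j, |inner ℝ ω (d N j)| ≤ t / N := by
    intro N j
    simp only [d]
    rw [real_inner_smul_right, ← hb, b.inner_eq_ite]
    by_cases hj : i = j
    · subst hj
      have : Real.sqrt (a i) = r := by simp [a, Real.sqrt_sq hr0.le]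
      rw [this, if_pos rfl, mul_one, abs_of_nonneg (by positivity), hr]
      refine le_of_eq ?_
      rcases Nat.eq_zero_or_pos N with rfl | hN
      · simp
      · have : (N : ℝ) ≠ 0 := by exact_mod_cast hN.ne'
        field_simp
    · rw [if_neg hj, mul_zero, abs_zero]
      positivity
  -- By 1 − cos 2x = 2 sin² x, the one-step symbol is 1 − 2z² = cos(2 arcsin z), and `hasum` ensures
  -- z ≤ 1.
  let z : ℕ → Rn n → ℝ := fun N ξ =>
    Real.sqrt (∑ j, a j * Real.sin (Real.pi * inner ℝ (d N j) ξ) ^ 2)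
  have hz0 : ∀ N ξ, 0 ≤ ∑ j, a j * Real.sin (Real.pi * inner ℝ (d N j) ξ) ^ 2 := fun N ξ =>
    Finset.sum_nonneg fun j _ => mul_nonneg (ha j).le (sq_nonneg _)
  have hz1 : ∀ N ξ, z N ξ ≤ 1 := by
    intro N ξ
    refine Real.sqrt_le_one.2 ((Finset.sum_le_sum fun j _ => ?_).trans hasum)
    exact mul_le_of_le_one_right (ha j).le (Real.sin_sq_le_one _)
  have hθ : ∀ N ξ, Real.cos (2 * Real.arcsin (z N ξ))
      = 1 - ∑ j, a j * (1 - Real.cos (2 * Real.pi * inner ℝ (d N j) ξ)) := by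
    intro N ξ
    have hz : -1 ≤ z N ξ := le_trans (by norm_num) (Real.sqrt_nonneg _)
    rw [Real.cos_two_mul, Real.cos_sq', Real.sin_arcsin hz (hz1 N ξ), Real.sq_sqrt (hz0 N ξ)]
    have : ∀ j, a j * (1 - Real.cos (2 * Real.pi * inner ℝ (d N j) ξ))
        = 2 * (a j * Real.sin (Real.pi * inner ℝ (d N j) ξ) ^ 2) := by
      intro j
      rw [mul_assoc 2 Real.pi, Real.cos_two_mul, Real.cos_sq']
      ring
    simp only [this, ← Finset.mul_sum]
    ring
  have hbase : IsAnnihilated F ℓ ω t 0 (fun _ => 1) := by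
    refine ⟨⟨continuous_const, 1, fun _ => by simp⟩, fun v hv => ?_⟩
    simpa using h v (by linarith)
  have hN : ∀ N : ℕ, 0 < N →
      ℓ (∫ ξ, (Real.cos (N * (2 * Real.arcsin (z N ξ))) : ℂ) * F ξ) = 0 := by
    intro N hN
    have hN' : (N : ℝ) ≠ 0 := by exact_mod_cast hN.ne'
    -- The N steps use the whole budget N · (t/N) = t, which leaves exactly the character of v = 0.
    have h1 := (hbase.chebyshev hF Finset.univ a (d N) (by positivity : 0 ≤ t / N) (hd N)
      (hθ N) N).1.2 0 (by rw [mul_div_cancel₀ _ hN']; simp)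
    simpa [character] using h1
  have hlim : Filter.Tendsto
      (fun N : ℕ => ∫ ξ, (Real.cos (N * (2 * Real.arcsin (z N ξ))) : ℂ) * F ξ) Filter.atTop
      (nhds (∫ ξ, (Real.cos (2 * Real.pi * s * ‖ξ‖) : ℂ) * F ξ)) := by
    refine tendsto_integral_filter_of_dominated_convergence (fun ξ => ‖F ξ‖) ?_ ?_ hF.norm ?_
    · refine Filter.Eventually.of_forall fun N => ?_
      refine AEStronglyMeasurable.mul (Continuous.aestronglyMeasurable ?_) hF.1
      have : Continuous (z N) := by
        refine Real.continuous_sqrt.comp (continuous_finsetSum _ fun j _ => ?_)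
        fun_prop
      have h2 := Real.continuous_arcsin.comp this
      exact Complex.continuous_ofReal.comp
        (Real.continuous_cos.comp (continuous_const.mul (continuous_const.mul h2)))
    · refine Filter.Eventually.of_forall fun N => Filter.Eventually.of_forall fun ξ => ?_
      rw [norm_mul, Complex.norm_real]
      exact mul_le_of_le_one_left (norm_nonneg _) (Real.abs_cos_le_one _)
    · refine Filter.Eventually.of_forall fun ξ => Filter.Tendsto.mul_const _ ?_
      exact (Complex.continuous_ofReal.tendsto _).comp
        ((Real.continuous_cos.tendsto _).comp (tendsto_scheme_frequency b ha hs.le ξ))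
  have hlim2 := (ℓ.continuous.tendsto _).comp hlim
  refine tendsto_nhds_unique hlim2 (tendsto_const_nhds.congr' ?_)
  filter_upwards [Filter.eventually_gt_atTop 0] with N hpos
  exact (hN N hpos).symm

/-- A symbol `c + ∫₀ᵗ w(s) cos (2 π s |ξ|) ds` is annihilated by functionals which annihilate the
characters `exp (2 π i v·ξ)` with `|v·ω| ≤ t`. -/
theorem annihilated_radial {n : ℕ} {F : Rn n → ℂ} (hF : Integrable F volume) {ℓ : ℂ →L[ℝ] ℝ}
    {ω : Rn n} (hω : ‖ω‖ = 1) {t : ℝ} (ht : 0 ≤ t)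
    (h : ∀ v, |inner ℝ ω v| ≤ t → ℓ (∫ ξ, character v ξ * F ξ) = 0)
    {m : ℝ → ℝ} {c : ℝ} {w : ℝ → ℝ} (hw : Continuous w)
    (hm : ∀ r, m r = c + ∫ s in (0 : ℝ)..t, w s * Real.cos (r * s)) :
    ℓ (∫ ξ, radial n m ξ * F ξ) = 0 := by
  have hint : Integrable (fun q : ℝ × Rn n =>
      ((w q.1 * Real.cos (2 * Real.pi * ‖q.2‖ * q.1) : ℝ) : ℂ) * F q.2)
      ((volume.restrict (Ioc 0 t)).prod volume) := by
    have hw1 : Integrable w (volume.restrict (Ioc 0 t)) :=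
      (hw.integrableOn_Icc (a := 0) (b := t)).mono_set Ioc_subset_Icc_self
    have h1 : Integrable (fun q : ℝ × Rn n => (w q.1 : ℂ) * F q.2)
        ((volume.restrict (Ioc 0 t)).prod volume) := Integrable.mul_prod hw1.ofReal hF
    have h2 := h1.bdd_mul (c := 1)
      (f := fun q : ℝ × Rn n => (Real.cos (2 * Real.pi * ‖q.2‖ * q.1) : ℂ))
      (Continuous.aestronglyMeasurable (by fun_prop))
      (Filter.Eventually.of_forall fun q => by
        rw [Complex.norm_real]
        exact Real.abs_cos_le_one _)
    refine h2.congr (Filter.Eventually.of_forall fun q => ?_)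
    push_cast
    ring
  have hinner : ∀ ξ, (∫ s in Ioc 0 t, ((w s * Real.cos (2 * Real.pi * ‖ξ‖ * s) : ℝ) : ℂ) * F ξ)
      = ((m (2 * Real.pi * ‖ξ‖) - c : ℝ) : ℂ) * F ξ := by
    intro ξ
    rw [integral_mul_const, integral_complex_ofReal, hm, add_sub_cancel_left,
      intervalIntegral.integral_of_le ht]
  -- Fubini in (s, ξ). The constant `c` multiplies the trivial character v = 0, which is annihilated
  -- by hypothesis.
  have hsplit : ∫ ξ, radial n m ξ * F ξ = (c : ℂ) * (∫ ξ, character 0 ξ * F ξ)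
      + ∫ s in Ioc 0 t, ∫ ξ, ((w s * Real.cos (2 * Real.pi * ‖ξ‖ * s) : ℝ) : ℂ) * F ξ := by
    rw [integral_integral_swap hint]
    simp only [hinner]
    have hi : Integrable (fun ξ => ((m (2 * Real.pi * ‖ξ‖) - c : ℝ) : ℂ) * F ξ) volume := by
      simp only [← hinner]
      exact hint.integral_prod_right
    rw [← integral_const_mul, ← integral_add _ hi]
    · refine integral_congr_ae (Filter.Eventually.of_forall fun ξ => ?_)
      simp only [radial, character, inner_zero_left, AddChar.map_zero_eq_one]
      push_cast
      ring
    · simp only [character, inner_zero_left, AddChar.map_zero_eq_one, Circle.coe_one, one_mul]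
      exact hF.const_mul _
  rw [hsplit, map_add, ← Complex.real_smul, map_smul, h 0 (by simpa using ht), smul_zero, zero_add,
    ← ContinuousLinearMap.integral_comp_comm _ hint.integral_prod_left]
  -- The endpoint s = t is discarded as a null set, because `annihilated_cos` requires s < t.
  rw [setIntegral_congr_set Ioo_ae_eq_Ioc.symm]
  refine setIntegral_eq_zero_of_forall_eq_zero fun s hs => ?_
  have h3 := annihilated_cos hF hω h hs.1 hs.2
  have h4 : ∫ ξ, ((w s * Real.cos (2 * Real.pi * ‖ξ‖ * s) : ℝ) : ℂ) * F ξ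
      = (w s : ℂ) * ∫ ξ, (Real.cos (2 * Real.pi * s * ‖ξ‖) : ℂ) * F ξ := by
    rw [← integral_const_mul]
    refine integral_congr_ae (Filter.Eventually.of_forall fun ξ => ?_)
    simp only
    rw [mul_right_comm (2 * Real.pi)]
    push_cast
    ring
  rw [h4, ← Complex.real_smul, map_smul, h3, smul_zero]

/-! ### The three kernels as superpositions of cosines -/

/-- Symbols which are superpositions of `cos (s r)` with `0 ≤ s ≤ t`. -/
def IsWaveSymbol (t : ℝ) (m : ℝ → ℝ) : Prop :=
  ∃ (c : ℝ) (w : ℝ → ℝ), Continuous w ∧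
    ∀ r, m r = c + ∫ s in (0 : ℝ)..t, w s * Real.cos (r * s)

theorem integral_cos_mul_eq (t r : ℝ) :
    ∫ s in (0 : ℝ)..t, Real.cos (r * s) = t * Real.sinc (r * t) := by
  rcases eq_or_ne r 0 with rfl | hr
  · simp
  rcases eq_or_ne t 0 with rfl | ht
  · simp
  have hd : ∀ s ∈ uIcc 0 t, HasDerivAt (fun s => Real.sin (r * s) / r) (Real.cos (r * s)) s := by
    intro s _
    have h1 : HasDerivAt (fun s : ℝ => r * s) r s := by
      simpa using (hasDerivAt_id s).const_mul r
    have h2 := (h1.sin).div_const r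
    rwa [mul_div_cancel_right₀ _ hr] at h2
  rw [intervalIntegral.integral_eq_sub_of_hasDerivAt hd
    ((by fun_prop : Continuous fun s : ℝ => Real.cos (r * s)).intervalIntegrable _ _),
    Real.sinc_of_ne_zero (mul_ne_zero hr ht)]
  field_simp
  simp

theorem integral_exp_mul_cos_eq {β : ℝ} (hβ : β ≠ 0) (t r : ℝ) :
    ∫ s in (0 : ℝ)..t, Real.exp ((s - t) / β) * Real.cos (r * s)
      = β * (Real.cos (r * t) + β * r * Real.sin (r * t) - Real.exp (-t / β))
        / (1 + β ^ 2 * r ^ 2) := by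
  have hD : (1 + β ^ 2 * r ^ 2) ≠ 0 := by positivity
  have hd : ∀ s ∈ uIcc 0 t, HasDerivAt (fun s => Real.exp ((s - t) / β) *
      (β * (Real.cos (r * s) + β * r * Real.sin (r * s)) / (1 + β ^ 2 * r ^ 2)))
      (Real.exp ((s - t) / β) * Real.cos (r * s)) s := by
    intro s _
    have h1 : HasDerivAt (fun s : ℝ => r * s) r s := by
      simpa using (hasDerivAt_id s).const_mul r
    have h2 : HasDerivAt (fun s : ℝ => (s - t) / β) (1 / β) s :=
      ((hasDerivAt_id s).sub_const t).div_const β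
    have h3 := h2.exp.mul
      (((h1.cos.add (h1.sin.const_mul (β * r))).const_mul β).div_const (1 + β ^ 2 * r ^ 2))
    refine h3.congr_deriv ?_
    simp only [Pi.add_apply]
    field_simp
    ring
  have hc : Continuous fun s : ℝ => Real.exp ((s - t) / β) * Real.cos (r * s) := by fun_prop
  rw [intervalIntegral.integral_eq_sub_of_hasDerivAt hd (hc.intervalIntegrable _ _)]
  simp only [sub_self, zero_div, Real.exp_zero, mul_zero, Real.cos_zero, Real.sin_zero, zero_sub]
  field_simp
  ring

/-- For the data (1, 0, 0) the function y = u + βuₜ equals cos(rt). Solving βuₜ + u = y with u(0) =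
1 gives the constant exp(-t/β) and the weight exp((s - t)/β)/β. -/
theorem isWaveSymbol_symbol₀ {β : ℝ} (hβ : β ≠ 0) (t : ℝ) : IsWaveSymbol t (symbol₀ β t) := by
  refine ⟨Real.exp (-t / β), fun s => 1 / β * Real.exp ((s - t) / β), by fun_prop, fun r => ?_⟩
  have hD : (1 + β ^ 2 * r ^ 2) ≠ 0 := by positivity
  simp only [mul_assoc]
  rw [intervalIntegral.integral_const_mul, integral_exp_mul_cos_eq hβ, symbol₀]
  field_simp
  ring

theorem isWaveSymbol_symbol₁ (t : ℝ) : IsWaveSymbol t (symbol₁ t) := by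
  refine ⟨0, fun _ => 1, continuous_const, fun r => ?_⟩
  simp only [one_mul, zero_add]
  rw [integral_cos_mul_eq, symbol₁]

theorem mul_mul_sinc (t r : ℝ) : r * (t * Real.sinc (r * t)) = Real.sin (r * t) := by
  rcases eq_or_ne (r * t) 0 with h | h
  · rw [← mul_assoc, h]
    simp
  · rw [Real.sinc_of_ne_zero h]
    rw [← mul_assoc, mul_div_cancel₀ _ h]

/-- For the data (0, 0, 1), y = u + βuₜ equals β sin(rt)/r and u(0) = 0. Integrating by parts in the
solution formula for the ODE turns the sine into a cosine and gives the weight β(1 − exp((s -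
t)/β)). -/
theorem isWaveSymbol_symbol₂ {β : ℝ} (hβ : β ≠ 0) (t : ℝ) : IsWaveSymbol t (symbol₂ β t) := by
  refine ⟨0, fun s => β * (1 - Real.exp ((s - t) / β)), by fun_prop, fun r => ?_⟩
  have hD : (1 + β ^ 2 * r ^ 2) ≠ 0 := by positivity
  have h1 : ∀ s, β * (1 - Real.exp ((s - t) / β)) * Real.cos (r * s)
      = β * (Real.cos (r * s) - Real.exp ((s - t) / β) * Real.cos (r * s)) := fun s => by ring
  simp only [h1, zero_add]
  rw [intervalIntegral.integral_const_mul, intervalIntegral.integral_sub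
    ((by fun_prop : Continuous fun s : ℝ => Real.cos (r * s)).intervalIntegrable _ _)
    ((by fun_prop : Continuous fun s : ℝ =>
      Real.exp ((s - t) / β) * Real.cos (r * s)).intervalIntegrable _ _),
    integral_cos_mul_eq, integral_exp_mul_cos_eq hβ, symbol₂]
  -- With S = t sinc(rt) and sin(rt) = rS the identity becomes algebraic, and r = 0 needs no
  -- separate case.
  generalize hS : t * Real.sinc (r * t) = S
  have hm := mul_mul_sinc t r
  rw [hS] at hm
  rw [← hm]
  field_simp
  ring

/-! ### Reality and support of the convolutions -/

theorem exists_norm_eq_one {n : ℕ} (hn : 1 ≤ n) : ∃ ω : Rn n, ‖ω‖ = 1 :=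
  ⟨EuclideanSpace.single ⟨0, hn⟩ 1, by simp⟩

theorem integrable_mul_coe {n : ℕ} (g : L2 n) (h : L2C n) :
    Integrable (fun x => (g x : ℂ) * h x) volume := by
  refine (integrable_conj_mul (toComplex n g) h).congr ?_
  filter_upwards [coeFn_toComplex g] with x hx
  rw [hx, Complex.conj_ofReal]

/-- Convolution with a superposition of wave kernels maps real functions to real functions. -/
theorem IsWaveSymbol.exists_toComplex_eq {n : ℕ} (hn : 1 ≤ n) {t : ℝ} (ht : 0 ≤ t) {m : ℝ → ℝ}
    (h : IsWaveSymbol t m) (hm : MemLp (radial n m) ∞ (volume : Measure (Rn n))) (f : L2 n) :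
    ∃ w : L2 n, toComplex n w = convolve hm f := by
  obtain ⟨ω, hω⟩ := exists_norm_eq_one hn
  obtain ⟨c, k, hk, hmk⟩ := h
  set H := convolve hm f with hH
  -- The test function is the imaginary part of the convolution itself. Correlations of real
  -- functions are real, so the functional Im kills every character, and the conclusion reads ∫ (Im
  -- H)² = 0.
  let g : L2 n := Complex.imCLM.compLpL 2 volume H
  have hg : g =ᵐ[volume] fun x => (H x).im :=
    Complex.imCLM.coeFn_compLpL (p := 2) (μ := (volume : Measure (Rn n))) H
  have h1 := annihilated_radial (integrable_crossSpectrum f g) (ℓ := Complex.imCLM) hω ht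
    (fun v _ => by rw [integral_character_mul_crossSpectrum]; simp) hk hmk
  rw [integral_mul_crossSpectrum hm, ← hH, ← Complex.imCLM.integral_comp_comm
    (integrable_mul_coe g H)] at h1
  have h2 : ∫ x, (H x).im ^ 2 = 0 := by
    rw [← h1]
    refine integral_congr_ae ?_
    filter_upwards [hg] with x hx
    rw [hx]
    simp [sq]
  have h3 : (fun x => (H x).im ^ 2) =ᵐ[volume] 0 := by
    refine (integral_eq_zero_iff_of_nonneg (fun x => sq_nonneg _) ?_).1 h2
    refine (MemLp.integrable_sq (Lp.memLp g)).congr ?_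
    filter_upwards [hg] with x hx
    rw [hx]
  refine ⟨Complex.reCLM.compLpL 2 volume H, Lp.ext ?_⟩
  filter_upwards [coeFn_toComplex (Complex.reCLM.compLpL 2 volume H),
    Complex.reCLM.coeFn_compLpL (p := 2) (μ := (volume : Measure (Rn n))) H, h3] with x e1 e2 e3
  rw [e1, e2]
  apply Complex.ext
  · simp
  · simpa using (pow_eq_zero_iff two_ne_zero).1 e3 |>.symm

/-- Outside the ball, x lies in the half-space of the direction x/‖x‖. The condition r < ω·x is open
in ω, so countably many directions suffice and the exceptional sets stay null. -/
theorem supportedInBall_of_halfSpaces {n : ℕ} {f : L2 n} {r : ℝ} (hr : 0 ≤ r)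
    (h : ∀ ω : Rn n, ‖ω‖ = 1 → ∀ᵐ x, r < inner ℝ ω x → f x = 0) : SupportedInBall f r := by
  obtain ⟨D, hDc, hD⟩ := TopologicalSpace.exists_countable_dense (Metric.sphere (0 : Rn n) 1)
  have h1 : ∀ᵐ x, ∀ ω ∈ D, r < inner ℝ (ω : Rn n) x → f x = 0 :=
    (ae_ball_iff hDc).2 fun ω _ => h ω (by simp)
  filter_upwards [h1] with x hx hxr
  rw [mem_closedBall_zero_iff, not_le] at hxr
  have hx0 : 0 < ‖x‖ := lt_of_le_of_lt hr hxr
  have hopen : IsOpen {ω : Metric.sphere (0 : Rn n) 1 | r < inner ℝ (ω : Rn n) x} :=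
    isOpen_lt continuous_const (by fun_prop)
  obtain ⟨ω, hω1, hω2⟩ := hD.inter_open_nonempty _ hopen
    ⟨⟨‖x‖⁻¹ • x, by simp [norm_smul, hx0.ne']⟩, by
      simp only [mem_ofPred_eq, real_inner_smul_left, real_inner_self_eq_norm_sq]
      rw [sq, inv_mul_cancel_left₀ hx0.ne']
      exact hxr⟩
  exact hx ω hω2 hω1

/-- Finite speed of propagation. -/
theorem IsWaveSymbol.supportedInBall {n : ℕ} {t : ℝ} (ht : 0 ≤ t) {m : ℝ → ℝ}
    (h : IsWaveSymbol t m) (hm : MemLp (radial n m) ∞ (volume : Measure (Rn n))) {f w : L2 n}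
    (hw : toComplex n w = convolve hm f) {ρ : ℝ} (hρ : 0 ≤ ρ) (hf : SupportedInBall f ρ) :
    SupportedInBall w (ρ + t) := by
  refine supportedInBall_of_halfSpaces (add_nonneg hρ ht) fun ω hω => ?_
  obtain ⟨c, k, hk, hmk⟩ := h
  let S : Set (Rn n) := {x | ρ + t < inner ℝ ω x}
  have hS : MeasurableSet S := (isOpen_lt continuous_const (by fun_prop)).measurableSet
  -- The test function is `w` cut off to the half-space. A shift with |ω·v| ≤ t cannot carry that
  -- half-space back to ω·x ≤ ρ, where `f` lives, so all relevant correlations vanish and ∫ |1_S w|²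
  -- = 0 follows.
  let g : L2 n := ((Lp.memLp w).indicator hS).toLp
  have hg : g =ᵐ[volume] S.indicator w := MemLp.coeFn_toLp _
  have h0 : ∀ v : Rn n, |inner ℝ ω v| ≤ t →
      Complex.reCLM (∫ ξ, character v ξ * crossSpectrum f g ξ) = 0 := by
    intro v hv
    rw [integral_character_mul_crossSpectrum]
    simp only [Complex.reCLM_apply, Complex.ofReal_re]
    refine integral_eq_zero_of_ae ?_
    filter_upwards [hg, (measurePreserving_add_right (volume : Measure (Rn n)) v
      ).quasiMeasurePreserving.ae hf] with x e1 e2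
    rw [e1, Pi.zero_apply]
    by_cases hx : x ∈ S
    · rw [e2, mul_zero]
      rw [mem_closedBall_zero_iff, not_le]
      have hx' : ρ + t < inner ℝ ω x := hx
      have h1 : inner ℝ ω (x + v) ≤ ‖x + v‖ := by
        simpa [hω] using real_inner_le_norm ω (x + v)
      rw [inner_add_right] at h1
      linarith [neg_abs_le (inner ℝ ω v)]
    · rw [indicator_of_notMem hx, zero_mul]
  have h1 := annihilated_radial (integrable_crossSpectrum f g) (ℓ := Complex.reCLM) hω ht h0 hk hmk
  rw [integral_mul_crossSpectrum hm, ← hw, ← Complex.reCLM.integral_comp_comm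
    (integrable_mul_coe g _)] at h1
  have h2 : ∫ x, (S.indicator w x) ^ 2 = 0 := by
    rw [← h1]
    refine integral_congr_ae ?_
    filter_upwards [hg, coeFn_toComplex w] with x e1 e2
    rw [e1, e2]
    by_cases hx : x ∈ S
    · simp [indicator_of_mem hx, sq]
    · simp [indicator_of_notMem hx]
  have h3 : (fun x => (S.indicator w x) ^ 2) =ᵐ[volume] 0 := by
    refine (integral_eq_zero_iff_of_nonneg (fun x => sq_nonneg _) ?_).1 h2
    exact MemLp.integrable_sq ((Lp.memLp w).indicator hS)
  filter_upwards [h3] with x hx hxS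
  have h4 := (pow_eq_zero_iff two_ne_zero).1 hx
  rwa [indicator_of_mem (show x ∈ S from hxS)] at h4

/-! ### Sobolev spaces in Fourier space -/

/-- The weight `(1 + |ξ|²) ^ (s / 2)`. -/
def bracket (n : ℕ) (s : ℝ) (ξ : Rn n) : ℝ := (1 + ‖ξ‖ ^ 2) ^ (s / 2)

theorem bracket_pos {n : ℕ} (s : ℝ) (ξ : Rn n) : 0 < bracket n s ξ :=
  Real.rpow_pos_of_pos (by positivity) _

theorem continuous_bracket {n : ℕ} (s : ℝ) : Continuous (bracket n s) :=
  Continuous.rpow_const (by fun_prop) fun ξ => Or.inl (by positivity)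

theorem bracket_add {n : ℕ} (s t : ℝ) (ξ : Rn n) :
    bracket n (s + t) ξ = bracket n s ξ * bracket n t ξ := by
  rw [bracket, bracket, bracket, add_div, Real.rpow_add (by positivity)]

theorem bracket_zero {n : ℕ} (ξ : Rn n) : bracket n 0 ξ = 1 := by simp [bracket]

theorem bracket_neg_mul {n : ℕ} (s : ℝ) (ξ : Rn n) : bracket n (-s) ξ * bracket n s ξ = 1 := by
  rw [← bracket_add, neg_add_cancel, bracket_zero]

theorem bracket_le_one {n : ℕ} {s : ℝ} (hs : s ≤ 0) (ξ : Rn n) : bracket n s ξ ≤ 1 :=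
  Real.rpow_le_one_of_one_le_of_nonpos (le_add_of_nonneg_right (sq_nonneg _)) (by linarith)

theorem isSymbol_bracket {n : ℕ} {s : ℝ} (hs : s ≤ 0) : IsSymbol (bracket n s) :=
  ⟨continuous_bracket s, 1, fun ξ => by
    rw [abs_of_pos (bracket_pos s ξ)]
    exact bracket_le_one hs ξ⟩

theorem hasTemperateGrowth_bracket {n : ℕ} (s : ℝ) :
    (fun ξ : Rn n => (bracket n s ξ : ℂ)).HasTemperateGrowth := by
  unfold bracket
  fun_prop

theorem mulOp_eq_smul {n : ℕ} {a : Rn n → ℝ} (h : IsSymbol a) (f : L2C n) :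
    mulOp a f = h.memLp.toLp • f := by
  refine mulOp_eq_of_ae h ?_
  filter_upwards [Lp.coeFn_lpSMul (r := 2) h.memLp.toLp f, h.memLp.coeFn_toLp] with ξ h1 h2
  rw [h1, Pi.smul_apply', h2, smul_eq_mul]

theorem norm_toComplex {n : ℕ} (f : L2 n) : ‖toComplex n f‖ = ‖f‖ := by
  rw [Lp.norm_def, Lp.norm_def]
  congr 1
  refine eLpNorm_congr_norm_ae ?_
  filter_upwards [coeFn_toComplex f] with x hx
  rw [hx, Complex.norm_real]

/-- `f ↦ 𝓕 f` on `L²(ℝⁿ)`. -/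
def fourierL2 (n : ℕ) : L2 n →ₗᵢ[ℝ] L2C n where
  toFun f := 𝓕 (toComplex n f)
  map_add' f g := by rw [map_add, FourierTransform.fourier_add]
  map_smul' c f := by
    rw [map_smul, real_smul_eq, FourierTransform.fourier_smul, RingHom.id_apply, real_smul_eq]
  norm_map' f := by
    change ‖𝓕 (toComplex n f)‖ = _
    rw [Lp.norm_fourier_eq, norm_toComplex]

theorem fourierL2_apply {n : ℕ} (f : L2 n) : fourierL2 n f = 𝓕 (toComplex n f) := rfl

/-- The isometry `f ↦ (1 + |ξ|²) ^ (s / 2) 𝓕 f` from `Hˢ(ℝⁿ)` to `L²(ℝⁿ; ℂ)`. -/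
def weightedFourier (n : ℕ) (s : ℝ) : Sobolev n s →ₗᵢ[ℝ] L2C n where
  toFun f := 𝓕 (Sobolev.bessel f : L2C n)
  map_add' f g := by rw [map_add, FourierTransform.fourier_add]
  map_smul' c f := by
    rw [map_smul, real_smul_eq, FourierTransform.fourier_smul, RingHom.id_apply, real_smul_eq]
  norm_map' f := by
    change ‖𝓕 (Sobolev.bessel f : L2C n)‖ = _
    rw [Lp.norm_fourier_eq]
    rfl

theorem smulLeft_bracket_mulOp {n : ℕ} {s : ℝ} (hs : 0 ≤ s) (g : L2C n) :
    TemperedDistribution.smulLeftCLM ℂ (fun ξ : Rn n => (bracket n s ξ : ℂ))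
      (mulOp (bracket n (-s)) g : L2C n) = (g : 𝓢'(Rn n, ℂ)) := by
  rw [mulOp_eq_smul (isSymbol_bracket (by linarith)), Lp.toTemperedDistribution_smul_eq
    (hasTemperateGrowth_bracket _), TemperedDistribution.smulLeftCLM_smulLeftCLM_apply
    (hasTemperateGrowth_bracket _) (hasTemperateGrowth_bracket _)]
  have : ((fun ξ : Rn n => (bracket n (-s) ξ : ℂ)) * fun ξ => (bracket n s ξ : ℂ))
      = fun _ => 1 := by
    ext ξ
    rw [Pi.mul_apply, ← Complex.ofReal_mul, bracket_neg_mul, Complex.ofReal_one]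
  rw [this, TemperedDistribution.smulLeftCLM_const, one_smul]

theorem smulLeft_bracket_injective {n : ℕ} (s : ℝ) {u v : 𝓢'(Rn n, ℂ)}
    (h : TemperedDistribution.smulLeftCLM ℂ (fun ξ : Rn n => (bracket n s ξ : ℂ)) u
      = TemperedDistribution.smulLeftCLM ℂ (fun ξ : Rn n => (bracket n s ξ : ℂ)) v) : u = v := by
  have h1 := congrArg
    (TemperedDistribution.smulLeftCLM ℂ (fun ξ : Rn n => (bracket n (-s) ξ : ℂ))) h
  rw [TemperedDistribution.smulLeftCLM_smulLeftCLM_apply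
    (hasTemperateGrowth_bracket _) (hasTemperateGrowth_bracket _),
    TemperedDistribution.smulLeftCLM_smulLeftCLM_apply
    (hasTemperateGrowth_bracket _) (hasTemperateGrowth_bracket _)] at h1
  have : ((fun ξ : Rn n => (bracket n s ξ : ℂ)) * fun ξ => (bracket n (-s) ξ : ℂ))
      = fun _ => 1 := by
    ext ξ
    rw [Pi.mul_apply, ← Complex.ofReal_mul, mul_comm, bracket_neg_mul, Complex.ofReal_one]
  simpa only [this, TemperedDistribution.smulLeftCLM_const, one_smul] using h1

theorem fourier_bessel {n : ℕ} {s : ℝ} (f : 𝓢'(Rn n, ℂ)) :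
    𝓕 (TemperedDistribution.besselPotential (Rn n) ℂ s f)
      = TemperedDistribution.smulLeftCLM ℂ (fun ξ : Rn n => (bracket n s ξ : ℂ)) (𝓕 f) :=
  TemperedDistribution.fourier_besselPotential_eq_smulLeftCLM_fourier_apply s f

/-- Links the distributional Bessel potential with L² multipliers. Dividing by the weight, rather
than multiplying, keeps every operator bounded on L². -/
theorem mulOp_weightedFourier {n : ℕ} {s : ℝ} (hs : 0 ≤ s) (f : Sobolev n s) :
    mulOp (bracket n (-s)) (weightedFourier n s f) = fourierL2 n f.toL2 := by
  apply toTemperedDistribution_injective n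
  apply smulLeft_bracket_injective s
  simp only
  rw [smulLeft_bracket_mulOp hs, fourierL2_apply, ← Lp.fourier_toTemperedDistribution_eq,
    ← fourier_bessel, f.bessel_spec, Lp.fourier_toTemperedDistribution_eq]
  rfl

/-- The criterion for membership in Hˢ used below: an L² function `g` which, divided by the weight,
is the Fourier transform of a real function. -/
theorem exists_sobolev {n : ℕ} {s : ℝ} (hs : 0 ≤ s) {f : L2 n} {g : L2C n}
    (h : mulOp (bracket n (-s)) g = fourierL2 n f) :
    ∃ F : Sobolev n s, F.toL2 = f ∧ weightedFourier n s F = g := by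
  have h1 : 𝓕 (TemperedDistribution.besselPotential (Rn n) ℂ s (toComplex n f : 𝓢'(Rn n, ℂ)))
      = 𝓕 ((𝓕⁻ g : L2C n) : 𝓢'(Rn n, ℂ)) := by
    rw [fourier_bessel, Lp.fourier_toTemperedDistribution_eq, ← fourierL2_apply, ← h,
      smulLeft_bracket_mulOp hs, Lp.fourier_toTemperedDistribution_eq,
      FourierTransform.fourier_fourierInv_eq]
  have h2 := congrArg (fun u : 𝓢'(Rn n, ℂ) => 𝓕⁻ u) h1
  simp only [FourierTransform.fourierInv_fourier_eq] at h2
  let F : Sobolev n s := (⟨f, ⟨_, h2⟩⟩ : sobolevSubmodule n s)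
  refine ⟨F, rfl, ?_⟩
  have h3 : (Sobolev.bessel F : L2C n) = 𝓕⁻ g := by
    apply toTemperedDistribution_injective n
    simp only
    rw [← F.bessel_spec]
    exact h2
  change 𝓕 (Sobolev.bessel F : L2C n) = g
  rw [h3, FourierTransform.fourier_fourierInv_eq]

theorem mem_range_weightedFourier {n : ℕ} {s : ℝ} (hs : 0 ≤ s) {g : L2C n} :
    g ∈ range (weightedFourier n s) ↔ mulOp (bracket n (-s)) g ∈ range (fourierL2 n) := by
  constructor
  · rintro ⟨f, rfl⟩
    exact ⟨f.toL2, (mulOp_weightedFourier hs f).symm⟩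
  · rintro ⟨f, hf⟩
    obtain ⟨F, -, hF⟩ := exists_sobolev hs hf.symm
    exact ⟨F, hF⟩

/-- The range is the preimage, under a bounded multiplier, of the closed range of the isometry
`fourierL2`. -/
theorem isClosed_range_weightedFourier {n : ℕ} {s : ℝ} (hs : 0 ≤ s) :
    IsClosed (range (weightedFourier n s)) := by
  have h1 : IsClosed (range (fourierL2 n)) :=
    (fourierL2 n).isometry.isClosedEmbedding.isClosed_range
  have h2 : range (weightedFourier n s) = mulOp (bracket n (-s)) ⁻¹' range (fourierL2 n) := by
    ext g
    exact mem_range_weightedFourier hs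
  rw [h2]
  exact h1.preimage (mulOp (bracket n (-s))).continuous

theorem completeSpace_sobolev {n : ℕ} {s : ℝ} (hs : 0 ≤ s) : CompleteSpace (Sobolev n s) :=
  (completeSpace_iff_isComplete_range (weightedFourier n s).isometry.isUniformInducing).2
    (isClosed_range_weightedFourier hs).isComplete

/-- A continuous left inverse of `weightedFourier`. -/
theorem exists_leftInverse_weightedFourier {n : ℕ} {s : ℝ} (hs : 0 ≤ s) :
    ∃ L : L2C n →L[ℝ] Sobolev n s, ∀ f, L (weightedFourier n s f) = f := by
  have hcl : IsComplete ((weightedFourier n s).range : Set (L2C n)) := by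
    have : ((weightedFourier n s).range : Set (L2C n)) = range (weightedFourier n s) := rfl
    rw [this]
    exact (isClosed_range_weightedFourier hs).isComplete
  have : CompleteSpace (weightedFourier n s).range := hcl.completeSpace_coe
  let e := (weightedFourier n s).equivRange
  -- Orthogonal projection onto the closed range, followed by the inverse isometry. Being linear and
  -- bounded on all of L², it carries smooth curves in L² to smooth curves in Hˢ.
  refine ⟨(e.symm.toContinuousLinearEquiv : _ →L[ℝ] Sobolev n s).comp
    (weightedFourier n s).range.orthogonalProjectionOnto, fun f => ?_⟩
  have h1 : weightedFourier n s f = (e f : L2C n) := rfl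
  simp only [ContinuousLinearMap.comp_apply]
  rw [h1, Submodule.orthogonalProjectionOnto_mem_subspace_eq_self]
  simp

/-- The inclusion `Hˢ(ℝⁿ) → L²(ℝⁿ)` as a continuous map. -/
def inclusionL2 {n : ℕ} {s : ℝ} (hs : 0 ≤ s) : Sobolev n s →L[ℝ] L2 n :=
  Sobolev.toL2.mkContinuous 1 fun f => by
    rw [← (fourierL2 n).norm_map, ← mulOp_weightedFourier hs f, ← (weightedFourier n s).norm_map f]
    refine norm_mulOp_le (continuous_bracket _) (fun ξ => ?_) _
    rw [abs_of_pos (bracket_pos _ ξ)]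
    exact bracket_le_one (by linarith) ξ

theorem inclusionL2_apply {n : ℕ} {s : ℝ} (hs : 0 ≤ s) (f : Sobolev n s) :
    inclusionL2 hs f = f.toL2 := rfl

/-! ### Bounds for the symbols -/

/-- A family of symbols, its first two time derivatives, and the decay which makes it map
`L²` to `C([0, T], H²) ∩ C¹([0, T], H¹) ∩ C²([0, T], L²)`. -/
structure IsEnergyFamily {n : ℕ} (c c' c'' : ℝ → Rn n → ℝ) : Prop where
  order_zero : IsSymbolFamily (fun t ξ => bracket n 2 ξ * c t ξ)
  order_one : IsSymbolFamily (fun t ξ => bracket n 1 ξ * c' t ξ)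
  order_two : IsSymbolFamily c''
  hasDerivAt : ∀ t ξ, HasDerivAt (fun s => c s ξ) (c' t ξ) t
  hasDerivAt' : ∀ t ξ, HasDerivAt (fun s => c' s ξ) (c'' t ξ) t

theorem IsSymbolFamily.bracket_mul {n : ℕ} {s t : ℝ} {a : ℝ → Rn n → ℝ} (hst : s ≤ t)
    (h : IsSymbolFamily (fun τ ξ => bracket n t ξ * a τ ξ)) :
    IsSymbolFamily (fun τ ξ => bracket n s ξ * a τ ξ) := by
  have h1 := (IsSymbolFamily.of_isSymbol (isSymbol_bracket (n := n) (sub_nonpos.2 hst))).mul h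
  convert h1 using 3 with τ ξ
  rw [← mul_assoc, ← bracket_add, sub_add_cancel]

theorem IsSymbolFamily.of_bracket_mul {n : ℕ} {t : ℝ} {a : ℝ → Rn n → ℝ} (ht : 0 ≤ t)
    (h : IsSymbolFamily (fun τ ξ => bracket n t ξ * a τ ξ)) : IsSymbolFamily a := by
  simpa [bracket_zero] using h.bracket_mul ht

theorem bracket_one_eq {n : ℕ} (ξ : Rn n) : bracket n 1 ξ = (bracket n (-1) ξ)⁻¹ :=
  eq_inv_of_mul_eq_one_right (bracket_neg_mul 1 ξ)

theorem bracket_two_eq {n : ℕ} (ξ : Rn n) : bracket n 2 ξ = (bracket n (-1) ξ ^ 2)⁻¹ := by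
  rw [← inv_pow, ← bracket_one_eq, sq, ← bracket_add]
  norm_num

theorem bracket_neg_two_eq {n : ℕ} (ξ : Rn n) : bracket n (-2) ξ = bracket n (-1) ξ ^ 2 := by
  rw [sq, ← bracket_add]
  norm_num

theorem bracket_neg_one_sq {n : ℕ} (ξ : Rn n) : bracket n (-1) ξ ^ 2 = (1 + ‖ξ‖ ^ 2)⁻¹ := by
  rw [← bracket_neg_two_eq, bracket]
  norm_num [Real.rpow_neg_one]

/-- The angular frequency `2 π |ξ|`. -/
def freq {n : ℕ} (ξ : Rn n) : ℝ := 2 * Real.pi * ‖ξ‖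

theorem continuous_freq {n : ℕ} : Continuous (freq (n := n)) := by
  unfold freq
  fun_prop

theorem norm_mul_bracket_neg_one_le {n : ℕ} (ξ : Rn n) : ‖ξ‖ * bracket n (-1) ξ ≤ 1 := by
  have hb := bracket_pos (-1) ξ
  have h : (‖ξ‖ * bracket n (-1) ξ) ^ 2 ≤ 1 := by
    rw [mul_pow, bracket_neg_one_sq, ← div_eq_mul_inv, div_le_one (by positivity)]
    linarith
  exact (sq_le_one_iff₀ (by positivity)).1 h

theorem isSymbol_freq_mul_bracket {n : ℕ} :
    IsSymbol (fun ξ : Rn n => freq ξ * bracket n (-1) ξ) := by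
  refine ⟨continuous_freq.mul (continuous_bracket _), 2 * Real.pi, fun ξ => ?_⟩
  have hb := bracket_pos (-1) ξ
  have hpi := Real.pi_pos
  change |2 * Real.pi * ‖ξ‖ * bracket n (-1) ξ| ≤ _
  rw [mul_assoc, abs_of_nonneg (by positivity)]
  exact mul_le_of_le_one_right (by positivity) (norm_mul_bracket_neg_one_le ξ)

/-- The function is (1 + |ξ|²)/(1 + (2πβ|ξ|)²), bounded because β > 0. This ellipticity of the
denominator is the source of the two derivatives gained. -/
theorem isSymbol_inv_bracket_mul {n : ℕ} {β : ℝ} (hβ : 0 < β) :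
    IsSymbol (fun ξ : Rn n => (bracket n (-1) ξ ^ 2 * (1 + β ^ 2 * freq ξ ^ 2))⁻¹) := by
  have hpi := Real.pi_pos
  have hpos : ∀ ξ : Rn n, 0 < bracket n (-1) ξ ^ 2 * (1 + β ^ 2 * freq ξ ^ 2) := fun ξ => by
    have := bracket_pos (-1) ξ
    positivity
  refine ⟨Continuous.inv₀ (((continuous_bracket _).pow 2).mul
    (continuous_const.add (continuous_const.mul (continuous_freq.pow 2)))) fun ξ => (hpos ξ).ne',
    1 + 1 / (β * (2 * Real.pi)) ^ 2, fun ξ => ?_⟩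
  rw [abs_of_pos (inv_pos.2 (hpos ξ)), bracket_neg_one_sq, mul_inv, inv_inv, freq,
    ← div_eq_mul_inv, div_le_iff₀ (by positivity)]
  have e : (1 + 1 / (β * (2 * Real.pi)) ^ 2) * (1 + β ^ 2 * (2 * Real.pi * ‖ξ‖) ^ 2)
      = 1 + ‖ξ‖ ^ 2 + (1 / (β * (2 * Real.pi)) ^ 2 + (β * (2 * Real.pi) * ‖ξ‖) ^ 2) := by
    field_simp
    ring
  rw [e]
  exact le_add_of_nonneg_right (by positivity)

theorem isSymbolFamily_cos {n : ℕ} : IsSymbolFamily (fun t (ξ : Rn n) => Real.cos (freq ξ * t)) := by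
  have := continuous_freq (n := n)
  exact ⟨by fun_prop, fun b => ⟨1, fun t _ ξ => Real.abs_cos_le_one _⟩⟩

theorem isSymbolFamily_sin {n : ℕ} : IsSymbolFamily (fun t (ξ : Rn n) => Real.sin (freq ξ * t)) := by
  have := continuous_freq (n := n)
  exact ⟨by fun_prop, fun b => ⟨1, fun t _ ξ => Real.abs_sin_le_one _⟩⟩

theorem isSymbolFamily_exp {n : ℕ} (β : ℝ) :
    IsSymbolFamily (fun t (_ : Rn n) => Real.exp (-t / β)) :=
  IsSymbolFamily.of_time (by fun_prop)

/-- Decay of order one from two bounds: |t sinc(rt)| ≤ |t| at low frequency, and |r t sinc(rt)| =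
|sin(rt)| ≤ 1 at high frequency. -/
theorem isSymbolFamily_symbol₁ {n : ℕ} :
    IsSymbolFamily (fun t (ξ : Rn n) => symbol₁ t (freq ξ) / bracket n (-1) ξ) := by
  have hc := continuous_freq (n := n)
  have hpi := Real.pi_pos
  constructor
  · have h1 := Real.continuous_sinc
    have h2 := continuous_bracket (n := n) (-1)
    unfold symbol₁
    exact Continuous.div (by fun_prop) (by fun_prop) fun q => (bracket_pos _ _).ne'
  · refine fun b => ⟨b + 1, fun t ht ξ => ?_⟩
    have hb := bracket_pos (-1) ξ
    rw [abs_div, abs_of_pos hb, div_le_iff₀ hb]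
    have h1 : |symbol₁ t (freq ξ)| ≤ b := by
      rw [symbol₁, abs_mul]
      exact (mul_le_of_le_one_right (abs_nonneg _) (Real.abs_sinc_le_one _)).trans ht
    have h2 : ‖ξ‖ * |symbol₁ t (freq ξ)| ≤ 1 := by
      have h3 : |freq ξ * symbol₁ t (freq ξ)| ≤ 1 := by
        rw [symbol₁, mul_mul_sinc]
        exact Real.abs_sin_le_one _
      rw [abs_mul, freq, abs_of_nonneg (by positivity)] at h3
      refine le_trans ?_ h3
      refine mul_le_mul_of_nonneg_right ?_ (abs_nonneg _)
      refine le_mul_of_one_le_left (norm_nonneg _) ?_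
      linarith [Real.two_le_pi]
    have h4 : 1 ≤ (1 + ‖ξ‖) * bracket n (-1) ξ := by
      have h5 : 1 ≤ ((1 + ‖ξ‖) * bracket n (-1) ξ) ^ 2 := by
        rw [mul_pow, bracket_neg_one_sq, ← div_eq_mul_inv, one_le_div (by positivity)]
        nlinarith [norm_nonneg ξ]
      exact (one_le_sq_iff₀ (by positivity)).1 h5
    have h6 : |symbol₁ t (freq ξ)| * (1 + ‖ξ‖) ≤ b + 1 := by nlinarith
    nlinarith [abs_nonneg (symbol₁ t (freq ξ))]

theorem hasDerivAt_symbol₁ (t r : ℝ) : HasDerivAt (fun s => symbol₁ s r) (Real.cos (r * t)) t := by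
  have hc : Continuous fun s : ℝ => Real.cos (r * s) := by fun_prop
  have h := intervalIntegral.integral_hasDerivAt_right (hc.intervalIntegrable 0 t)
    (hc.stronglyMeasurableAtFilter _ _) hc.continuousAt
  simpa only [integral_cos_mul_eq, symbol₁] using h

theorem hasDerivAt_cos_mul (r t : ℝ) :
    HasDerivAt (fun s => Real.cos (r * s)) (-r * Real.sin (r * t)) t := by
  have h1 : HasDerivAt (fun s : ℝ => r * s) r t := by simpa using (hasDerivAt_id t).const_mul r
  exact h1.cos.congr_deriv (by ring)

theorem hasDerivAt_sin_mul (r t : ℝ) :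
    HasDerivAt (fun s => Real.sin (r * s)) (r * Real.cos (r * t)) t := by
  have h1 : HasDerivAt (fun s : ℝ => r * s) r t := by simpa using (hasDerivAt_id t).const_mul r
  exact h1.sin.congr_deriv (by ring)

theorem hasDerivAt_exp_neg_div (β t : ℝ) :
    HasDerivAt (fun s => Real.exp (-s / β)) (-(1 / β) * Real.exp (-t / β)) t := by
  have h1 : HasDerivAt (fun s : ℝ => -s / β) (-1 / β) t := (hasDerivAt_id t).neg.div_const β
  exact h1.exp.congr_deriv (by ring)

/-- The time derivative of `symbol₀`. -/
def symbol₀' (β t r : ℝ) : ℝ :=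
  (-r * Real.sin (r * t) + β * r ^ 2 * Real.cos (r * t) - β * r ^ 2 * Real.exp (-t / β))
    / (1 + β ^ 2 * r ^ 2)

/-- The second time derivative of `symbol₀`. -/
def symbol₀'' (β t r : ℝ) : ℝ :=
  (-r ^ 2 * Real.cos (r * t) - β * r ^ 3 * Real.sin (r * t) + r ^ 2 * Real.exp (-t / β))
    / (1 + β ^ 2 * r ^ 2)

/-- The time derivative of `symbol₂`. -/
def symbol₂' (β t r : ℝ) : ℝ :=
  (β * Real.cos (r * t) + β ^ 2 * r * Real.sin (r * t) - β * Real.exp (-t / β))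
    / (1 + β ^ 2 * r ^ 2)

/-- The second time derivative of `symbol₂`. -/
def symbol₂'' (β t r : ℝ) : ℝ :=
  (-β * r * Real.sin (r * t) + β ^ 2 * r ^ 2 * Real.cos (r * t) + Real.exp (-t / β))
    / (1 + β ^ 2 * r ^ 2)

theorem hasDerivAt_symbol₀ {β : ℝ} (hβ : β ≠ 0) (t r : ℝ) :
    HasDerivAt (fun s => symbol₀ β s r) (symbol₀' β t r) t := by
  refine (((hasDerivAt_cos_mul r t).add ((hasDerivAt_sin_mul r t).const_mul (β * r))).add
    ((hasDerivAt_exp_neg_div β t).const_mul (β ^ 2 * r ^ 2))).div_const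
    (1 + β ^ 2 * r ^ 2) |>.congr_deriv ?_
  rw [symbol₀']
  field_simp
  ring

theorem hasDerivAt_symbol₀' {β : ℝ} (hβ : β ≠ 0) (t r : ℝ) :
    HasDerivAt (fun s => symbol₀' β s r) (symbol₀'' β t r) t := by
  refine ((((hasDerivAt_sin_mul r t).const_mul (-r)).add
    ((hasDerivAt_cos_mul r t).const_mul (β * r ^ 2))).sub
    ((hasDerivAt_exp_neg_div β t).const_mul (β * r ^ 2))).div_const
    (1 + β ^ 2 * r ^ 2) |>.congr_deriv ?_
  rw [symbol₀'']
  field_simp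
  ring

theorem hasDerivAt_symbol₂ {β : ℝ} (hβ : β ≠ 0) (t r : ℝ) :
    HasDerivAt (fun s => symbol₂ β s r) (symbol₂' β t r) t := by
  refine ((((hasDerivAt_symbol₁ t r).const_mul β).sub
    ((hasDerivAt_cos_mul r t).const_mul (β ^ 2))).add
    ((hasDerivAt_exp_neg_div β t).const_mul (β ^ 2))).div_const
    (1 + β ^ 2 * r ^ 2) |>.congr_deriv ?_
  rw [symbol₂']
  field_simp
  ring

theorem hasDerivAt_symbol₂' {β : ℝ} (hβ : β ≠ 0) (t r : ℝ) :
    HasDerivAt (fun s => symbol₂' β s r) (symbol₂'' β t r) t := by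
  refine ((((hasDerivAt_cos_mul r t).const_mul β).add
    ((hasDerivAt_sin_mul r t).const_mul (β ^ 2 * r))).sub
    ((hasDerivAt_exp_neg_div β t).const_mul β)).div_const
    (1 + β ^ 2 * r ^ 2) |>.congr_deriv ?_
  rw [symbol₂'']
  field_simp
  ring

section families

variable {n : ℕ} {β : ℝ}

/-- Every term is a product of bounded factors: ⟨ξ⟩⁻¹, r⟨ξ⟩⁻¹, the elliptic quotient `Q₂`, and
trigonometric or exponential functions. Each time derivative brings one more power of r, which the
weight dropped by one order pays for. -/
theorem isEnergyFamily_symbol₀ (hβ : 0 < β) : IsEnergyFamily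
    (fun t (ξ : Rn n) => bracket n (-2) ξ * symbol₀ β t (freq ξ))
    (fun t ξ => bracket n (-2) ξ * symbol₀' β t (freq ξ))
    (fun t ξ => bracket n (-2) ξ * symbol₀'' β t (freq ξ)) := by
  have B := IsSymbolFamily.of_isSymbol (isSymbol_bracket (n := n) (s := -1) (by norm_num))
  have Q₁ := IsSymbolFamily.of_isSymbol (isSymbol_freq_mul_bracket (n := n))
  have Q₂ := IsSymbolFamily.of_isSymbol (isSymbol_inv_bracket_mul (n := n) hβ)
  have S := isSymbolFamily_sin (n := n)
  have C := isSymbolFamily_cos (n := n)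
  have E := isSymbolFamily_exp (n := n) β
  have K := IsSymbolFamily.of_time (n := n) (continuous_const (y := β))
  refine ⟨?_, ?_, ?_, fun t ξ => (hasDerivAt_symbol₀ hβ.ne' t _).const_mul _,
    fun t ξ => (hasDerivAt_symbol₀' hβ.ne' t _).const_mul _⟩
  · have h := ((((B.mul B).mul Q₂).mul C).add ((((K.mul B).mul Q₁).mul Q₂).mul S)).add
      (((((K.mul K).mul Q₁).mul Q₁).mul Q₂).mul E)
    convert h using 3 with t ξ
    have hb := (bracket_pos (-1) ξ).ne'
    rw [bracket_two_eq, bracket_neg_two_eq, symbol₀]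
    field_simp
  · have h := ((((((B.mul B).mul Q₁).mul Q₂).mul S).neg).add
      ((((((B.mul K).mul Q₁).mul Q₁).mul Q₂).mul C))).sub
      ((((((B.mul K).mul Q₁).mul Q₁).mul Q₂).mul E))
    convert h using 3 with t ξ
    have hb := (bracket_pos (-1) ξ).ne'
    rw [bracket_one_eq, bracket_neg_two_eq, symbol₀']
    field_simp
  · have h := (((((((B.mul B).mul Q₁).mul Q₁).mul Q₂).mul C).neg).sub
      ((((((B.mul K).mul Q₁).mul Q₁).mul Q₁).mul Q₂).mul S)).add
      (((((B.mul B).mul Q₁).mul Q₁).mul Q₂).mul E)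
    convert h using 3 with t ξ
    have hb := (bracket_pos (-1) ξ).ne'
    rw [bracket_neg_two_eq, symbol₀'']
    field_simp

theorem isEnergyFamily_symbol₁ : IsEnergyFamily
    (fun t (ξ : Rn n) => bracket n (-1) ξ * symbol₁ t (freq ξ))
    (fun t ξ => bracket n (-1) ξ * Real.cos (freq ξ * t))
    (fun t ξ => bracket n (-1) ξ * (-freq ξ * Real.sin (freq ξ * t))) := by
  refine ⟨?_, ?_, ?_, fun t ξ => (hasDerivAt_symbol₁ t _).const_mul _,
    fun t ξ => (hasDerivAt_cos_mul _ t).const_mul _⟩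
  · convert isSymbolFamily_symbol₁ (n := n) using 3 with t ξ
    have hb := (bracket_pos (-1) ξ).ne'
    rw [bracket_two_eq]
    field_simp
  · convert isSymbolFamily_cos (n := n) using 3 with t ξ
    have hb := (bracket_pos (-1) ξ).ne'
    rw [bracket_one_eq]
    field_simp
  · convert ((IsSymbolFamily.of_isSymbol (isSymbol_freq_mul_bracket (n := n))).mul
      isSymbolFamily_sin).neg using 3 with t ξ
    ring

/-- No weight is taken from the data here: the denominator alone supplies order −2, so the source
and `u₂` need only be in L². -/
theorem isEnergyFamily_symbol₂ (hβ : 0 < β) : IsEnergyFamily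
    (fun t (ξ : Rn n) => symbol₂ β t (freq ξ))
    (fun t ξ => symbol₂' β t (freq ξ)) (fun t ξ => symbol₂'' β t (freq ξ)) := by
  have B := IsSymbolFamily.of_isSymbol (isSymbol_bracket (n := n) (s := -1) (by norm_num))
  have Q₁ := IsSymbolFamily.of_isSymbol (isSymbol_freq_mul_bracket (n := n))
  have Q₂ := IsSymbolFamily.of_isSymbol (isSymbol_inv_bracket_mul (n := n) hβ)
  have S := isSymbolFamily_sin (n := n)
  have C := isSymbolFamily_cos (n := n)
  have E := isSymbolFamily_exp (n := n) β
  have W := isSymbolFamily_symbol₁ (n := n)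
  have K := IsSymbolFamily.of_time (n := n) (continuous_const (y := β))
  refine ⟨?_, ?_, ?_, fun t ξ => hasDerivAt_symbol₂ hβ.ne' t _,
    fun t ξ => hasDerivAt_symbol₂' hβ.ne' t _⟩
  · have h := Q₂.mul (((K.mul (B.mul W)).sub ((K.mul K).mul C)).add ((K.mul K).mul E))
    convert h using 3 with t ξ
    have hb := (bracket_pos (-1) ξ).ne'
    rw [bracket_two_eq, symbol₂, symbol₁]
    field_simp
  · have h := ((B.mul Q₂).mul ((K.mul C).sub (K.mul E))).add ((((K.mul K).mul Q₁).mul Q₂).mul S)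
    convert h using 3 with t ξ
    have hb := (bracket_pos (-1) ξ).ne'
    rw [bracket_one_eq, symbol₂']
    field_simp
    ring
  · have h := ((((((K.mul B).mul Q₁).mul Q₂).mul S).neg).add
      (((((K.mul K).mul Q₁).mul Q₁).mul Q₂).mul C)).add (((B.mul B).mul Q₂).mul E)
    convert h using 3 with t ξ
    have hb := (bracket_pos (-1) ξ).ne'
    rw [symbol₂'']
    field_simp

end families

/-! ### Duhamel integrals and mild equations in Banach spaces -/

section abstractMild

variable {X Y : Type*} [NormedAddCommGroup X] [NormedSpace ℝ X] [NormedAddCommGroup Y]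

theorem continuous_duhamel {A : ℝ → Y → X} (hA : Continuous (Function.uncurry A)) {h : ℝ → Y}
    (hh : Continuous h) : Continuous (fun t => ∫ τ in (0 : ℝ)..t, A (t - τ) (h τ)) := by
  refine intervalIntegral.continuous_parametric_intervalIntegral_of_continuous
    (f := fun t τ => A (t - τ) (h τ)) ?_ continuous_id
  exact hA.comp (by fun_prop : Continuous fun q : ℝ × ℝ => (q.1 - q.2, h q.2))

/-- The derivative of a Duhamel integral whose kernel vanishes at time zero. -/
theorem hasDerivAt_duhamel {A A' : ℝ → Y → X} (hA : Continuous (Function.uncurry A))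
    (hA' : Continuous (Function.uncurry A')) (hd : ∀ t y, HasDerivAt (fun s => A s y) (A' t y) t)
    (h0 : ∀ y, A 0 y = 0) {h : ℝ → Y} (hh : Continuous h) (t : ℝ) :
    HasDerivAt (fun t => ∫ τ in (0 : ℝ)..t, A (t - τ) (h τ))
      (∫ τ in (0 : ℝ)..t, A' (t - τ) (h τ)) t := by
  have hc : ∀ x : ℝ, Continuous fun τ => A (x - τ) (h τ) := fun x =>
    hA.comp (by fun_prop : Continuous fun τ : ℝ => (x - τ, h τ))
  have hc' : Continuous fun q : ℝ × ℝ => A' (q.1 - q.2) (h q.2) :=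
    hA'.comp (by fun_prop : Continuous fun q : ℝ × ℝ => (q.1 - q.2, h q.2))
  obtain ⟨C, hC⟩ := ((isCompact_closedBall t 1).prod (isCompact_uIcc (a := 0) (b := t))
    ).exists_bound_of_continuousOn hc'.continuousOn
  -- The upper limit is frozen, and differentiation under the integral sign applies.
  have h1 : HasDerivAt (fun x => ∫ τ in (0 : ℝ)..t, A (x - τ) (h τ))
      (∫ τ in (0 : ℝ)..t, A' (t - τ) (h τ)) t := by
    refine (intervalIntegral.hasDerivAt_integral_of_dominated_loc_of_deriv_le (s := Metric.ball t 1)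
      (bound := fun _ => C) (F' := fun x τ => A' (x - τ) (h τ)) (Metric.ball_mem_nhds t one_pos)
      (Filter.Eventually.of_forall fun x => (hc x).aestronglyMeasurable)
      ((hc t).intervalIntegrable _ _) ?_ ?_ intervalIntegrable_const ?_).2
    · exact (hc'.comp (by fun_prop : Continuous fun τ : ℝ => (t, τ))).aestronglyMeasurable
    · exact Filter.Eventually.of_forall fun τ hτ x hx =>
        hC (x, τ) ⟨Metric.ball_subset_closedBall hx, uIoc_subset_uIcc hτ⟩
    · refine Filter.Eventually.of_forall fun τ _ x _ => ?_
      exact (hd (x - τ) (h τ)).comp_sub_const x τ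
  -- The boundary contribution is o(x − t), because the kernel is small near time zero. Continuity
  -- of `h` is enough.
  have h2 : HasDerivAt (fun x => ∫ τ in t..x, A (x - τ) (h τ)) 0 t := by
    rw [hasDerivAt_iff_isLittleO, Asymptotics.isLittleO_iff]
    intro ε hε
    have hcont : Filter.Tendsto (fun q : ℝ × ℝ => ‖A (q.1 - q.2) (h q.2)‖) (nhds (t, t))
        (nhds 0) := by
      have : Continuous fun q : ℝ × ℝ => ‖A (q.1 - q.2) (h q.2)‖ :=
        (hA.comp (by fun_prop : Continuous fun q : ℝ × ℝ => (q.1 - q.2, h q.2))).norm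
      simpa [h0] using this.tendsto (t, t)
    obtain ⟨δ, hδ, hball⟩ := Metric.eventually_nhds_iff.1 (hcont.eventually_lt_const hε)
    filter_upwards [Metric.ball_mem_nhds t hδ] with x hx
    simp only [intervalIntegral.integral_same, sub_zero, smul_zero]
    rw [Real.norm_eq_abs]
    refine intervalIntegral.norm_integral_le_of_norm_le_const fun τ hτ => ?_
    have hdist : dist (x, τ) (t, t) < δ := by
      rw [Prod.dist_eq, max_lt_iff]
      refine ⟨hx, lt_of_le_of_lt ?_ hx⟩
      rw [Real.dist_eq, Real.dist_eq]
      exact abs_sub_left_of_mem_uIcc (uIoc_subset_uIcc hτ)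
    exact (hball hdist).le
  have h3 := h1.add h2
  rw [add_zero] at h3
  refine h3.congr_of_eventuallyEq (Filter.Eventually.of_forall fun x => ?_)
  exact (intervalIntegral.integral_add_adjacent_intervals ((hc x).intervalIntegrable _ _)
    ((hc x).intervalIntegrable _ _)).symm

variable [NormedSpace ℝ Y] {S : ℝ → Y →L[ℝ] X} {G : X → Y}

/-- Local existence for mild equations with a locally Lipschitz nonlinearity, in a family of closed
sets which is preserved by the Duhamel operator. -/
theorem exists_mild_solution [CompleteSpace X]
    (hS : Continuous fun q : ℝ × Y => S q.1 q.2) {M : ℝ} (hM0 : 0 ≤ M)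
    (hM : ∀ t ∈ Icc (0 : ℝ) 1, ∀ y, ‖S t y‖ ≤ M * ‖y‖)
    (hGc : Continuous G)
    (hG : ∀ ρ, ∃ L, 0 ≤ L ∧ ∀ x x', ‖x‖ ≤ ρ → ‖x'‖ ≤ ρ → ‖G x - G x'‖ ≤ L * ‖x - x'‖)
    {g : ℝ → X} (hg : Continuous g) {P : ℝ → Set X} (hP : ∀ t, IsClosed (P t))
    (hP0 : ∀ t, 0 ∈ P t)
    (hPinv : ∀ (u : ℝ → X) (T : ℝ), Continuous u → (∀ t ∈ Icc 0 T, u t ∈ P t) →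
      ∀ t ∈ Icc 0 T, g t + ∫ τ in (0 : ℝ)..t, S (t - τ) (G (u τ)) ∈ P t) :
    ∃ T, 0 < T ∧ ∃ u : ℝ → X, Continuous u ∧ (∀ t ∈ Icc 0 T, u t ∈ P t) ∧
      ∀ t ∈ Icc 0 T, u t = g t + ∫ τ in (0 : ℝ)..t, S (t - τ) (G (u τ)) := by
  obtain ⟨C, hC⟩ := (isCompact_Icc (a := (0 : ℝ)) (b := 1)).exists_bound_of_continuousOn
    hg.continuousOn
  have hC0 : 0 ≤ C := (norm_nonneg _).trans (hC 0 (by simp))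
  obtain ⟨L, hL0, hL⟩ := hG (C + 1)
  set B := M * (‖G 0‖ + L * (C + 1)) with hB
  have hB0 : 0 ≤ B := by positivity
  -- `B` bounds the integrand on the ball of radius `C + 1`. This T gives T·M·L ≤ 1/2 for the
  -- contraction, T·B ≤ 1 for invariance of the ball, and T ≤ 1 so that the bounds on [0, 1] apply.
  set T := 1 / (2 * (M * L + B + 1)) with hT
  have hTpos : 0 < T := by positivity
  have hTB : T * (M * L + B + 1) = 1 / 2 := by
    rw [hT]
    field_simp
  have hT1 : T ≤ 1 := by nlinarith [mul_nonneg hM0 hL0]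
  have hTML : T * (M * L) ≤ 1 / 2 := by nlinarith
  have hTB' : T * B ≤ 1 := by nlinarith [mul_nonneg hM0 hL0]
  -- Curves are extended by constants outside [0, T], so that the Duhamel integral is defined and
  -- continuous for all times.
  let ext : C(Icc 0 T, X) → ℝ → X := fun f t => f (projIcc 0 T hTpos.le t)
  have hext : ∀ f, Continuous (ext f) := fun f => f.continuous.comp continuous_projIcc
  have hint : ∀ f : C(Icc 0 T, X), ∀ t, Continuous fun τ => S (t - τ) (G (ext f τ)) :=
    fun f t => hS.comp ((continuous_const.sub continuous_id).prodMk (hGc.comp (hext f)))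
  let Φ : C(Icc 0 T, X) → C(Icc 0 T, X) := fun f =>
    ⟨fun t => g t + ∫ τ in (0 : ℝ)..t, S (t - τ) (G (ext f τ)),
      (hg.add (continuous_duhamel (A := fun t y => S t y) hS
        (hGc.comp (hext f)))).comp continuous_subtype_val⟩
  let s : Set C(Icc 0 T, X) := {f | ∀ t, ‖f t‖ ≤ C + 1 ∧ f t ∈ P t}
  have hs : IsClosed s := by
    have : s = ⋂ t : Icc 0 T, {f | ‖f t‖ ≤ C + 1} ∩ {f | f t ∈ P t} := by
      ext f
      simp [s]
    rw [this]
    refine isClosed_iInter fun t => ?_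
    have hev : Continuous fun f : C(Icc 0 T, X) => f t := continuous_eval_const t
    exact (isClosed_le hev.norm continuous_const).inter ((hP t).preimage hev)
  have hmem : ∀ t ∈ Icc 0 T, ∀ τ ∈ uIoc 0 t, t - τ ∈ Icc (0 : ℝ) 1 := by
    intro t ht τ hτ
    rw [uIoc_of_le ht.1] at hτ
    exact ⟨by linarith [hτ.2], by linarith [hτ.1, ht.2]⟩
  have hmaps : MapsTo Φ s s := by
    intro f hf t
    have hbd : ‖∫ τ in (0 : ℝ)..t, S (t - τ) (G (ext f τ))‖ ≤ B * |(t : ℝ) - 0| := by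
      refine intervalIntegral.norm_integral_le_of_norm_le_const fun τ hτ => ?_
      refine (hM _ (hmem t t.2 τ hτ) _).trans (mul_le_mul_of_nonneg_left ?_ hM0)
      have h1 := hL (ext f τ) 0 (hf _).1 (by rw [norm_zero]; linarith)
      rw [sub_zero] at h1
      have h2 : ‖G (ext f τ)‖ ≤ ‖G 0‖ + ‖G (ext f τ) - G 0‖ := by
        simpa using norm_add_le (G 0) (G (ext f τ) - G 0)
      have h3 : L * ‖ext f τ‖ ≤ L * (C + 1) := mul_le_mul_of_nonneg_left (hf _).1 hL0
      linarith
    refine ⟨?_, ?_⟩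
    · have ht1 : |(t : ℝ) - 0| ≤ T := by
        rw [sub_zero, abs_of_nonneg t.2.1]
        exact t.2.2
      have h1 := norm_add_le (g t) (∫ τ in (0 : ℝ)..t, S (t - τ) (G (ext f τ)))
      have h2 := hC t ⟨t.2.1, t.2.2.trans hT1⟩
      have h3 := mul_le_mul_of_nonneg_left ht1 hB0
      change ‖g t + _‖ ≤ _
      linarith
    · refine hPinv (ext f) T (hext f) (fun r hr => ?_) t t.2
      have : ext f r = f ⟨r, hr⟩ := congrArg f (projIcc_of_mem _ hr)
      rw [this]
      exact (hf ⟨r, hr⟩).2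
  have hcontr : ContractingWith (1 / 2) (hmaps.restrict Φ s s) := by
    refine ⟨by rw [← NNReal.coe_lt_coe]; norm_num, LipschitzWith.of_dist_le_mul ?_⟩
    rintro ⟨f, hf⟩ ⟨f', hf'⟩
    change dist (Φ f) (Φ f') ≤ _ * dist f f'
    rw [ContinuousMap.dist_le (by positivity)]
    intro t
    rw [dist_eq_norm]
    change ‖(g t + _) - (g t + _)‖ ≤ _
    rw [add_sub_add_left_eq_sub, ← intervalIntegral.integral_sub
      ((hint f t).intervalIntegrable _ _) ((hint f' t).intervalIntegrable _ _)]
    have hbd : ‖∫ τ in (0 : ℝ)..t, (S (t - τ) (G (ext f τ)) - S (t - τ) (G (ext f' τ)))‖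
        ≤ M * (L * dist f f') * |(t : ℝ) - 0| := by
      refine intervalIntegral.norm_integral_le_of_norm_le_const fun τ hτ => ?_
      rw [← map_sub]
      refine (hM _ (hmem t t.2 τ hτ) _).trans (mul_le_mul_of_nonneg_left ?_ hM0)
      refine (hL _ _ (hf _).1 (hf' _).1).trans (mul_le_mul_of_nonneg_left ?_ hL0)
      rw [← dist_eq_norm]
      exact ContinuousMap.dist_apply_le_dist _
    refine hbd.trans ?_
    rw [sub_zero, abs_of_nonneg t.2.1]
    have h4 : (0 : ℝ) ≤ dist f f' := dist_nonneg
    have h5 : M * (L * dist f f') * t ≤ M * (L * dist f f') * T :=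
      mul_le_mul_of_nonneg_left t.2.2 (by positivity)
    have h6 := mul_le_mul_of_nonneg_right hTML h4
    have h7 : (((1 / 2 : NNReal) : ℝ)) = 1 / 2 := by norm_num
    rw [h7]
    linarith
  have h0s : (0 : C(Icc 0 T, X)) ∈ s := fun t => ⟨by simpa using by linarith, hP0 t⟩
  obtain ⟨f, hfs, hfix, -⟩ := hcontr.exists_fixedPoint' hs.isComplete hmaps h0s
    (edist_ne_top _ _)
  refine ⟨T, hTpos, ext f, hext f, fun t ht => ?_, fun t ht => ?_⟩
  · have : ext f t = f ⟨t, ht⟩ := congrArg f (projIcc_of_mem _ ht)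
    rw [this]
    exact (hfs ⟨t, ht⟩).2
  · have : ext f t = f ⟨t, ht⟩ := congrArg f (projIcc_of_mem _ ht)
    rw [this]
    exact (DFunLike.congr_fun hfix (⟨t, ht⟩ : Icc 0 T)).symm

/-- Unconditional uniqueness for mild equations with a locally Lipschitz nonlinearity. -/
theorem mild_solution_unique (hS : Continuous fun q : ℝ × Y => S q.1 q.2)
    {M T : ℝ} (hT : 0 ≤ T) (hM0 : 0 ≤ M) (hM : ∀ t ∈ Icc (0 : ℝ) T, ∀ y, ‖S t y‖ ≤ M * ‖y‖)
    (hGc : Continuous G)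
    (hG : ∀ ρ, ∃ L, 0 ≤ L ∧ ∀ x x', ‖x‖ ≤ ρ → ‖x'‖ ≤ ρ → ‖G x - G x'‖ ≤ L * ‖x - x'‖)
    {g u v : ℝ → X} (hu : ContinuousOn u (Icc 0 T)) (hv : ContinuousOn v (Icc 0 T))
    (hu' : ∀ t ∈ Icc 0 T, u t = g t + ∫ τ in (0 : ℝ)..t, S (t - τ) (G (u τ)))
    (hv' : ∀ t ∈ Icc 0 T, v t = g t + ∫ τ in (0 : ℝ)..t, S (t - τ) (G (v τ))) :
    ∀ t ∈ Icc 0 T, u t = v t := by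
  obtain ⟨A, hA⟩ := isCompact_Icc.exists_bound_of_continuousOn hu
  obtain ⟨B, hB⟩ := isCompact_Icc.exists_bound_of_continuousOn hv
  obtain ⟨L, hL0, hL⟩ := hG (max A B)
  -- Clamping time to [0, T] makes both curves continuous on the whole line without changing the
  -- integrals that occur.
  let pr : ℝ → ℝ := fun t => projIcc 0 T hT t
  have hpr : ∀ t ∈ Icc 0 T, pr t = t := fun t ht => congrArg Subtype.val (projIcc_of_mem hT ht)
  have hprm : ∀ t, pr t ∈ Icc 0 T := fun t => (projIcc 0 T hT t).2
  have hprc : Continuous pr := continuous_subtype_val.comp continuous_projIcc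
  have huc : Continuous fun t => u (pr t) := hu.comp_continuous hprc hprm
  have hvc : Continuous fun t => v (pr t) := hv.comp_continuous hprc hprm
  let φ : ℝ → ℝ := fun t => ‖u (pr t) - v (pr t)‖
  have hφ : Continuous φ := (huc.sub hvc).norm
  have hcongr : ∀ w : ℝ → X, ∀ t ∈ Icc 0 T, ∫ τ in (0 : ℝ)..t, S (t - τ) (G (w τ))
      = ∫ τ in (0 : ℝ)..t, S (t - τ) (G (w (pr τ))) := by
    intro w t ht
    refine intervalIntegral.integral_congr fun τ hτ => ?_
    rw [uIcc_of_le ht.1] at hτ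
    simp only [hpr τ ⟨hτ.1, hτ.2.trans ht.2⟩]
  have hci : ∀ w : ℝ → X, Continuous (fun t => w (pr t)) → ∀ t,
      IntervalIntegrable (fun τ => S (t - τ) (G (w (pr τ)))) volume 0 t := fun w hw t =>
    (hS.comp ((continuous_const.sub continuous_id).prodMk (hGc.comp hw))).intervalIntegrable _ _
  have hineq : ∀ t ∈ Icc 0 T, φ t ≤ M * L * ∫ τ in (0 : ℝ)..t, φ τ := by
    intro t ht
    have e : u (pr t) - v (pr t)
        = ∫ τ in (0 : ℝ)..t, S (t - τ) (G (u (pr τ)) - G (v (pr τ))) := by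
      rw [hpr t ht, hu' t ht, hv' t ht, add_sub_add_left_eq_sub, hcongr u t ht, hcongr v t ht,
        ← intervalIntegral.integral_sub (hci u huc t) (hci v hvc t)]
      simp only [map_sub]
    change ‖u (pr t) - v (pr t)‖ ≤ _
    rw [e, ← intervalIntegral.integral_const_mul]
    refine intervalIntegral.norm_integral_le_of_norm_le ht.1 ?_
      ((hφ.const_mul (M * L)).intervalIntegrable _ _)
    refine Filter.Eventually.of_forall fun τ hτ => ?_
    refine (hM _ ⟨by linarith [hτ.2], by linarith [hτ.1, ht.2]⟩ _).trans ?_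
    rw [mul_assoc]
    refine mul_le_mul_of_nonneg_left (hL _ _ ?_ ?_) hM0
    · exact (hA _ (hprm τ)).trans (le_max_left _ _)
    · exact (hB _ (hprm τ)).trans (le_max_right _ _)
  -- Gronwall is applied to the primitive of φ, since φ itself is only continuous: ψ' = φ ≤ MLψ and
  -- ψ(0) = 0.
  have hψ : ∀ t, HasDerivAt (fun t => ∫ τ in (0 : ℝ)..t, φ τ) (φ t) t := fun t =>
    intervalIntegral.integral_hasDerivAt_right (hφ.intervalIntegrable _ _)
      (hφ.stronglyMeasurableAtFilter _ _) hφ.continuousAt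
  have hgr := norm_le_gronwallBound_of_norm_deriv_right_le (f := fun t => ∫ τ in (0 : ℝ)..t, φ τ)
    (f' := φ) (δ := 0) (K := M * L) (ε := 0) (a := 0) (b := T)
    (fun t _ => (hψ t).continuousAt.continuousWithinAt) (fun t _ => (hψ t).hasDerivWithinAt)
    (by simp) (fun t ht => by
      rw [add_zero, Real.norm_of_nonneg (norm_nonneg _)]
      refine (hineq t ⟨ht.1, ht.2.le⟩).trans
        (mul_le_mul_of_nonneg_left (Real.le_norm_self _) (mul_nonneg hM0 hL0)))
  intro t ht
  have h1 := hgr t ht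
  rw [gronwallBound_ε0_δ0, norm_le_zero_iff] at h1
  have h2 := hineq t ht
  rw [h1, mul_zero] at h2
  have h3 : ‖u (pr t) - v (pr t)‖ = 0 := le_antisymm h2 (norm_nonneg _)
  rw [hpr t ht, norm_eq_zero, sub_eq_zero] at h3
  exact h3

end abstractMild

/-! ### The Sobolev embedding -/

/-- The L² inverse transform, defined by extension, agrees with the absolutely convergent integral.
Both are tested against smooth compactly supported functions, and the transform is moved onto the
test function. -/
theorem fourierInv_ae_eq {n : ℕ} {h : L2C n} (hi : Integrable h volume) :
    (𝓕⁻ h : L2C n) =ᵐ[volume] fun x => ∫ ξ, character x ξ * h ξ := by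
  have hG : ∀ x, ∫ ξ, character x ξ * h ξ
      = VectorFourier.fourierIntegral Real.fourierChar volume (-innerₗ (Rn n)).flip h x := by
    intro x
    simp only [VectorFourier.fourierIntegral, character]
    refine integral_congr_ae (Filter.Eventually.of_forall fun ξ => ?_)
    simp [Circle.smul_def]
  have hL : Continuous fun q : Rn n × Rn n => (-innerₗ (Rn n)) q.1 q.2 := by
    simp only [LinearMap.neg_apply, innerₗ_apply_apply]
    fun_prop
  have hL' : Continuous fun q : Rn n × Rn n => (-innerₗ (Rn n)).flip q.1 q.2 :=
    hL.comp continuous_swap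
  have hGc : Continuous fun x => ∫ ξ, character x ξ * h ξ := by
    simp only [hG]
    exact VectorFourier.fourierIntegral_continuous Real.continuous_fourierChar hL' hi
  refine ae_eq_of_integral_contDiff_smul_eq ((Lp.memLp _).locallyIntegrable one_le_two)
    hGc.locallyIntegrable fun g g_smooth g_cpt => ?_
  have hg₁ : HasCompactSupport (Complex.ofRealCLM ∘ g) := g_cpt.comp_left rfl
  have hg₂ : ContDiff ℝ (⊤ : ℕ∞) (Complex.ofRealCLM ∘ g) :=
    Complex.ofRealCLM.contDiff.comp g_smooth
  let φ : 𝓢(Rn n, ℂ) := hg₁.toSchwartzMap hg₂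
  have hφ : ∀ x, φ x = (g x : ℂ) := fun x => rfl
  have h1 := DFunLike.congr_fun (Lp.fourierInv_toTemperedDistribution_eq h) φ
  rw [TemperedDistribution.fourierInv_apply, Lp.toTemperedDistribution_apply,
    Lp.toTemperedDistribution_apply] at h1
  have h2 := VectorFourier.integral_fourierIntegral_smul_eq_flip (μ := (volume : Measure (Rn n)))
    (ν := (volume : Measure (Rn n))) Real.continuous_fourierChar hL φ.integrable hi
  calc ∫ x, g x • (𝓕⁻ h : L2C n) x = ∫ x, φ x • (𝓕⁻ h : L2C n) x := by
        simp only [hφ, Complex.real_smul, smul_eq_mul]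
    _ = ∫ x, (𝓕⁻ φ) x • h x := h1.symm
    _ = _ := by
        rw [SchwartzMap.fourierInv_coe]
        refine h2.trans ?_
        simp only [hφ, Complex.real_smul, smul_eq_mul, hG]

theorem norm_fourierInv_le {n : ℕ} {h : L2C n} (hi : Integrable h volume) :
    ∀ᵐ x, ‖(𝓕⁻ h : L2C n) x‖ ≤ ∫ ξ, ‖h ξ‖ := by
  filter_upwards [fourierInv_ae_eq hi] with x hx
  rw [hx]
  refine (norm_integral_le_integral_norm _).trans (le_of_eq ?_)
  refine integral_congr_ae (Filter.Eventually.of_forall fun ξ => ?_)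
  simp only [norm_mul, norm_character, one_mul]

theorem eLpNorm_bracket_lt_top {n : ℕ} {s : ℝ} (hs : (n : ℝ) < 2 * s) :
    eLpNorm (bracket n (-s)) 2 volume < ∞ := by
  have h : Integrable (fun ξ : Rn n => bracket n (-s) ξ ^ 2) volume := by
    have h1 := integrable_rpow_neg_one_add_norm_sq (E := Rn n) (μ := volume) (r := 2 * s)
      (by simpa using hs)
    refine h1.congr (Filter.Eventually.of_forall fun ξ => ?_)
    simp only [bracket]
    rw [← Real.rpow_mul_natCast (by positivity)]
    congr 1
    push_cast
    ring
  exact ((memLp_two_iff_integrable_sq (continuous_bracket _).aestronglyMeasurable).2 h).2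

/-- The low frequency part of a function with a weighted Fourier transform in `L²` is bounded. -/
theorem integral_norm_lowFrequency_le {n : ℕ} {θ K : ℝ} (hK : 0 < K)
    (hB : eLpNorm (bracket n (-(2 + θ))) 2 volume ≤ ENNReal.ofReal K) {g : L2C n}
    (hg : ‖g‖ ≤ 1) {l : ℝ} (hl : 0 < l) {w : L2C n}
    (hw : ∀ᵐ ξ, ‖w ξ‖ ≤ if 2 * K * bracket n θ ξ ≤ l then bracket n (-2) ξ * ‖g ξ‖ else 0) :
    Integrable w volume ∧ ∫ ξ, ‖w ξ‖ ≤ l / 2 := by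
  -- On the low-frequency set ⟨ξ⟩⁻² ≤ (l/2K)⟨ξ⟩^{-(2+θ)}, and Cauchy–Schwarz with the L² norm of
  -- ⟨ξ⟩^{-(2+θ)} gives (l/2K)·K = l/2.
  have h1 : eLpNorm w 1 volume ≤ ENNReal.ofReal (l / 2) := by
    calc eLpNorm w 1 volume
        ≤ eLpNorm ((l / (2 * K)) • (bracket n (-(2 + θ)) • fun ξ => ‖g ξ‖)) 1 volume := by
          refine eLpNorm_mono_ae ?_
          filter_upwards [hw] with ξ hξ
          refine hξ.trans ?_
          have hb := bracket_pos (n := n) (-(2 + θ)) ξ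
          have hb' := bracket_pos (n := n) θ ξ
          simp only [Pi.smul_apply, smul_eq_mul, Pi.mul_apply]
          rw [Real.norm_of_nonneg (by positivity)]
          split_ifs with hle
          · have e : bracket n (-2) ξ = bracket n θ ξ * bracket n (-(2 + θ)) ξ := by
              rw [← bracket_add]
              congr 1
              ring
            have h2 : bracket n θ ξ ≤ l / (2 * K) := by
              rw [le_div_iff₀ (by positivity)]
              linarith
            rw [e, mul_assoc]
            exact mul_le_mul_of_nonneg_right h2 (by positivity)
          · positivity
      _ ≤ ENNReal.ofReal (l / (2 * K)) * (ENNReal.ofReal K * 1) := by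
          rw [eLpNorm_const_smul, Real.enorm_of_nonneg (by positivity : 0 ≤ l / (2 * K))]
          gcongr
          refine (eLpNorm_smul_le_mul_eLpNorm (p := 2) (q := 2)
            (Lp.aestronglyMeasurable g).norm (continuous_bracket _).aestronglyMeasurable).trans ?_
          gcongr
          rw [eLpNorm_norm, ← ENNReal.ofReal_one]
          rw [Lp.norm_def] at hg
          exact ENNReal.le_ofReal_iff_toReal_le (Lp.eLpNorm_ne_top g) zero_le_one |>.2 hg
      _ = ENNReal.ofReal (l / 2) := by
          rw [mul_one, ← ENNReal.ofReal_mul (by positivity)]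
          congr 1
          field_simp
  have h2 : MemLp w 1 volume := ⟨Lp.aestronglyMeasurable w, h1.trans_lt ENNReal.ofReal_lt_top⟩
  have h3 : Integrable w volume := memLp_one_iff_integrable.1 h2
  refine ⟨h3, ?_⟩
  rw [integral_norm_eq_lintegral_enorm h3.1, ← eLpNorm_one_eq_lintegral_enorm]
  exact ENNReal.toReal_le_of_le_ofReal (by positivity) h1

theorem enorm_sq_eq_lintegral {n : ℕ} (f : L2C n) : ‖f‖ₑ ^ 2 = ∫⁻ ξ, ‖f ξ‖ₑ ^ 2 := by
  rw [Lp.enorm_def, eLpNorm_eq_lintegral_rpow_enorm_toReal two_ne_zero ENNReal.ofNat_ne_top,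
    ← ENNReal.rpow_natCast, ← ENNReal.rpow_mul]
  norm_num

theorem enorm_fourierInv {n : ℕ} (f : L2C n) : ‖(𝓕⁻ f : L2C n)‖ₑ = ‖f‖ₑ := by
  rw [← ofReal_norm, ← ofReal_norm, ← Lp.norm_fourier_eq, FourierTransform.fourier_fourierInv_eq]

/-- The frequency cut depends on the level l: the low part is at most l/2 pointwise, so exceeding l
forces the high part above l/2. Chebyshev's inequality and Plancherel then apply to the high part.
-/
theorem measure_superlevel_le {n : ℕ} {θ K : ℝ} (hK : 0 < K)
    (hB : eLpNorm (bracket n (-(2 + θ))) 2 volume ≤ ENNReal.ofReal K) {g : L2C n}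
    (hg : ‖g‖ ≤ 1) {l : ℝ} (hl : 0 < l) :
    volume {x | l < ‖(𝓕⁻ (mulOp (bracket n (-2)) g) : L2C n) x‖}
      ≤ ENNReal.ofReal (4 / l ^ 2) * ∫⁻ ξ, if l < 2 * K * bracket n θ ξ
        then ‖mulOp (bracket n (-2)) g ξ‖ₑ ^ 2 else 0 := by
  set w : L2C n := mulOp (bracket n (-2)) g with hw
  let E : Set (Rn n) := {ξ | 2 * K * bracket n θ ξ ≤ l}
  have hE : MeasurableSet E :=
    (isClosed_le (continuous_const.mul (continuous_bracket _)) continuous_const).measurableSet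
  let wl : L2C n := ((Lp.memLp w).indicator hE).toLp
  let wh : L2C n := ((Lp.memLp w).indicator hE.compl).toLp
  have hwl : wl =ᵐ[volume] E.indicator w := MemLp.coeFn_toLp _
  have hwh : wh =ᵐ[volume] Eᶜ.indicator w := MemLp.coeFn_toLp _
  have hsum : w = wl + wh := by
    apply Lp.ext
    filter_upwards [hwl, hwh, Lp.coeFn_add wl wh] with ξ h1 h2 h3
    rw [h3, Pi.add_apply, h1, h2]
    exact congrFun (indicator_self_add_compl E w).symm ξ
  obtain ⟨hint, hbd⟩ := integral_norm_lowFrequency_le hK hB hg hl (w := wl) (by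
    filter_upwards [hwl, coeFn_mulOp (isSymbol_bracket (by norm_num : (-2 : ℝ) ≤ 0)) g]
      with ξ h1 h2
    rw [h1]
    by_cases hξ : ξ ∈ E
    · rw [indicator_of_mem hξ, if_pos (show 2 * K * bracket n θ ξ ≤ l from hξ), hw, h2, norm_mul, Complex.norm_real,
        Real.norm_of_nonneg (bracket_pos _ _).le]
    · rw [indicator_of_notMem hξ, norm_zero,
        if_neg (show ¬2 * K * bracket n θ ξ ≤ l from hξ)])
  have hsub : volume {x | l < ‖(𝓕⁻ w : L2C n) x‖}
      ≤ volume {x | ENNReal.ofReal (l / 2) ≤ ‖(𝓕⁻ wh : L2C n) x‖ₑ} := by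
    refine measure_mono_ae ?_
    have hF : (𝓕⁻ w : L2C n) = 𝓕⁻ wl + 𝓕⁻ wh := by
      rw [hsum, FourierTransform.fourierInv_add]
    filter_upwards [norm_fourierInv_le hint, Lp.coeFn_add (𝓕⁻ wl : L2C n) (𝓕⁻ wh)]
      with x h1 h2 h3
    have h3' : l < ‖(𝓕⁻ w : L2C n) x‖ := h3
    rw [hF, h2, Pi.add_apply] at h3'
    have h4 := norm_add_le ((𝓕⁻ wl : L2C n) x) ((𝓕⁻ wh : L2C n) x)
    change ENNReal.ofReal (l / 2) ≤ ‖(𝓕⁻ wh : L2C n) x‖ₑ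
    rw [← ofReal_norm]
    exact ENNReal.ofReal_le_ofReal (by linarith)
  have hmarkov := mul_meas_ge_le_pow_eLpNorm' (volume : Measure (Rn n)) (p := 2) two_ne_zero
    ENNReal.ofNat_ne_top (Lp.aestronglyMeasurable (𝓕⁻ wh : L2C n)) (ENNReal.ofReal (l / 2))
  rw [← Lp.enorm_def, enorm_fourierInv] at hmarkov
  simp only [ENNReal.toReal_ofNat, ENNReal.rpow_ofNat] at hmarkov
  rw [enorm_sq_eq_lintegral, ← ENNReal.ofReal_pow (by positivity)] at hmarkov
  have hhigh : ∫⁻ ξ, ‖wh ξ‖ₑ ^ 2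
      = ∫⁻ ξ, if l < 2 * K * bracket n θ ξ then ‖w ξ‖ₑ ^ 2 else 0 := by
    refine lintegral_congr_ae ?_
    filter_upwards [hwh] with ξ h1
    rw [h1]
    by_cases hξ : l < 2 * K * bracket n θ ξ
    · rw [if_pos hξ, indicator_of_mem (show ξ ∈ Eᶜ from not_le.2 hξ)]
    · rw [if_neg hξ, indicator_of_notMem (show ξ ∉ Eᶜ from fun h => h (not_lt.1 hξ))]
      simp
  rw [hhigh] at hmarkov
  refine hsub.trans ?_
  have e : ENNReal.ofReal (4 / l ^ 2) * ENNReal.ofReal ((l / 2) ^ 2) = 1 := by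
    rw [← ENNReal.ofReal_mul (by positivity), ← ENNReal.ofReal_one]
    congr 1
    field_simp
    norm_num
  calc _ = ENNReal.ofReal (4 / l ^ 2) * (ENNReal.ofReal ((l / 2) ^ 2)
        * volume {x | ENNReal.ofReal (l / 2) ≤ ‖(𝓕⁻ wh : L2C n) x‖ₑ}) := by
        rw [← mul_assoc, e, one_mul]
    _ ≤ _ := by gcongr

theorem lintegral_rpow_lt {q R : ℝ} (hq : 2 < q) (hR : 0 ≤ R) :
    ∫⁻ l in Ioi (0 : ℝ), (if l < R then ENNReal.ofReal (4 * l ^ (q - 3)) else 0)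
      = ENNReal.ofReal (4 / (q - 2) * R ^ (q - 2)) := by
  have h1 : ∀ l : ℝ, (if l < R then ENNReal.ofReal (4 * l ^ (q - 3)) else 0)
      = (Iio R).indicator (fun l => ENNReal.ofReal (4 * l ^ (q - 3))) l := fun l => by
    simp [indicator_apply]
  simp only [h1]
  rw [setLIntegral_indicator measurableSet_Iio, Iio_inter_Ioi]
  have hii : IntervalIntegrable (fun l : ℝ => 4 * l ^ (q - 3)) volume 0 R :=
    (intervalIntegral.intervalIntegrable_rpow' (by linarith)).const_mul 4
  rw [setLIntegral_congr Ioo_ae_eq_Ioc, ← ofReal_integral_eq_lintegral_ofReal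
    ((intervalIntegrable_iff_integrableOn_Ioc_of_le hR).1 hii),
    ← intervalIntegral.integral_of_le hR, intervalIntegral.integral_const_mul,
    integral_rpow (Or.inl (by linarith))]
  · rw [Real.zero_rpow (by linarith)]
    congr 1
    have : q - 2 ≠ 0 := by linarith
    rw [show q - 3 + 1 = q - 2 by ring]
    field_simp
    ring
  · refine (ae_restrict_iff' measurableSet_Ioc).2 (Filter.Eventually.of_forall fun l hl => ?_)
    have := Real.rpow_nonneg hl.1.le (q - 3)
    simp only [Pi.zero_apply]
    positivity

theorem rpow_bracket {n : ℕ} (s r : ℝ) (ξ : Rn n) : bracket n s ξ ^ r = bracket n (s * r) ξ := by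
  rw [bracket, bracket, ← Real.rpow_mul (by positivity)]
  congr 1
  ring

/-- Layer-cake formula, the level-dependent cut, and Tonelli. The integral of 4l^{q-3} over l <
2K⟨ξ⟩^θ converges at 0 since q > 2 and produces ⟨ξ⟩^{θ(q-2)}. -/
theorem lintegral_rpow_fourierInv_le {n : ℕ} {q K : ℝ} (hq : 2 < q) (hK : 0 < K)
    (hB : eLpNorm (bracket n (-(2 + 4 / (q - 2)))) 2 volume ≤ ENNReal.ofReal K) {g : L2C n}
    (hg : ‖g‖ ≤ 1) :
    ∫⁻ x, ENNReal.ofReal (‖(𝓕⁻ (mulOp (bracket n (-2)) g) : L2C n) x‖ ^ q)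
      ≤ ENNReal.ofReal q * ENNReal.ofReal (4 / (q - 2) * (2 * K) ^ (q - 2)) := by
  set θ := 4 / (q - 2) with hθ
  set w : L2C n := mulOp (bracket n (-2)) g with hw
  have hq2 : 0 < q - 2 := by linarith
  rw [lintegral_rpow_eq_lintegral_meas_lt_mul volume
    (Filter.Eventually.of_forall fun x => norm_nonneg _)
    (Lp.aestronglyMeasurable (𝓕⁻ w : L2C n)).norm.aemeasurable (by linarith)]
  gcongr
  have hmeas : Measurable fun z : ℝ × Rn n =>
      (if z.1 < 2 * K * bracket n θ z.2 then ENNReal.ofReal (4 * z.1 ^ (q - 3)) else 0)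
        * ‖w z.2‖ₑ ^ 2 := by
    refine Measurable.mul (Measurable.ite ?_ ?_ measurable_const) ?_
    · refine measurableSet_lt measurable_fst ?_
      exact measurable_const.mul ((continuous_bracket θ).measurable.comp measurable_snd)
    · exact ((measurable_fst.pow_const _).const_mul 4).ennreal_ofReal
    · exact ((Lp.stronglyMeasurable w).measurable.comp measurable_snd).enorm.pow_const 2
  calc ∫⁻ l in Ioi (0 : ℝ), volume {x | l < ‖(𝓕⁻ w : L2C n) x‖} * ENNReal.ofReal (l ^ (q - 1))
      ≤ ∫⁻ l in Ioi (0 : ℝ), ∫⁻ ξ, (if l < 2 * K * bracket n θ ξ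
          then ENNReal.ofReal (4 * l ^ (q - 3)) else 0) * ‖w ξ‖ₑ ^ 2 := by
        refine setLIntegral_mono' measurableSet_Ioi fun l hl => ?_
        have hl : 0 < l := hl
        refine (mul_le_mul_left (measure_superlevel_le hK hB hg hl) _).trans (le_of_eq ?_)
        have hfin : ENNReal.ofReal (4 * l ^ (q - 3)) ≠ ∞ := ENNReal.ofReal_ne_top
        have e : ENNReal.ofReal (4 / l ^ 2) * ENNReal.ofReal (l ^ (q - 1))
            = ENNReal.ofReal (4 * l ^ (q - 3)) := by
          rw [← ENNReal.ofReal_mul (by positivity)]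
          congr 1
          rw [show q - 1 = (q - 3) + (2 : ℕ) by push_cast; ring, Real.rpow_add_natCast hl.ne']
          field_simp
        rw [mul_right_comm, e, ← lintegral_const_mul' _ _ hfin]
        refine lintegral_congr fun ξ => ?_
        split_ifs <;> simp [hw]
    _ = ∫⁻ ξ, ∫⁻ l in Ioi (0 : ℝ), (if l < 2 * K * bracket n θ ξ
          then ENNReal.ofReal (4 * l ^ (q - 3)) else 0) * ‖w ξ‖ₑ ^ 2 :=
        lintegral_lintegral_swap hmeas.aemeasurable
    _ = ∫⁻ ξ, ENNReal.ofReal (4 / (q - 2) * (2 * K) ^ (q - 2)) * ‖g ξ‖ₑ ^ 2 := by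
        refine lintegral_congr_ae ?_
        filter_upwards [coeFn_mulOp (isSymbol_bracket (by norm_num : (-2 : ℝ) ≤ 0)) g] with ξ h1
        have hb := bracket_pos (n := n) θ ξ
        have hb2 := bracket_pos (n := n) (-2) ξ
        rw [lintegral_mul_const' _ _ (by finiteness), lintegral_rpow_lt hq (by positivity), hw, h1,
          enorm_mul, mul_pow, ← mul_assoc]
        congr 1
        rw [← ofReal_norm, Complex.norm_real, Real.norm_of_nonneg hb2.le,
          ← ENNReal.ofReal_pow hb2.le, ← ENNReal.ofReal_mul (by positivity),
          Real.mul_rpow (by positivity) hb.le, rpow_bracket]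
        congr 1
        -- The choice θ = 4/(q − 2) makes this weight ⟨ξ⟩⁴, which cancels the two factors ⟨ξ⟩⁻²
        -- exactly.
        rw [show θ * (q - 2) = 2 + 2 by rw [hθ]; field_simp; norm_num, bracket_add]
        have := bracket_neg_mul (n := n) 2 ξ
        linear_combination (4 / (q - 2) * (2 * K) ^ (q - 2))
          * (bracket n (-2) ξ * bracket n 2 ξ + 1) * this
    _ ≤ ENNReal.ofReal (4 / (q - 2) * (2 * K) ^ (q - 2)) := by
        rw [lintegral_const_mul' _ _ ENNReal.ofReal_ne_top, ← enorm_sq_eq_lintegral]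
        refine mul_le_of_le_one_right' (pow_le_one' ?_ 2)
        rw [← ofReal_norm, ← ENNReal.ofReal_one]
        exact ENNReal.ofReal_le_ofReal hg

theorem toComplex_toL2_eq {n : ℕ} (f : Sobolev n 2) :
    toComplex n f.toL2 = 𝓕⁻ (mulOp (bracket n (-2)) (weightedFourier n 2 f)) := by
  rw [mulOp_weightedFourier zero_le_two, fourierL2_apply, FourierTransform.fourierInv_fourier_eq]

/-- The subcritical Sobolev embedding `H² ⊆ L^q`. -/
theorem exists_eLpNorm_le_sobolev {n : ℕ} {q : ℝ} (hq : 2 < q) (hn : (n : ℝ) < 4 + 8 / (q - 2)) :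
    ∃ C : ℝ, 0 ≤ C ∧ ∀ f : Sobolev n 2,
      eLpNorm f.toL2 (ENNReal.ofReal q) volume ≤ ENNReal.ofReal (C * ‖f‖) := by
  -- Square integrability of ⟨ξ⟩^{-(2+θ)} is the condition n < 2(2 + θ), that is, strict
  -- subcriticality of q.
  have hB := eLpNorm_bracket_lt_top (n := n) (s := 2 + 4 / (q - 2)) (by
    refine hn.trans_le (le_of_eq ?_)
    ring)
  set K := (eLpNorm (bracket n (-(2 + 4 / (q - 2)))) 2 volume).toReal + 1 with hKdef
  have hK : 0 < K := by positivity
  have hBK : eLpNorm (bracket n (-(2 + 4 / (q - 2)))) 2 volume ≤ ENNReal.ofReal K := by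
    refine ENNReal.le_ofReal_iff_toReal_le hB.ne hK.le |>.2 ?_
    linarith
  have hq0 : ENNReal.ofReal q ≠ 0 := by
    rw [Ne, ENNReal.ofReal_eq_zero]
    linarith
  set D := (q * (4 / (q - 2) * (2 * K) ^ (q - 2))) ^ (1 / q) with hD
  have hq2 : 0 < q - 2 := by linarith
  have hunit : ∀ f : Sobolev n 2, ‖f‖ ≤ 1 →
      eLpNorm f.toL2 (ENNReal.ofReal q) volume ≤ ENNReal.ofReal D := by
    intro f hf
    have h1 := lintegral_rpow_fourierInv_le hq hK hBK (g := weightedFourier n 2 f)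
      (by rwa [(weightedFourier n 2).norm_map])
    rw [← toComplex_toL2_eq] at h1
    rw [eLpNorm_eq_lintegral_rpow_enorm_toReal hq0 ENNReal.ofReal_ne_top,
      ENNReal.toReal_ofReal (by linarith), hD, ← ENNReal.ofReal_rpow_of_nonneg (by positivity)
      (by positivity), ENNReal.ofReal_mul (by linarith)]
    gcongr
    refine le_trans (le_of_eq ?_) h1
    refine lintegral_congr_ae ?_
    filter_upwards [coeFn_toComplex f.toL2] with x hx
    rw [hx, Complex.norm_real, ← ofReal_norm,
      ENNReal.ofReal_rpow_of_nonneg (norm_nonneg _) (by linarith)]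
  refine ⟨D, by positivity, fun f => ?_⟩
  rcases eq_or_ne f 0 with rfl | hf
  · have : eLpNorm ((0 : Sobolev n 2).toL2) (ENNReal.ofReal q) volume = 0 := by
      rw [map_zero, eLpNorm_congr_ae (Lp.coeFn_zero ℝ 2 volume), eLpNorm_zero]
    rw [this]
    exact zero_le
  · have hf0 : 0 < ‖f‖ := norm_pos_iff.2 hf
    have h1 := hunit (‖f‖⁻¹ • f) (by rw [norm_smul, norm_inv, norm_norm, inv_mul_cancel₀ hf0.ne'])
    rw [map_smul, eLpNorm_congr_ae (Lp.coeFn_smul _ _), eLpNorm_const_smul,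
      Real.enorm_of_nonneg (by positivity)] at h1
    calc eLpNorm f.toL2 (ENNReal.ofReal q) volume
        = ENNReal.ofReal ‖f‖ * (ENNReal.ofReal ‖f‖⁻¹ *
            eLpNorm f.toL2 (ENNReal.ofReal q) volume) := by
          rw [← mul_assoc, ← ENNReal.ofReal_mul hf0.le, mul_inv_cancel₀ hf0.ne',
            ENNReal.ofReal_one, one_mul]
      _ ≤ ENNReal.ofReal ‖f‖ * ENNReal.ofReal D := by gcongr
      _ = ENNReal.ofReal (D * ‖f‖) := by rw [← ENNReal.ofReal_mul hf0.le, mul_comm]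

/-! ### The power nonlinearity -/

/-- For n ≥ 3, p ≤ n/(n − 2) gives 8/(2p − 2) ≥ 2(n − 2), so the right-hand side is at least 2n.
Thus q = 2p is strictly subcritical for H². -/
theorem lt_four_add_of_le {n : ℕ} {p : ℝ} (hp : 1 < p)
    (hpn : 3 ≤ n → p ≤ (n : ℝ) / ((n : ℝ) - 2)) : (n : ℝ) < 4 + 8 / (2 * p - 2) := by
  have hp1 : 0 < 2 * p - 2 := by linarith
  rcases Nat.lt_or_ge n 3 with h | h
  · have h1 : (n : ℝ) < 3 := by exact_mod_cast h
    have h2 : 0 < 8 / (2 * p - 2) := by positivity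
    linarith
  · have h1 : (3 : ℝ) ≤ n := by exact_mod_cast h
    have h2 := hpn h
    rw [le_div_iff₀ (by linarith)] at h2
    have h3 : 2 * ((n : ℝ) - 2) ≤ 8 / (2 * p - 2) := by
      rw [le_div_iff₀ hp1]
      linarith
    linarith

/-- Mean value inequality for x^p on [0, |a| + |b|]. -/
theorem abs_rpow_sub_rpow_le {p : ℝ} (hp : 1 ≤ p) (a b : ℝ) :
    |(|a| ^ p - |b| ^ p)| ≤ p * (‖|a| + |b|‖ ^ (p - 1) * |a - b|) := by
  have hM : 0 ≤ |a| + |b| := by positivity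
  have h := Convex.norm_image_sub_le_of_norm_hasDerivWithin_le (f := fun x : ℝ => x ^ p)
    (f' := fun x => p * x ^ (p - 1)) (s := Icc 0 (|a| + |b|)) (C := p * (|a| + |b|) ^ (p - 1))
    (x := |b|) (y := |a|) (fun x _ => (Real.hasDerivAt_rpow_const (Or.inr hp)).hasDerivWithinAt)
    (fun x hx => by
      have h1 := Real.rpow_nonneg hx.1 (p - 1)
      rw [Real.norm_of_nonneg (by positivity)]
      exact mul_le_mul_of_nonneg_left (Real.rpow_le_rpow hx.1 hx.2 (by linarith)) (by linarith))
    (convex_Icc _ _) ⟨abs_nonneg _, by linarith [abs_nonneg a]⟩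
    ⟨abs_nonneg _, by linarith [abs_nonneg b]⟩
  rw [Real.norm_of_nonneg hM, ← mul_assoc]
  refine h.trans (mul_le_mul_of_nonneg_left (abs_abs_sub_abs_le _ _) ?_)
  have := Real.rpow_nonneg hM (p - 1)
  positivity

theorem memLp_abs_rpow {n : ℕ} {p : ℝ} (hp : 1 < p) {f : L2 n}
    (hf : eLpNorm f (ENNReal.ofReal (2 * p)) volume < ∞) :
    MemLp (fun x => |f x| ^ p) 2 (volume : Measure (Rn n)) := by
  have hm : MemLp f (ENNReal.ofReal (2 * p)) volume := ⟨Lp.aestronglyMeasurable f, hf⟩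
  have h1 := hm.norm_rpow_div (ENNReal.ofReal p)
  have h2 : ENNReal.ofReal (2 * p) / ENNReal.ofReal p = 2 := by
    rw [← ENNReal.ofReal_div_of_pos (by linarith), mul_div_cancel_right₀ _ (by linarith)]
    norm_num
  rw [h2, ENNReal.toReal_ofReal (by linarith)] at h1
  exact h1

theorem coeFn_absPow {n : ℕ} {p : ℝ} {f : L2 n}
    (h : MemLp (fun x => |f x| ^ p) 2 (volume : Measure (Rn n))) :
    absPow p f =ᵐ[volume] fun x => |f x| ^ p := by
  rw [absPow, dif_pos h]
  exact MemLp.coeFn_toLp h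

theorem supportedInBall_absPow {n : ℕ} {p : ℝ} (hp : p ≠ 0) {f : L2 n} {r : ℝ}
    (hf : SupportedInBall f r) : SupportedInBall (absPow p f) r := by
  by_cases h : MemLp (fun x => |f x| ^ p) 2 (volume : Measure (Rn n))
  · filter_upwards [coeFn_absPow h, hf] with x h1 h2 hx
    rw [h1, h2 hx, abs_zero, Real.zero_rpow hp]
  · rw [absPow, dif_neg h]
    filter_upwards [Lp.coeFn_zero ℝ 2 (volume : Measure (Rn n))] with x h1 _
    rw [h1, Pi.zero_apply]

/-- The pointwise bound above and Hölder with 1/2 = (p − 1)/(2p) + 1/(2p); the L^{2p/(p-1)} norm of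
the power is a power of an L^{2p} norm. -/
theorem enorm_absPow_sub_le {n : ℕ} {p : ℝ} (hp : 1 < p) {f g : L2 n}
    (hf : eLpNorm f (ENNReal.ofReal (2 * p)) volume < ∞)
    (hg : eLpNorm g (ENNReal.ofReal (2 * p)) volume < ∞) :
    ‖absPow p f - absPow p g‖ₑ ≤ ENNReal.ofReal p *
      ((eLpNorm f (ENNReal.ofReal (2 * p)) volume
        + eLpNorm g (ENNReal.ofReal (2 * p)) volume) ^ (p - 1)
        * eLpNorm (f - g : L2 n) (ENNReal.ofReal (2 * p)) volume) := by
  have hp1 : 0 < p - 1 := by linarith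
  have hfm := Lp.aestronglyMeasurable f
  have hgm := Lp.aestronglyMeasurable g
  have hsm : AEStronglyMeasurable (fun x => |f x| + |g x|) (volume : Measure (Rn n)) :=
    hfm.norm.add hgm.norm
  have : ENNReal.HolderTriple (ENNReal.ofReal (2 * p / (p - 1))) (ENNReal.ofReal (2 * p)) 2 := by
    constructor
    rw [← ENNReal.ofReal_inv_of_pos (by positivity), ← ENNReal.ofReal_inv_of_pos (by positivity),
      ← ENNReal.ofReal_add (by positivity) (by positivity),
      show (2 : ℝ≥0∞) = ENNReal.ofReal 2 by norm_num, ← ENNReal.ofReal_inv_of_pos two_pos]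
    congr 1
    field_simp
    ring
  rw [Lp.enorm_def]
  calc eLpNorm (absPow p f - absPow p g : L2 n) 2 volume
      ≤ eLpNorm (p • ((fun x => ‖|f x| + |g x|‖ ^ (p - 1)) • ⇑(f - g : L2 n))) 2 volume := by
        refine eLpNorm_mono_ae ?_
        filter_upwards [Lp.coeFn_sub (absPow p f) (absPow p g), Lp.coeFn_sub f g,
          coeFn_absPow (memLp_abs_rpow hp hf), coeFn_absPow (memLp_abs_rpow hp hg)]
          with x h1 h2 h3 h4
        rw [h1, Pi.sub_apply, h3, h4]
        have h5 := abs_rpow_sub_rpow_le hp.le (f x) (g x)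
        have h6 : (0 : ℝ) ≤ ‖|f x| + |g x|‖ ^ (p - 1) := by positivity
        simp only [Pi.smul_apply, smul_eq_mul, Pi.mul_apply]
        rw [h2, Pi.sub_apply, norm_mul, norm_mul, Real.norm_of_nonneg (by linarith : (0 : ℝ) ≤ p),
          Real.norm_of_nonneg h6]
        exact h5
    _ ≤ ENNReal.ofReal p * (eLpNorm (fun x => ‖|f x| + |g x|‖ ^ (p - 1))
          (ENNReal.ofReal (2 * p / (p - 1))) volume
          * eLpNorm (f - g : L2 n) (ENNReal.ofReal (2 * p)) volume) := by
        rw [eLpNorm_const_smul, Real.enorm_of_nonneg (by linarith : (0 : ℝ) ≤ p)]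
        gcongr
        refine eLpNorm_smul_le_mul_eLpNorm (Lp.aestronglyMeasurable _) ?_
        exact (hsm.norm.aemeasurable.pow_const _).aestronglyMeasurable
    _ ≤ _ := by
        rw [eLpNorm_norm_rpow _ hp1, ← ENNReal.ofReal_mul (by positivity),
          div_mul_cancel₀ _ hp1.ne']
        gcongr
        refine (eLpNorm_add_le hfm.norm hgm.norm ?_).trans ?_
        · rw [← ENNReal.ofReal_one]
          exact ENNReal.ofReal_le_ofReal (by linarith)
        · exact (congrArg₂ _ (eLpNorm_norm _) (eLpNorm_norm _)).le

/-- The nonlinearity `|f|^p` maps `H²` to `L²` and is locally Lipschitz. -/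
theorem absPow_sobolev {n : ℕ} {p : ℝ} (hp : 1 < p) (hn : (n : ℝ) < 4 + 8 / (2 * p - 2)) :
    (∀ f : Sobolev n 2, MemLp (fun x => |f.toL2 x| ^ p) 2 (volume : Measure (Rn n))) ∧
    ∀ ρ, ∃ L, 0 ≤ L ∧ ∀ f g : Sobolev n 2, ‖f‖ ≤ ρ → ‖g‖ ≤ ρ →
      ‖absPow p f.toL2 - absPow p g.toL2‖ ≤ L * ‖f - g‖ := by
  obtain ⟨C, hC0, hC⟩ := exists_eLpNorm_le_sobolev (n := n) (q := 2 * p) (by linarith) hn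
  have hfin : ∀ f : Sobolev n 2, eLpNorm f.toL2 (ENNReal.ofReal (2 * p)) volume < ∞ := fun f =>
    (hC f).trans_lt ENNReal.ofReal_lt_top
  refine ⟨fun f => memLp_abs_rpow hp (hfin f), fun ρ => ?_⟩
  -- By the embedding both functions have L^{2p} norm at most C|ρ|. The absolute value covers
  -- negative ρ, keeping the constant nonnegative.
  refine ⟨p * ((C * |ρ| + C * |ρ|) ^ (p - 1) * C), by positivity, fun f g hf hg => ?_⟩
  have hf' : ‖f‖ ≤ |ρ| := hf.trans (le_abs_self _)
  have hg' : ‖g‖ ≤ |ρ| := hg.trans (le_abs_self _)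
  have h1 := enorm_absPow_sub_le hp (hfin f) (hfin g)
  rw [← map_sub] at h1
  rw [← ofReal_norm] at h1
  rw [← ENNReal.ofReal_le_ofReal_iff (by positivity)]
  refine h1.trans ?_
  rw [show p * ((C * |ρ| + C * |ρ|) ^ (p - 1) * C) * ‖f - g‖
    = p * ((C * |ρ| + C * |ρ|) ^ (p - 1) * (C * ‖f - g‖)) by ring,
    ENNReal.ofReal_mul (p := p) (by linarith),
    ENNReal.ofReal_mul (p := (C * |ρ| + C * |ρ|) ^ (p - 1)) (by positivity),
    ← ENNReal.ofReal_rpow_of_nonneg (by positivity) (by linarith),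
    ENNReal.ofReal_add (by positivity) (by positivity)]
  have hb : ∀ e : Sobolev n 2, ‖e‖ ≤ |ρ| →
      eLpNorm e.toL2 (ENNReal.ofReal (2 * p)) volume ≤ ENNReal.ofReal (C * |ρ|) := fun e he =>
    (hC e).trans (ENNReal.ofReal_le_ofReal (mul_le_mul_of_nonneg_left he hC0))
  have hp1 : 0 ≤ p - 1 := by linarith
  gcongr
  · exact hb f hf'
  · exact hb g hg'
  · exact hC _

theorem continuous_of_lipschitz_on_balls {X Y : Type*} [NormedAddCommGroup X]
    [NormedAddCommGroup Y] {G : X → Y}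
    (hG : ∀ ρ, ∃ L, 0 ≤ L ∧ ∀ x x', ‖x‖ ≤ ρ → ‖x'‖ ≤ ρ → ‖G x - G x'‖ ≤ L * ‖x - x'‖) :
    Continuous G := by
  rw [continuous_iff_continuousAt]
  intro x
  obtain ⟨L, -, hL⟩ := hG (‖x‖ + 1)
  rw [ContinuousAt, tendsto_iff_norm_sub_tendsto_zero]
  have h1 : Filter.Tendsto (fun y => L * ‖y - x‖) (nhds x) (nhds 0) := by
    have : Continuous fun y => L * ‖y - x‖ := by fun_prop
    simpa using this.tendsto x
  refine squeeze_zero' (Filter.Eventually.of_forall fun _ => norm_nonneg _) ?_ h1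
  filter_upwards [(continuous_norm.tendsto x).eventually_le_const (lt_add_one ‖x‖)] with y hy
  exact hL y x hy (by linarith)

/-! ### The linear propagators -/

section propagators

variable {n : ℕ}

/-- The symbol of `K₀(t)` on `L²`-normalized `H²` data. -/
def propagator₀ (β t : ℝ) (ξ : Rn n) : ℝ := bracket n (-2) ξ * symbol₀ β t (freq ξ)

/-- The symbol of `K₁(t)` on `L²`-normalized `H¹` data. -/
def propagator₁ (t : ℝ) (ξ : Rn n) : ℝ := bracket n (-1) ξ * symbol₁ t (freq ξ)

/-- The symbol of `K₂(t)`. -/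
def propagator₂ (β t : ℝ) (ξ : Rn n) : ℝ := symbol₂ β t (freq ξ)

theorem IsEnergyFamily.isSymbolFamily {c c' c'' : ℝ → Rn n → ℝ} (h : IsEnergyFamily c c' c'') :
    IsSymbolFamily c :=
  h.order_zero.of_bracket_mul zero_le_two

theorem IsEnergyFamily.isSymbolFamily' {c c' c'' : ℝ → Rn n → ℝ} (h : IsEnergyFamily c c' c'') :
    IsSymbolFamily c' :=
  h.order_one.of_bracket_mul zero_le_one

theorem fourier_convolve {m : ℝ → ℝ} (hm : MemLp (radial n m) ∞ (volume : Measure (Rn n)))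
    (h : IsSymbol fun ξ : Rn n => m (freq ξ)) (f : L2 n) :
    𝓕 (convolve hm f) = mulOp (fun ξ => m (freq ξ)) (fourierL2 n f) := by
  rw [mulOp_eq_smul h, convolve, FourierTransform.fourier_fourierInv_eq]
  rfl

theorem fourier_K₀ {β : ℝ} (hβ : 0 < β) (t : ℝ) (f : Sobolev n 2) :
    𝓕 (K₀ β t f.toL2) = mulOp (propagator₀ β t) (weightedFourier n 2 f) := by
  have h : IsSymbol fun ξ : Rn n => symbol₀ β t (freq ξ) := by
    have h1 := (isEnergyFamily_symbol₀ (n := n) hβ).order_zero.isSymbol t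
    convert h1 using 2 with ξ
    rw [← mul_assoc, mul_comm (bracket n 2 ξ), bracket_neg_mul, one_mul]
  rw [K₀, fourier_convolve _ h, ← mulOp_weightedFourier zero_le_two,
    mulOp_mulOp h (isSymbol_bracket (by norm_num))]
  congr 1
  congr 1
  ext ξ
  exact mul_comm _ _

theorem fourier_K₁ (t : ℝ) (f : Sobolev n 1) :
    𝓕 (K₁ t f.toL2) = mulOp (propagator₁ t) (weightedFourier n 1 f) := by
  have h : IsSymbol fun ξ : Rn n => symbol₁ t (freq ξ) := by
    have h1 := ((isEnergyFamily_symbol₁ (n := n)).order_zero.bracket_mul one_le_two).isSymbol t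
    convert h1 using 2 with ξ
    rw [← mul_assoc, mul_comm (bracket n 1 ξ), bracket_neg_mul, one_mul]
  rw [K₁, fourier_convolve _ h, ← mulOp_weightedFourier zero_le_one,
    mulOp_mulOp h (isSymbol_bracket (by norm_num))]
  congr 1
  congr 1
  ext ξ
  exact mul_comm _ _

theorem fourier_K₂ {β : ℝ} (hβ : 0 < β) (t : ℝ) (f : L2 n) :
    𝓕 (K₂ β t f) = mulOp (propagator₂ β t) (fourierL2 n f) :=
  fourier_convolve _ ((isEnergyFamily_symbol₂ hβ).isSymbolFamily.isSymbol t) f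

/-- A continuous left inverse of `weightedFourier n s`. -/
def sobolevProj (n : ℕ) {s : ℝ} (hs : 0 ≤ s) : L2C n →L[ℝ] Sobolev n s :=
  Classical.choose (exists_leftInverse_weightedFourier hs)

theorem sobolevProj_weightedFourier {s : ℝ} (hs : 0 ≤ s) (f : Sobolev n s) :
    sobolevProj n hs (weightedFourier n s f) = f :=
  Classical.choose_spec (exists_leftInverse_weightedFourier hs) f

theorem toL2_sobolevProj {s : ℝ} (hs : 0 ≤ s) {z : L2C n} {w : L2 n}
    (h : mulOp (bracket n (-s)) z = fourierL2 n w) : (sobolevProj n hs z).toL2 = w := by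
  obtain ⟨F, hF, rfl⟩ := exists_sobolev hs h
  rw [sobolevProj_weightedFourier, hF]

theorem mulOp_bracket_mulOp {s : ℝ} (hs : 0 ≤ s) {a : Rn n → ℝ}
    (ha : IsSymbol fun ξ => bracket n s ξ * a ξ) (z : L2C n) :
    mulOp (bracket n (-s)) (mulOp (fun ξ => bracket n s ξ * a ξ) z) = mulOp a z := by
  rw [mulOp_mulOp (isSymbol_bracket (by linarith)) ha]
  congr 1
  congr 1
  ext ξ
  rw [← mul_assoc, bracket_neg_mul, one_mul]

/-- Reality enters through `w`: once the convolution `y` is known to be the complexification of a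
real function, the weighted transform lies in the range and the projection returns that function. -/
theorem toComplex_sobolevProj {a : Rn n → ℝ} (ha : IsSymbol fun ξ => bracket n 2 ξ * a ξ)
    {z : L2C n} {w : L2 n} {y : L2C n} (hw : toComplex n w = y) (hy : 𝓕 y = mulOp a z) :
    (sobolevProj n zero_le_two (mulOp (fun ξ => bracket n 2 ξ * a ξ) z)).toL2 = w := by
  apply toL2_sobolevProj
  rw [mulOp_bracket_mulOp zero_le_two ha, ← hy, ← hw, fourierL2_apply]

/-- `f ↦ β⁻¹ K₂(t) ∗ f` as a map from `L²` to `H²` (for `t ≥ 0`). -/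
def duhamelKernel (n : ℕ) (β t : ℝ) : L2 n →L[ℝ] Sobolev n 2 :=
  (1 / β) • (sobolevProj n zero_le_two).comp
    (((mulOp fun ξ => bracket n 2 ξ * propagator₂ β t ξ).restrictScalars ℝ).comp
      (fourierL2 n).toContinuousLinearMap)

theorem duhamelKernel_apply (β t : ℝ) (f : L2 n) : duhamelKernel n β t f
    = (1 / β) • sobolevProj n zero_le_two
      (mulOp (fun ξ => bracket n 2 ξ * propagator₂ β t ξ) (fourierL2 n f)) := rfl

/-- Reality of K₂(t) ∗ f comes from the cosine representation of the symbol, which is used for t ≥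
0; for t < 0 `duhamelKernel` is only a continuous extension. -/
theorem exists_duhamelKernel (hn : 1 ≤ n) {β : ℝ} (hβ : 0 < β) {t : ℝ} (ht : 0 ≤ t) (f : L2 n) :
    ∃ w, toComplex n w = K₂ β t f ∧ (duhamelKernel n β t f).toL2 = (1 / β) • w := by
  obtain ⟨w, hw⟩ := (isWaveSymbol_symbol₂ hβ.ne' t).exists_toComplex_eq hn ht
    (symbol₂_memLp n β t) f
  refine ⟨w, hw, ?_⟩
  rw [duhamelKernel_apply, map_smul, toComplex_sobolevProj (a := propagator₂ β t)
    ((isEnergyFamily_symbol₂ hβ).order_zero.isSymbol t) hw (fourier_K₂ hβ t f)]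

theorem continuous_duhamelKernel {β : ℝ} (hβ : 0 < β) :
    Continuous fun q : ℝ × L2 n => duhamelKernel n β q.1 q.2 := by
  have h1 := (isEnergyFamily_symbol₂ (n := n) hβ).order_zero.continuous_mulOp
  have h2 : Continuous fun q : ℝ × L2 n => (q.1, fourierL2 n q.2) :=
    continuous_fst.prodMk ((fourierL2 n).continuous.comp continuous_snd)
  exact ((sobolevProj n zero_le_two).continuous.comp (h1.comp h2)).const_smul (1 / β)

theorem continuous_duhamelKernel_comp {β : ℝ} (hβ : 0 < β) {h : ℝ → L2 n} (hh : Continuous h)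
    (t : ℝ) : Continuous fun τ => duhamelKernel n β (t - τ) (h τ) := by
  have h1 : Continuous fun τ => (t - τ, h τ) := by fun_prop
  have h2 := (continuous_duhamelKernel hβ).comp h1
  exact h2

theorem exists_norm_duhamelKernel_le {β : ℝ} (hβ : 0 < β) (T : ℝ) :
    ∃ M, 0 ≤ M ∧ ∀ t ∈ Icc 0 T, ∀ f : L2 n, ‖duhamelKernel n β t f‖ ≤ M * ‖f‖ := by
  obtain ⟨C, hC0, hC⟩ := (isEnergyFamily_symbol₂ (n := n) hβ).order_zero.exists_norm_le T
  refine ⟨1 / β * (‖sobolevProj n zero_le_two‖ * C), by positivity, fun t ht f => ?_⟩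
  rw [duhamelKernel_apply, norm_smul, Real.norm_of_nonneg (by positivity), mul_assoc, mul_assoc]
  refine mul_le_mul_of_nonneg_left ?_ (by positivity)
  refine (ContinuousLinearMap.le_opNorm _ _).trans ?_
  refine mul_le_mul_of_nonneg_left ?_ (norm_nonneg _)
  rw [← (fourierL2 n).norm_map f]
  exact hC t (by rw [abs_of_nonneg ht.1]; exact ht.2) _

/-- The solution of the linear problem, as a curve in `H²` (for `t ≥ 0`). -/
def linearFlow (β : ℝ) (U₀ : Sobolev n 2) (U₁ : Sobolev n 1) (u₂ : L2 n) (t : ℝ) : Sobolev n 2 :=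
  sobolevProj n zero_le_two
      (mulOp (fun ξ => bracket n 2 ξ * propagator₀ β t ξ) (weightedFourier n 2 U₀))
    + sobolevProj n zero_le_two
      (mulOp (fun ξ => bracket n 2 ξ * propagator₁ t ξ) (weightedFourier n 1 U₁))
    + sobolevProj n zero_le_two
      (mulOp (fun ξ => bracket n 2 ξ * propagator₂ β t ξ) (fourierL2 n u₂))

theorem continuous_linearFlow {β : ℝ} (hβ : 0 < β) (U₀ : Sobolev n 2) (U₁ : Sobolev n 1)
    (u₂ : L2 n) : Continuous (linearFlow β U₀ U₁ u₂) := by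
  have h : ∀ {a : ℝ → Rn n → ℝ} (_ : IsSymbolFamily a) (z : L2C n),
      Continuous fun t => sobolevProj n zero_le_two (mulOp (a t) z) := fun ha z =>
    (sobolevProj n zero_le_two).continuous.comp
      (ha.continuous_mulOp.comp (continuous_id.prodMk continuous_const))
  exact ((h (isEnergyFamily_symbol₀ hβ).order_zero _).add
    (h isEnergyFamily_symbol₁.order_zero _)).add (h (isEnergyFamily_symbol₂ hβ).order_zero _)

theorem exists_linearFlow (hn : 1 ≤ n) {β : ℝ} (hβ : 0 < β) (U₀ : Sobolev n 2) (U₁ : Sobolev n 1)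
    (u₂ : L2 n) {t : ℝ} (ht : 0 ≤ t) : ∃ w₀ w₁ w₂, toComplex n w₀ = K₀ β t U₀.toL2 ∧
      toComplex n w₁ = K₁ t U₁.toL2 ∧ toComplex n w₂ = K₂ β t u₂ ∧
      (linearFlow β U₀ U₁ u₂ t).toL2 = w₀ + w₁ + w₂ := by
  obtain ⟨w₀, h₀⟩ := (isWaveSymbol_symbol₀ hβ.ne' t).exists_toComplex_eq hn ht
    (symbol₀_memLp n β t) U₀.toL2
  obtain ⟨w₁, h₁⟩ := (isWaveSymbol_symbol₁ t).exists_toComplex_eq hn ht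
    (symbol₁_memLp n t) U₁.toL2
  obtain ⟨w₂, h₂⟩ := (isWaveSymbol_symbol₂ hβ.ne' t).exists_toComplex_eq hn ht
    (symbol₂_memLp n β t) u₂
  refine ⟨w₀, w₁, w₂, h₀, h₁, h₂, ?_⟩
  rw [linearFlow, map_add, map_add,
    toComplex_sobolevProj (a := propagator₀ β t) ((isEnergyFamily_symbol₀ hβ).order_zero.isSymbol t) h₀
      (fourier_K₀ hβ t U₀),
    toComplex_sobolevProj (a := propagator₁ t) (isEnergyFamily_symbol₁.order_zero.isSymbol t) h₁ (fourier_K₁ t U₁),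
    toComplex_sobolevProj (a := propagator₂ β t) ((isEnergyFamily_symbol₂ hβ).order_zero.isSymbol t) h₂
      (fourier_K₂ hβ t u₂)]

theorem toL2_add_integral [CompleteSpace (Sobolev n 2)] (f : Sobolev n 2) {F : ℝ → Sobolev n 2}
    (hF : Continuous F) (t : ℝ) :
    (f + ∫ τ in (0 : ℝ)..t, F τ).toL2 = f.toL2 + ∫ τ in (0 : ℝ)..t, (F τ).toL2 := by
  have h := (inclusionL2 (n := n) zero_le_two).intervalIntegral_comp_comm
    (hF.intervalIntegrable (μ := volume) 0 t)
  simp only [inclusionL2_apply] at h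
  rw [map_add, h]

/-- The Duhamel operator on curves in `H²`. -/
theorem toComplex_mildOperator (hn : 1 ≤ n) {β p : ℝ} (hβ : 0 < β) (U₀ : Sobolev n 2)
    (U₁ : Sobolev n 1) (u₂ : L2 n) {V : ℝ → Sobolev n 2}
    (hV : Continuous fun τ => absPow p (V τ).toL2) {t : ℝ} (ht : 0 ≤ t) :
    toComplex n (linearFlow β U₀ U₁ u₂ t
        + ∫ τ in (0 : ℝ)..t, duhamelKernel n β (t - τ) (absPow p (V τ).toL2)).toL2
      = duhamel β p U₀.toL2 U₁.toL2 u₂ (fun τ => (V τ).toL2) t := by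
  have hcs := completeSpace_sobolev (n := n) zero_le_two
  obtain ⟨w₀, w₁, w₂, h₀, h₁, h₂, h⟩ := exists_linearFlow hn hβ U₀ U₁ u₂ ht
  have hint : Continuous fun τ => duhamelKernel n β (t - τ) (absPow p (V τ).toL2) :=
    continuous_duhamelKernel_comp hβ hV t
  have hint' : Continuous fun τ => (duhamelKernel n β (t - τ) (absPow p (V τ).toL2)).toL2 :=
    (inclusionL2 zero_le_two).continuous.comp hint
  rw [toL2_add_integral _ hint, map_add, h, map_add, map_add, h₀, h₁, h₂, duhamel]
  congr 1
  rw [← (toComplex n).intervalIntegral_comp_comm (hint'.intervalIntegrable (μ := volume) 0 t),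
    ← intervalIntegral.integral_smul]
  refine intervalIntegral.integral_congr fun τ hτ => ?_
  rw [uIcc_of_le ht] at hτ
  obtain ⟨w, hw1, hw2⟩ := exists_duhamelKernel hn hβ (sub_nonneg.2 hτ.2) (absPow p (V τ).toL2)
  exact (congrArg (toComplex n) hw2).trans (((toComplex n).map_smul _ _).trans (by rw [hw1]))

/-! ### Supports -/

/-- Restriction to the complement of a ball. -/
def outside (n : ℕ) (r : ℝ) :
    L2 n →L[ℝ] Lp ℝ 2 ((volume : Measure (Rn n)).restrict (Metric.closedBall 0 r)ᶜ) :=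
  LpToLpRestrictCLM (Rn n) ℝ ℝ volume 2 (Metric.closedBall 0 r)ᶜ

/-- Written as the kernel of a bounded linear map, the support condition passes through limits and
Bochner integrals. -/
theorem supportedInBall_iff {f : L2 n} {r : ℝ} : SupportedInBall f r ↔ outside n r f = 0 := by
  have h := LpToLpRestrictCLM_coeFn ℝ (Metric.closedBall (0 : Rn n) r)ᶜ f
  have hm : MeasurableSet (Metric.closedBall (0 : Rn n) r)ᶜ :=
    Metric.isClosed_closedBall.measurableSet.compl
  rw [Lp.eq_zero_iff_ae_eq_zero, SupportedInBall]
  constructor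
  · intro h1
    refine h.trans ((ae_restrict_iff' hm).2 ?_)
    exact h1
  · intro h1
    exact (ae_restrict_iff' hm).1 (h.symm.trans h1)

theorem SupportedInBall.add {f g : L2 n} {r : ℝ} (hf : SupportedInBall f r)
    (hg : SupportedInBall g r) : SupportedInBall (f + g) r := by
  rw [supportedInBall_iff] at *
  rw [map_add, hf, hg, add_zero]

theorem SupportedInBall.smul {f : L2 n} {r : ℝ} (c : ℝ) (hf : SupportedInBall f r) :
    SupportedInBall (c • f) r := by
  rw [supportedInBall_iff] at *
  rw [map_smul, hf, smul_zero]

theorem isClosed_supportedInBall (r : ℝ) :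
    IsClosed {F : Sobolev n 2 | SupportedInBall F.toL2 r} := by
  simp only [supportedInBall_iff]
  exact isClosed_eq ((outside n r).continuous.comp (inclusionL2 zero_le_two).continuous)
    continuous_const

/-- The Duhamel operator preserves the light cone. -/
theorem supportedInBall_mildOperator (hn : 1 ≤ n) {β p R : ℝ} (hβ : 0 < β) (hp : p ≠ 0)
    (hR : 0 ≤ R) {U₀ : Sobolev n 2} {U₁ : Sobolev n 1} {u₂ : L2 n}
    (h₀ : SupportedInBall U₀.toL2 R) (h₁ : SupportedInBall U₁.toL2 R)
    (h₂ : SupportedInBall u₂ R) {V : ℝ → Sobolev n 2}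
    (hV : Continuous fun τ => absPow p (V τ).toL2) {t : ℝ} (ht : 0 ≤ t)
    (hsupp : ∀ τ ∈ Icc 0 t, SupportedInBall (V τ).toL2 (R + τ)) :
    SupportedInBall (linearFlow β U₀ U₁ u₂ t
      + ∫ τ in (0 : ℝ)..t, duhamelKernel n β (t - τ) (absPow p (V τ).toL2)).toL2 (R + t) := by
  have hcs := completeSpace_sobolev (n := n) zero_le_two
  obtain ⟨w₀, w₁, w₂, e₀, e₁, e₂, e⟩ := exists_linearFlow hn hβ U₀ U₁ u₂ ht
  have hint : Continuous fun τ => duhamelKernel n β (t - τ) (absPow p (V τ).toL2) :=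
    continuous_duhamelKernel_comp hβ hV t
  have hint' : Continuous fun τ => (duhamelKernel n β (t - τ) (absPow p (V τ).toL2)).toL2 :=
    (inclusionL2 zero_le_two).continuous.comp hint
  rw [toL2_add_integral _ hint, e]
  refine ((((isWaveSymbol_symbol₀ hβ.ne' t).supportedInBall ht (symbol₀_memLp n β t) e₀ hR h₀).add
    ((isWaveSymbol_symbol₁ t).supportedInBall ht (symbol₁_memLp n t) e₁ hR h₁)).add
    ((isWaveSymbol_symbol₂ hβ.ne' t).supportedInBall ht (symbol₂_memLp n β t) e₂ hR h₂)).add ?_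
  rw [supportedInBall_iff]
  refine ((outside n (R + t)).intervalIntegral_comp_comm
    (hint'.intervalIntegrable (μ := volume) 0 t)).symm.trans ?_
  refine (intervalIntegral.integral_congr fun τ hτ => ?_).trans intervalIntegral.integral_zero
  rw [uIcc_of_le ht] at hτ
  obtain ⟨w, hw1, hw2⟩ := exists_duhamelKernel hn hβ (sub_nonneg.2 hτ.2) (absPow p (V τ).toL2)
  have h := (isWaveSymbol_symbol₂ hβ.ne' (t - τ)).supportedInBall (sub_nonneg.2 hτ.2)
    (symbol₂_memLp n β (t - τ)) hw1
    (add_nonneg hR hτ.1) (supportedInBall_absPow hp (hsupp τ hτ))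
  -- The source at time τ lives in the ball of radius R + τ and travels for time t − τ.
  rw [show R + τ + (t - τ) = R + t by ring] at h
  have h' := h.smul (1 / β)
  rw [← hw2] at h'
  exact supportedInBall_iff.1 h'

/-! ### Time regularity -/

/-- The Fourier transform of the Duhamel operator, with general symbols. -/
def fourierCurve (κ : ℝ) (a b c : ℝ → Rn n → ℝ) (z₀ z₁ z₂ : L2C n) (h : ℝ → L2C n) (t : ℝ) :
    L2C n :=
  mulOp (a t) z₀ + mulOp (b t) z₁ + mulOp (c t) z₂
    + κ • ∫ τ in (0 : ℝ)..t, mulOp (c (t - τ)) (h τ)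

section regularity

variable {κ : ℝ} {a b c a' b' c' a'' b'' c'' : ℝ → Rn n → ℝ} {z₀ z₁ z₂ : L2C n} {h : ℝ → L2C n}

theorem continuous_fourierCurve (ha : IsSymbolFamily a) (hb : IsSymbolFamily b)
    (hc : IsSymbolFamily c) (hh : Continuous h) :
    Continuous (fourierCurve κ a b c z₀ z₁ z₂ h) := by
  have key : ∀ {a : ℝ → Rn n → ℝ} (_ : IsSymbolFamily a) (z : L2C n),
      Continuous fun t => mulOp (a t) z := fun ha z =>
    ha.continuous_mulOp.comp (continuous_id.prodMk continuous_const)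
  exact (((key ha z₀).add (key hb z₁)).add (key hc z₂)).add
    ((continuous_duhamel (A := fun t y => mulOp (c t) y) hc.continuous_mulOp hh).const_smul κ)

/-- Because c vanishes at time zero there is no boundary term, and the derivative is again a curve
of the same type, so the lemma can be iterated. -/
theorem hasDerivAt_fourierCurve (ha : IsSymbolFamily a) (hb : IsSymbolFamily b)
    (hc : IsSymbolFamily c) (ha' : IsSymbolFamily a') (hb' : IsSymbolFamily b')
    (hc' : IsSymbolFamily c') (hda : ∀ t ξ, HasDerivAt (fun s => a s ξ) (a' t ξ) t)
    (hdb : ∀ t ξ, HasDerivAt (fun s => b s ξ) (b' t ξ) t)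
    (hdc : ∀ t ξ, HasDerivAt (fun s => c s ξ) (c' t ξ) t) (hc0 : ∀ ξ, c 0 ξ = 0)
    (hh : Continuous h) (t : ℝ) :
    HasDerivAt (fourierCurve κ a b c z₀ z₁ z₂ h) (fourierCurve κ a' b' c' z₀ z₁ z₂ h t) t := by
  have h0 : ∀ y : L2C n, mulOp (c 0) y = 0 := fun y => by
    refine mulOp_eq_of_ae (hc.isSymbol 0) ?_
    filter_upwards [Lp.coeFn_zero ℂ 2 (volume : Measure (Rn n))] with ξ hξ
    rw [hξ, hc0]
    simp
  exact (((ha.hasDerivAt_mulOp ha' hda z₀ t).add (hb.hasDerivAt_mulOp hb' hdb z₁ t)).add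
    (hc.hasDerivAt_mulOp hc' hdc z₂ t)).add
    ((hasDerivAt_duhamel (A := fun t y => mulOp (c t) y) (A' := fun t y => mulOp (c' t) y)
      hc.continuous_mulOp hc'.continuous_mulOp
      (fun t y => hc.hasDerivAt_mulOp hc' hdc y t) h0 hh t).const_smul κ)

theorem contDiff_one_of_hasDerivAt {X : Type*} [NormedAddCommGroup X] [NormedSpace ℝ X]
    {f f' : ℝ → X} (hf : ∀ t, HasDerivAt f (f' t) t) (hf' : Continuous f') : ContDiff ℝ 1 f := by
  rw [contDiff_one_iff_deriv]
  refine ⟨fun t => (hf t).differentiableAt, ?_⟩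
  rwa [funext fun t => (hf t).deriv]

theorem contDiff_two_of_hasDerivAt {X : Type*} [NormedAddCommGroup X] [NormedSpace ℝ X]
    {f f' : ℝ → X} (hf : ∀ t, HasDerivAt f (f' t) t) (hf' : ContDiff ℝ 1 f') : ContDiff ℝ 2 f := by
  rw [show (2 : WithTop ℕ∞) = 1 + 1 by norm_num, contDiff_succ_iff_deriv]
  refine ⟨fun t => (hf t).differentiableAt, by simp, ?_⟩
  rwa [funext fun t => (hf t).deriv]

/-- The weight ⟨ξ⟩ is affordable on both levels: the curve itself has decay of order two, its
derivative decay of order one. -/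
theorem contDiff_one_fourierCurve (ha : IsEnergyFamily a a' a'') (hb : IsEnergyFamily b b' b'')
    (hc : IsEnergyFamily c c' c'') (hc0 : ∀ ξ, c 0 ξ = 0) (hh : Continuous h) :
    ContDiff ℝ 1 (fourierCurve κ (fun t ξ => bracket n 1 ξ * a t ξ)
      (fun t ξ => bracket n 1 ξ * b t ξ) (fun t ξ => bracket n 1 ξ * c t ξ) z₀ z₁ z₂ h) :=
  contDiff_one_of_hasDerivAt
    (hasDerivAt_fourierCurve (ha.order_zero.bracket_mul one_le_two)
      (hb.order_zero.bracket_mul one_le_two) (hc.order_zero.bracket_mul one_le_two)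
      ha.order_one hb.order_one hc.order_one (fun t ξ => (ha.hasDerivAt t ξ).const_mul _)
      (fun t ξ => (hb.hasDerivAt t ξ).const_mul _) (fun t ξ => (hc.hasDerivAt t ξ).const_mul _)
      (fun ξ => by rw [hc0, mul_zero]) hh)
    (continuous_fourierCurve ha.order_one hb.order_one hc.order_one hh)

/-- The second differentiation needs `c'` to vanish at time zero as well. -/
theorem contDiff_two_fourierCurve (ha : IsEnergyFamily a a' a'') (hb : IsEnergyFamily b b' b'')
    (hc : IsEnergyFamily c c' c'') (hc0 : ∀ ξ, c 0 ξ = 0) (hc0' : ∀ ξ, c' 0 ξ = 0)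
    (hh : Continuous h) : ContDiff ℝ 2 (fourierCurve κ a b c z₀ z₁ z₂ h) :=
  contDiff_two_of_hasDerivAt
    (hasDerivAt_fourierCurve ha.isSymbolFamily hb.isSymbolFamily hc.isSymbolFamily
      ha.isSymbolFamily' hb.isSymbolFamily' hc.isSymbolFamily' ha.hasDerivAt hb.hasDerivAt
      hc.hasDerivAt hc0 hh)
    (contDiff_one_of_hasDerivAt
      (hasDerivAt_fourierCurve ha.isSymbolFamily' hb.isSymbolFamily' hc.isSymbolFamily'
        ha.order_two hb.order_two hc.order_two ha.hasDerivAt' hb.hasDerivAt' hc.hasDerivAt'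
        hc0' hh)
      (continuous_fourierCurve ha.order_two hb.order_two hc.order_two hh))

theorem mulOp_bracket_fourierCurve {s : ℝ} (hs : 0 ≤ s)
    (ha : IsSymbolFamily fun t ξ => bracket n s ξ * a t ξ)
    (hb : IsSymbolFamily fun t ξ => bracket n s ξ * b t ξ)
    (hc : IsSymbolFamily fun t ξ => bracket n s ξ * c t ξ) (hh : Continuous h) (t : ℝ) :
    mulOp (bracket n (-s)) (fourierCurve κ (fun t ξ => bracket n s ξ * a t ξ)
      (fun t ξ => bracket n s ξ * b t ξ) (fun t ξ => bracket n s ξ * c t ξ) z₀ z₁ z₂ h t)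
      = fourierCurve κ a b c z₀ z₁ z₂ h t := by
  have hint : Continuous fun τ => mulOp (fun ξ => bracket n s ξ * c (t - τ) ξ) (h τ) :=
    hc.continuous_mulOp.comp ((continuous_const.sub continuous_id).prodMk hh)
  rw [fourierCurve, map_add, map_add, map_add, mulOp_bracket_mulOp hs (ha.isSymbol t),
    mulOp_bracket_mulOp hs (hb.isSymbol t), mulOp_bracket_mulOp hs (hc.isSymbol t),
    ContinuousLinearMap.map_smul_of_tower,
    ← ContinuousLinearMap.intervalIntegral_comp_comm _ (hint.intervalIntegrable _ _), fourierCurve]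
  simp only [mulOp_bracket_mulOp hs (hc.isSymbol _)]

end regularity

theorem isCkSobolev_of_contDiff {k : ℕ} {s T : ℝ} (hs : 0 ≤ s) {Z : ℝ → L2C n}
    (hZ : ContDiff ℝ k Z) {u : ℝ → L2 n}
    (h : ∀ t ∈ Icc 0 T, mulOp (bracket n (-s)) (Z t) = fourierL2 n (u t)) :
    IsCkSobolev k s T u :=
  ⟨fun t => sobolevProj n hs (Z t), ((sobolevProj n hs).contDiff.comp hZ).contDiffOn,
    fun t ht => toL2_sobolevProj hs (h t ht)⟩

theorem fourier_duhamel {β p : ℝ} (hβ : 0 < β) (U₀ : Sobolev n 2) (U₁ : Sobolev n 1) (u₂ : L2 n)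
    {v : ℝ → L2 n} (hv : Continuous fun τ => absPow p (v τ)) (t : ℝ) :
    𝓕 (duhamel β p U₀.toL2 U₁.toL2 u₂ v t)
      = fourierCurve (1 / β) (propagator₀ β) propagator₁ (propagator₂ β) (weightedFourier n 2 U₀)
        (weightedFourier n 1 U₁) (fourierL2 n u₂) (fun τ => fourierL2 n (absPow p (v τ))) t := by
  let Φ : L2C n →L[ℂ] L2C n := (Lp.fourierTransformₗᵢ (Rn n) ℂ).toContinuousLinearEquiv
  have hΦ : ∀ f : L2C n, 𝓕 f = Φ f := fun f => rfl
  have hK : Continuous fun τ => K₂ β (t - τ) (absPow p (v τ)) := by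
    have h1 : ∀ τ, K₂ β (t - τ) (absPow p (v τ))
        = (Lp.fourierTransformₗᵢ (Rn n) ℂ).symm (mulOp (propagator₂ β (t - τ))
          (fourierL2 n (absPow p (v τ)))) := fun τ => by
      rw [← fourier_K₂ hβ]
      exact ((Lp.fourierTransformₗᵢ (Rn n) ℂ).symm_apply_apply _).symm
    simp only [h1]
    refine (Lp.fourierTransformₗᵢ (Rn n) ℂ).symm.continuous.comp ?_
    exact (isEnergyFamily_symbol₂ hβ).isSymbolFamily.continuous_mulOp.comp
      ((continuous_const.sub continuous_id).prodMk ((fourierL2 n).continuous.comp hv))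
  rw [duhamel, fourierCurve, hΦ, map_add, map_add, map_add, ContinuousLinearMap.map_smul_of_tower,
    ← Φ.intervalIntegral_comp_comm (hK.intervalIntegrable _ _)]
  simp only [← hΦ]
  rw [fourier_K₀ hβ, fourier_K₁, fourier_K₂ hβ]
  simp only [fourier_K₂ hβ]

theorem continuous_K₂ {β : ℝ} (hβ : 0 < β) :
    Continuous fun q : ℝ × L2 n => K₂ β q.1 q.2 := by
  have h1 : ∀ q : ℝ × L2 n, K₂ β q.1 q.2
      = (Lp.fourierTransformₗᵢ (Rn n) ℂ).symm (mulOp (propagator₂ β q.1)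
        (fourierL2 n q.2)) := fun q => by
    rw [← fourier_K₂ hβ]
    exact ((Lp.fourierTransformₗᵢ (Rn n) ℂ).symm_apply_apply _).symm
  simp only [h1]
  refine (Lp.fourierTransformₗᵢ (Rn n) ℂ).symm.continuous.comp ?_
  exact (isEnergyFamily_symbol₂ hβ).isSymbolFamily.continuous_mulOp.comp
    (continuous_fst.prodMk ((fourierL2 n).continuous.comp continuous_snd))

end propagators

/-! ### Well-posedness -/

section wellPosed

variable {n : ℕ} {β p : ℝ}

theorem propagator₂_zero (ξ : Rn n) : propagator₂ β 0 ξ = 0 := by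
  simp [propagator₂, symbol₂]

theorem symbol₂'_zero (r : ℝ) : symbol₂' β 0 r = 0 := by
  simp [symbol₂']

/-- Curves in `H²` which are fixed points of the Duhamel operator belong to the energy class. -/
theorem isInEnergyClass_of_fixedPoint (hβ : 0 < β) {T : ℝ} {U₀ : Sobolev n 2} {U₁ : Sobolev n 1}
    {u₂ : L2 n} {V : ℝ → Sobolev n 2} (hV : Continuous V)
    (hVp : Continuous fun τ => absPow p (V τ).toL2)
    (hfix : ∀ t ∈ Icc 0 T, toComplex n (V t).toL2
      = duhamel β p U₀.toL2 U₁.toL2 u₂ (fun τ => (V τ).toL2) t) :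
    IsInEnergyClass T fun t => (V t).toL2 := by
  have hh : Continuous fun τ => fourierL2 n (absPow p (V τ).toL2) :=
    (fourierL2 n).continuous.comp hVp
  have hF : ∀ t ∈ Icc 0 T, fourierL2 n (V t).toL2 = fourierCurve (1 / β) (propagator₀ β)
      propagator₁ (propagator₂ β) (weightedFourier n 2 U₀) (weightedFourier n 1 U₁)
      (fourierL2 n u₂) (fun τ => fourierL2 n (absPow p (V τ).toL2)) t := fun t ht => by
    rw [fourierL2_apply, hfix t ht, fourier_duhamel hβ U₀ U₁ u₂ hVp]
  have E₀ := isEnergyFamily_symbol₀ (n := n) hβ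
  have E₁ := isEnergyFamily_symbol₁ (n := n)
  have E₂ := isEnergyFamily_symbol₂ (n := n) hβ
  refine ⟨⟨V, contDiffOn_zero.2 hV.continuousOn, fun t _ => rfl⟩, ?_, ?_⟩
  · refine isCkSobolev_of_contDiff zero_le_one
      (contDiff_one_fourierCurve (κ := 1 / β) (z₀ := weightedFourier n 2 U₀)
        (z₁ := weightedFourier n 1 U₁) (z₂ := fourierL2 n u₂) E₀ E₁ E₂
        propagator₂_zero hh) fun t ht => ?_
    rw [hF t ht]
    exact mulOp_bracket_fourierCurve zero_le_one (E₀.order_zero.bracket_mul one_le_two)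
      (E₁.order_zero.bracket_mul one_le_two) (E₂.order_zero.bracket_mul one_le_two) hh t
  -- The L² statement is obtained as the case s = 0, where the weight is 1, and then passed through
  -- the inclusion of H⁰ in L².
  · have h : IsCkSobolev 2 0 T fun t => (V t).toL2 := by
      refine isCkSobolev_of_contDiff le_rfl
        (contDiff_two_fourierCurve (κ := 1 / β) (z₀ := weightedFourier n 2 U₀)
        (z₁ := weightedFourier n 1 U₁) (z₂ := fourierL2 n u₂) E₀ E₁ E₂
        propagator₂_zero (fun ξ => symbol₂'_zero _) hh)
        fun t ht => ?_
      rw [hF t ht]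
      refine mulOp_eq_of_ae (isSymbol_bracket (by simp)) (Filter.Eventually.of_forall fun ξ => ?_)
      simp only [neg_zero, bracket_zero, Complex.ofReal_one, one_mul]
      rfl
    obtain ⟨w, hw, hwV⟩ := h
    exact ((inclusionL2 le_rfl).contDiff.comp_contDiffOn hw).congr fun t ht => (hwV t ht).symm

theorem isMildSolution_of_fixedPoint (hβ : 0 < β) {T : ℝ} {u₀ u₁ u₂ : L2 n}
    {V : ℝ → Sobolev n 2} (hVp : Continuous fun τ => absPow p (V τ).toL2)
    (hmem : ∀ f : Sobolev n 2, MemLp (fun x => |f.toL2 x| ^ p) 2 (volume : Measure (Rn n)))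
    (hfix : ∀ t ∈ Icc 0 T, toComplex n (V t).toL2
      = duhamel β p u₀ u₁ u₂ (fun τ => (V τ).toL2) t) :
    IsMildSolution β p u₀ u₁ u₂ T fun t => (V t).toL2 where
  memLp t _ := hmem (V t)
  integrable t _ := by
    have h1 : Continuous fun τ => (t - τ, absPow p (V τ).toL2) := by fun_prop
    have h2 := (continuous_K₂ hβ).comp h1
    exact h2.intervalIntegrable 0 t
  fixedPoint := hfix

theorem toL2_injective {s : ℝ} : Function.Injective (Sobolev.toL2 (n := n) (s := s)) :=
  Subtype.val_injective

/-- Mild solutions in `C([0, T], H²)` solve the integral equation in `H²`. -/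
theorem IsMildSolution.eq_linearFlow_add (hn : 1 ≤ n) (hβ : 0 < β) {T : ℝ} (hT : 0 ≤ T)
    {U₀ : Sobolev n 2} {U₁ : Sobolev n 1} {u₂ : L2 n} {v : ℝ → L2 n}
    (hv : IsMildSolution β p U₀.toL2 U₁.toL2 u₂ T v)
    (hG : Continuous fun f : Sobolev n 2 => absPow p f.toL2) {V : ℝ → Sobolev n 2}
    (hV : ContinuousOn V (Icc 0 T)) (hVv : ∀ t ∈ Icc 0 T, (V t).toL2 = v t) :
    ∀ t ∈ Icc 0 T, V t = linearFlow β U₀ U₁ u₂ t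
      + ∫ τ in (0 : ℝ)..t, duhamelKernel n β (t - τ) (absPow p (V τ).toL2) := by
  intro t ht
  -- The curve is known to be continuous on [0, T] only, so it is clamped in time before the
  -- integral identities are applied.
  let W : ℝ → Sobolev n 2 := fun τ => V (projIcc 0 T hT τ)
  have hW : ∀ τ ∈ uIcc 0 t, W τ = V τ := fun τ hτ => by
    rw [uIcc_of_le ht.1] at hτ
    exact congrArg V (congrArg Subtype.val (projIcc_of_mem hT ⟨hτ.1, hτ.2.trans ht.2⟩))
  have hWc : Continuous W :=
    hV.comp_continuous (continuous_subtype_val.comp continuous_projIcc) fun τ =>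
      (projIcc 0 T hT τ).2
  have h1 := toComplex_mildOperator hn hβ U₀ U₁ u₂ (hG.comp hWc) ht.1
  have h2 : duhamel β p U₀.toL2 U₁.toL2 u₂ (fun τ => (W τ).toL2) t
      = duhamel β p U₀.toL2 U₁.toL2 u₂ v t := by
    rw [duhamel, duhamel]
    congr 2
    refine intervalIntegral.integral_congr fun τ hτ => ?_
    have hτ' := hτ
    rw [uIcc_of_le ht.1] at hτ'
    simp only [hW τ hτ, hVv τ ⟨hτ'.1, hτ'.2.trans ht.2⟩]
  have h3 : ∫ τ in (0 : ℝ)..t, duhamelKernel n β (t - τ) (absPow p (W τ).toL2)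
      = ∫ τ in (0 : ℝ)..t, duhamelKernel n β (t - τ) (absPow p (V τ).toL2) :=
    intervalIntegral.integral_congr fun τ hτ => by simp only [hW τ hτ]
  apply toL2_injective
  apply toComplex_injective n
  rw [hVv t ht, hv.fixedPoint t ht, ← h2, ← h1, ← h3]

/-- Local existence and uniqueness of mild solutions in the energy class, and finite speed of
propagation. -/
theorem exists_unique_mild (hn : 1 ≤ n) (hβ : 0 < β) (hp : 1 < p)
    (hpn : 3 ≤ n → p ≤ (n : ℝ) / ((n : ℝ) - 2)) {R : ℝ} (hR : 0 ≤ R) (U₀ : Sobolev n 2)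
    (U₁ : Sobolev n 1) (u₂ : L2 n) (hs₀ : SupportedInBall U₀.toL2 R)
    (hs₁ : SupportedInBall U₁.toL2 R) (hs₂ : SupportedInBall u₂ R) :
    ∃ T : ℝ, 0 < T ∧ ∃ u : ℝ → L2 n, IsInEnergyClass T u ∧
      IsMildSolution β p U₀.toL2 U₁.toL2 u₂ T u ∧
      (∀ t ∈ Icc 0 T, SupportedInBall (u t) (R + t)) ∧
      ∀ v : ℝ → L2 n, IsInEnergyClass T v → IsMildSolution β p U₀.toL2 U₁.toL2 u₂ T v →
        ∀ t ∈ Icc 0 T, v t = u t := by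
  have hcs := completeSpace_sobolev (n := n) zero_le_two
  obtain ⟨hmem, hG⟩ := absPow_sobolev (n := n) hp (lt_four_add_of_le hp hpn)
  have hGc : Continuous fun f : Sobolev n 2 => absPow p f.toL2 := continuous_of_lipschitz_on_balls hG
  obtain ⟨M, hM0, hM⟩ := exists_norm_duhamelKernel_le (n := n) hβ 1
  have hS := continuous_duhamelKernel (n := n) hβ
  -- The closed sets P(t) encode the light cone, so the fixed point is found with the right support.
  obtain ⟨T, hT, V, hV, hVs, hVeq⟩ := exists_mild_solution (S := duhamelKernel n β)
    (G := fun f : Sobolev n 2 => absPow p f.toL2) hS hM0 hM hGc hG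
    (continuous_linearFlow hβ U₀ U₁ u₂) (P := fun t => {F | SupportedInBall F.toL2 (R + t)})
    (fun t => isClosed_supportedInBall _)
    (fun t => supportedInBall_iff.2 (by rw [map_zero, map_zero]))
    (fun V T hV hVs t ht => supportedInBall_mildOperator hn hβ (by linarith) hR hs₀ hs₁ hs₂
      (hGc.comp hV) ht.1 fun τ hτ => hVs τ ⟨hτ.1, hτ.2.trans ht.2⟩)
  have hVp : Continuous fun τ => absPow p (V τ).toL2 := hGc.comp hV
  have hfix : ∀ t ∈ Icc 0 T, toComplex n (V t).toL2
      = duhamel β p U₀.toL2 U₁.toL2 u₂ (fun τ => (V τ).toL2) t := fun t ht => by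
    rw [← toComplex_mildOperator hn hβ U₀ U₁ u₂ hVp ht.1, ← hVeq t ht]
  refine ⟨T, hT, fun t => (V t).toL2, isInEnergyClass_of_fixedPoint hβ hV hVp hfix,
    isMildSolution_of_fixedPoint hβ hVp hmem hfix, hVs, fun v hv hmild t ht => ?_⟩
  -- Uniqueness uses only the C([0, T], H²) part of the energy class.
  obtain ⟨W, hW, hWv⟩ := hv.1
  have hWc : ContinuousOn W (Icc 0 T) := contDiffOn_zero.1 hW
  obtain ⟨M', hM0', hM'⟩ := exists_norm_duhamelKernel_le (n := n) hβ T
  have h := mild_solution_unique (S := duhamelKernel n β)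
    (G := fun f : Sobolev n 2 => absPow p f.toL2) hS hT.le hM0' hM' hGc hG hWc hV.continuousOn
    (hmild.eq_linearFlow_add hn hβ hT.le hGc hWc hWv) hVeq t ht
  rw [← hWv t ht, h]

end wellPosed

end MGT

end

theorem theorem3p1 (n : ℕ) (hn : 1 ≤ n) (β : ℝ) (hβ : 0 < β)
    (p : ℝ) (hp : 1 < p) (hpn : 3 ≤ n → p ≤ (n : ℝ) / ((n : ℝ) - 2))
    (R : ℝ) (hR : 0 < R) (u₀ u₁ u₂ : MGT.L2 n)
    (hu₀ : u₀ ∈ MGT.sobolevSubmodule n 2) (hu₁ : u₁ ∈ MGT.sobolevSubmodule n 1)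
    (hs₀ : MGT.SupportedInBall u₀ R) (hs₁ : MGT.SupportedInBall u₁ R)
    (hs₂ : MGT.SupportedInBall u₂ R) :
    ∃ T : ℝ, 0 < T ∧ ∃ u : ℝ → MGT.L2 n,
      MGT.IsInEnergyClass T u ∧
      MGT.IsMildSolution β p u₀ u₁ u₂ T u ∧
      (∀ t ∈ Set.Icc 0 T, MGT.SupportedInBall (u t) (R + t)) ∧
      ∀ v : ℝ → MGT.L2 n, MGT.IsInEnergyClass T v → MGT.IsMildSolution β p u₀ u₁ u₂ T v →
        ∀ t ∈ Set.Icc 0 T, v t = u t := by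
  exact MGT.exists_unique_mild hn hβ hp hpn hR.le ⟨u₀, hu₀⟩ ⟨u₁, hu₁⟩ u₂ hs₀ hs₁ hs₂
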